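/- Let $g\ge 0$, let $\Sigma_{g,1}$ be a compact connected oriented surface of genus $g$ with one boundary component, $\pi=\pi_1(\Sigma_{g,1},x_0)$ and $H=H_1(\Sigma_{g,1};\mathbb{Q})=\mathbb{Q}\otimes\pi^{\mathrm{ab}}$. Let $\epsilon\colon\mathbb{Q}\pi\to\mathbb{Q}$ be the augmentation, $I=\ker\epsilon$, $\hat R=\widehat{\mathbb{Q}\pi}=\varprojlim_n\mathbb{Q}\pi/I^n$, and let $\hat I$ be the kernel of the induced augmentation $\epsilon\colon\hat R\to\mathbb{Q}$. Put $H_1^{\mathrm{Lie}}(\hat I)=\hat I/[\hat I,\hat I]$, where $[\hat I,\hat I]$ is the linear span of the commutators $xy-yx$ with $x,y\in\hat I$ (not closed up). Let $K_1(\hat R)$ be the abelianization of $\mathrm{GL}(\hat R)=\varinjlim_N\mathrm{GL}(N,\hat R)$. For $n\ge1$ let $H^{\otimes n}/\mathbb{Z}_n$ denote the coinvariants of $H^{\otimes n}$ under cyclic permutation of the tensor factors. Let $\hat T=\prod_{n\ge0}H^{\otimes n}$ be the completed tensor algebra. A Magnus expansion is a multiplicative map $\theta\colon\pi\to\hat T$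 with $\theta(x)=1+[x]+(\text{terms of degree}\ge2)$ for all $x\in\pi$; it extends to an algebra homomorphism $\hat\theta\colon\hat R\to\hat T$. For $x\in\hat R$ let $\theta^{\mathrm{cyc}}(x)\in\prod_{n\ge1}H^{\otimes n}/\mathbb{Z}_n$ be the class of the part of $\hat\theta(x)$ of positive degree. **Theorem 1.1.** The group $K_1(\widehat{\mathbb{Q}\pi})$ is isomorphic to $\mathbb{Q}^\times\oplus\prod_{n\ge1}H^{\otimes n}/\mathbb{Z}_n$. More precisely: 1. The map $(\hat R^\times)_{\mathrm{ab}}\to K_1(\hat R)$ induced by $\hat R^\times=\mathrm{GL}(1,\hat R)$ is an isomorphism; its inverse is the Dieudonné determinant. 2. For $A\in\mathrm{GL}(N,\hat R)$ the series $\log(A\epsilon(A)^{-1})=\sum_{n\ge1}\frac{(-1)^{n-1}}{n}(A\epsilon(A)^{-1}-1)^n$ converges $I$-adically, its trace lies in $\hat I$, and $$A\mapsto\bigl(\det\epsilon(A),\ \operatorname{tr}\log(A\epsilon(A)^{-1})\bigr)$$ induces a group isomorphism $\widetilde{\ell\!\operatorname{det}}\colon K_1(\hat R)\to\mathbb{Q}^\times\oplus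 H_1^{\mathrm{Lie}}(\hat I)$. 3. Magnus expansions exist. For every Magnus expansion $\theta$, the map $\theta^{\mathrm{cyc}}$ induces a $\mathbb{Q}$-linear isomorphism $\theta_*\colon H_1^{\mathrm{Lie}}(\hat I)\to\prod_{n\ge1}H^{\otimes n}/\mathbb{Z}_n$. Hence $$\Phi_\theta=(\mathrm{id}\oplus\theta_*)\circ\widetilde{\ell\!\operatorname{det}}\colon K_1(\hat R)\to\mathbb{Q}^\times\oplus\prod_{n\ge1}H^{\otimes n}/\mathbb{Z}_n,\qquad [A]\mapsto\bigl(\det\epsilon(A),\ \theta^{\mathrm{cyc}}(\operatorname{tr}\log(A\epsilon(A)^{-1}))\bigr),$$ is a group isomorphism. 4. If $g\ge1$, the isomorphism $\Phi_\theta$ depends on the choice of $\theta$: there are Magnus expansions $\theta,\theta'$ with $\Phi_\theta\ne\Phi_{\theta'}$. -/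

import Mathlib

open scoped TensorProduct

noncomputable section

/-! ## The surface of genus `g` with one boundary component -/

/-- The closed rectangle `[0, 8g + 1] × [0, 1]`, a closed disc. -/
abbrev Rect (g : ℕ) : Type :=
  ↥(Set.Icc (0 : ℝ) (8 * g + 1) ×ˢ Set.Icc (0 : ℝ) 1)

/-- The gluing on the rectangle. The `j`-th handle uses four disjoint intervals of length `1` on
the bottom side, starting at `8j + 1`, `8j + 3`, `8j + 5`, `8j + 7`. The first is identified with
the third and the second with the fourth, each time by the orientation-reversing isometry. -/
inductive SurfaceGlue (g : ℕ) : Rect g → Rect g → Prop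
  | first (j : Fin g) (t : ℝ) (p q : Rect g) (ht : t ∈ Set.Icc (0 : ℝ) 1)
      (hp : p.1 = (8 * (j : ℝ) + 1 + t, 0)) (hq : q.1 = (8 * (j : ℝ) + 6 - t, 0)) :
      SurfaceGlue g p q
  | second (j : Fin g) (t : ℝ) (p q : Rect g) (ht : t ∈ Set.Icc (0 : ℝ) 1)
      (hp : p.1 = (8 * (j : ℝ) + 3 + t, 0)) (hq : q.1 = (8 * (j : ℝ) + 8 - t, 0)) :
      SurfaceGlue g p q

/-- The compact oriented surface `Σ_{g,1}` of genus `g` with one boundary component: a closed disc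
with `2g` pairs of disjoint boundary arcs glued (equivalently, with `2g` bands attached), orientably
and in the pattern `a₁ b₁ a₁⁻¹ b₁⁻¹ ⋯ a_g b_g a_g⁻¹ b_g⁻¹`. It carries the quotient topology. -/
def Surface (g : ℕ) : Type := Quot (SurfaceGlue g)

instance (g : ℕ) : TopologicalSpace (Surface g) :=
  inferInstanceAs (TopologicalSpace (Quot (SurfaceGlue g)))

/-- The group `π = π₁(Σ_{g,1}, x₀)`. -/
abbrev SurfaceGroup (g : ℕ) (x₀ : Surface g) : Type := FundamentalGroup (Surface g) x₀

/-! ## The group `K₁` -/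

section KOne

variable (R : Type*) [Ring R]

/-- The stabilization `A ↦ A ⊕ 1`, from `m × m` matrices to `n × n` matrices (for `m ≤ n`). -/
def stabMatrix {R : Type*} [Ring R] (m n : ℕ) (A : Matrix (Fin m) (Fin m) R) :
    Matrix (Fin n) (Fin n) R :=
  Matrix.of fun i j =>
    if h : i.val < m ∧ j.val < m then A ⟨i.val, h.1⟩ ⟨j.val, h.2⟩
    else if i.val = j.val then 1 else 0

theorem stabMatrix_one (m n : ℕ) :
    stabMatrix m n (1 : Matrix (Fin m) (Fin m) R) = 1 := by
  ext i j
  simp only [stabMatrix, Matrix.of_apply, Matrix.one_apply, Fin.ext_iff]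
  split_ifs <;> rfl

theorem stabMatrix_mul {m n : ℕ} (h : m ≤ n) (A B : Matrix (Fin m) (Fin m) R) :
    stabMatrix m n (A * B) = stabMatrix m n A * stabMatrix m n B := by
  obtain ⟨d, rfl⟩ := Nat.exists_eq_add_of_le h
  have h1 : ∀ (i : Fin m) (j : Fin d), ¬ (i.val = m + j.val) := fun i j => by omega
  have h2 : ∀ (i : Fin m) (j : Fin d), ¬ (m + j.val = i.val) := fun i j => by omega
  ext i j
  refine Fin.addCases (fun i => ?_) (fun i => ?_) i <;>
  refine Fin.addCases (fun j => ?_) (fun j => ?_) j <;>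
  simp [stabMatrix, Matrix.mul_apply, Fin.sum_univ_add, h1, h2]
  simp [← Fin.ext_iff]

theorem stabMatrix_stabMatrix {l m n : ℕ} (h : l ≤ m) (A : Matrix (Fin l) (Fin l) R) :
    stabMatrix m n (stabMatrix l m A) = stabMatrix l n A := by
  ext i j
  simp only [stabMatrix, Matrix.of_apply]
  split_ifs <;> first | rfl | omega

theorem stabMatrix_self {n : ℕ} (A : Matrix (Fin n) (Fin n) R) : stabMatrix n n A = A := by
  ext i j
  simp [stabMatrix]

/-- The stabilization `GL(m, R) → GL(n, R)` for `m ≤ n`. -/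
def stabGL (m n : ℕ) (h : m ≤ n) :
    (Matrix (Fin m) (Fin m) R)ˣ →* (Matrix (Fin n) (Fin n) R)ˣ :=
  Units.map
    { toFun := stabMatrix m n
      map_one' := stabMatrix_one R m n
      map_mul' := stabMatrix_mul R h }

instance : DirectedSystem (fun n : ℕ => (Matrix (Fin n) (Fin n) R)ˣ)
    (fun m n h => ⇑(stabGL R m n h)) where
  map_self _ _ := Units.ext (stabMatrix_self R _)
  map_map _ _ _ h _ _ := Units.ext (stabMatrix_stabMatrix R h _)

/-- The stable general linear group `GL(R) = colim GL(n, R)`. -/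
abbrev StableGL : Type _ :=
  DirectLimit (fun n : ℕ => (Matrix (Fin n) (Fin n) R)ˣ) (stabGL R)

/-- `K₁(R)`, the abelianization of `GL(R)`. -/
abbrev KOne : Type _ := Abelianization (StableGL R)

variable {R}

/-- The class in `K₁(R)` of an invertible matrix. -/
def KOne.mk (n : ℕ) (A : (Matrix (Fin n) (Fin n) R)ˣ) : KOne R :=
  Abelianization.of (⟦⟨n, A⟩⟧ : StableGL R)

/-- The class in `K₁(R)` of a unit of `R`, viewed as a `1 × 1` matrix. -/
def KOne.ofUnit (u : Rˣ) : KOne R :=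
  KOne.mk 1 (Units.map (Matrix.scalar (Fin 1)).toMonoidHom u)

end KOne

/-! ## Completion of an augmented algebra -/

section Completion

variable {R : Type*} [Ring R] [Algebra ℚ R]

/-- The algebra of compatible sequences in the quotients `R / Iⁿ`, `I = ker ε`. -/
def compatSeq (ε : R →ₐ[ℚ] ℚ) : Subalgebra ℚ (∀ n : ℕ, R ⧸ RingHom.ker ε ^ n) where
  carrier := {x | ∀ (m n : ℕ) (h : m ≤ n),
    Ideal.Quotient.factorₐ ℚ (Ideal.pow_le_pow_right h) (x n) = x m}
  mul_mem' hx hy m n h := by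
    rw [Pi.mul_apply, map_mul, hx m n h, hy m n h, Pi.mul_apply]
  add_mem' hx hy m n h := by
    rw [Pi.add_apply, map_add, hx m n h, hy m n h, Pi.add_apply]
  algebraMap_mem' r m n h := by
    rw [Pi.algebraMap_apply, AlgHom.commutes, Pi.algebraMap_apply]

variable (ε : R →ₐ[ℚ] ℚ)

/-- The completion `R̂ = lim R / Iⁿ` of an algebra `R` with augmentation `ε`, `I = ker ε`. -/
def AugCompletion : Type _ := ↥(compatSeq ε)

instance : Ring (AugCompletion ε) := inferInstanceAs (Ring ↥(compatSeq ε))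

instance : Algebra ℚ (AugCompletion ε) := inferInstanceAs (Algebra ℚ ↥(compatSeq ε))

/-- The projection `R̂ → R / Iⁿ`. -/
def complProj (n : ℕ) : AugCompletion ε →ₐ[ℚ] R ⧸ RingHom.ker ε ^ n :=
  (Pi.evalAlgHom ℚ (fun n : ℕ => R ⧸ RingHom.ker ε ^ n) n).comp (compatSeq ε).val

/-- The `I`-adic topology: the coarsest one for which the projections to the discrete `R / Iⁿ` are
continuous. -/
instance : TopologicalSpace (AugCompletion ε) :=
  ⨅ n : ℕ, TopologicalSpace.induced (complProj ε n) ⊥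

/-- The augmentation of the completion, through `R / I`. -/
def complAug : AugCompletion ε →ₐ[ℚ] ℚ :=
  (Ideal.Quotient.liftₐ (RingHom.ker ε ^ 1) ε
    (fun a ha => by rwa [Submodule.pow_one, RingHom.mem_ker] at ha)).comp (complProj ε 1)

/-- The augmentation ideal `Î` of the completion, as a rational vector space. -/
def complIdeal : Submodule ℚ (AugCompletion ε) := LinearMap.ker (complAug ε).toLinearMap

/-- The subspace `[Î, Î]` of `Î`: the span of all commutators (it is not closed up). -/
def complBracket : Submodule ℚ (complIdeal ε) :=
  Submodule.span ℚ {z | ∃ x y : complIdeal ε,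
    (z : AugCompletion ε) = (x : AugCompletion ε) * y - (y : AugCompletion ε) * x}

/-- `H₁^Lie(Î) = Î / [Î, Î]`, the abelianization of the Lie algebra `Î`. -/
abbrev LieHOne : Type _ := complIdeal ε ⧸ complBracket ε

variable {N : ℕ}

/-- `ε : GL(N, R̂) → GL(N, ℚ)`, entry by entry. -/
def augGL : (Matrix (Fin N) (Fin N) (AugCompletion ε))ˣ →* (Matrix (Fin N) (Fin N) ℚ)ˣ :=
  Units.map ((complAug ε).mapMatrix (m := Fin N) : _ →* _)

/-- `A ε(A)⁻¹`, where `ε(A)` is a matrix of scalars. -/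
def normalizeGL (A : (Matrix (Fin N) (Fin N) (AugCompletion ε))ˣ) :
    (Matrix (Fin N) (Fin N) (AugCompletion ε))ˣ :=
  A * (Units.map
    ((Algebra.ofId ℚ (AugCompletion ε)).mapMatrix (m := Fin N) : _ →* _) (augGL ε A))⁻¹

/-- The terms `(-1)ᵏ / (k + 1) (B - 1)ᵏ⁺¹`, `k ≥ 0`, of the logarithm series. -/
def logTerm (B : Matrix (Fin N) (Fin N) (AugCompletion ε)) (k : ℕ) :
    Matrix (Fin N) (Fin N) (AugCompletion ε) :=
  ((-1 : ℚ) ^ k / (k + 1)) • (B - 1) ^ (k + 1)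

/-- The logarithm of a matrix, as the sum of its series in the `I`-adic topology. -/
def matLog (B : Matrix (Fin N) (Fin N) (AugCompletion ε)) :
    Matrix (Fin N) (Fin N) (AugCompletion ε) :=
  ∑' k : ℕ, logTerm ε B k

/-- `tr (log (A ε(A)⁻¹))`. -/
def trLog (A : (Matrix (Fin N) (Fin N) (AugCompletion ε))ˣ) : AugCompletion ε :=
  (matLog ε (normalizeGL ε A : Matrix (Fin N) (Fin N) (AugCompletion ε))).trace

end Completion

/-! ## Tensors and Magnus expansions -/

section Magnus

/-- The permutation of the tensor factors of `H^{⊗ n}` by `σ`. -/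
def permTensor (H : Type*) [AddCommGroup H] [Module ℚ H] (n : ℕ) (σ : Equiv.Perm (Fin n)) :
    (⨂[ℚ]^n H) ≃ₗ[ℚ] (⨂[ℚ]^n H) :=
  PiTensorProduct.reindex ℚ (fun _ : Fin n => H) σ

/-- `H^{⊗ n} / ℤ_n`: coinvariants under the cyclic group generated by the rotation of the
factors. -/
abbrev CyclicTensor (H : Type*) [AddCommGroup H] [Module ℚ H] (n : ℕ) : Type _ :=
  (⨂[ℚ]^n H) ⧸ Submodule.span ℚ {z : ⨂[ℚ]^n H |
    ∃ σ ∈ Subgroup.zpowers (finRotate n), ∃ x : ⨂[ℚ]^n H, z = permTensor H n σ x - x}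

/-- The completed tensor algebra `∏_{n ≥ 0} H^{⊗ n}`: formal series `∑ tₙ Xⁿ` whose coefficient `tₙ`
is a homogeneous tensor of degree `n`. -/
def complTensor (H : Type*) [AddCommGroup H] [Module ℚ H] :
    Subalgebra ℚ (PowerSeries (TensorAlgebra ℚ H)) where
  carrier := {f | ∀ n, PowerSeries.coeff n f ∈ LinearMap.range (TensorAlgebra.ι ℚ (M := H)) ^ n}
  mul_mem' {f h} hf hh n := by
    rw [PowerSeries.coeff_mul]
    refine Submodule.sum_mem _ fun p hp => ?_
    rw [← Finset.HasAntidiagonal.mem_antidiagonal.1 hp, pow_add]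
    exact Submodule.mul_mem_mul (hf _) (hh _)
  add_mem' hf hh n := by
    rw [map_add]
    exact Submodule.add_mem _ (hf n) (hh n)
  algebraMap_mem' r n := by
    rw [PowerSeries.algebraMap_apply, PowerSeries.coeff_C]
    split_ifs with h
    · subst h
      rw [pow_zero]
      exact Submodule.algebraMap_mem r
    · exact Submodule.zero_mem _

variable (G : Type*) [Group G]

/-- `H₁(G; ℚ) = ℚ ⊗ G^ab`. For `G = π₁(X)` this is `H₁(X; ℚ)`. -/
abbrev RatHOne : Type _ := ℚ ⊗[ℤ] Additive (Abelianization G)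

variable {G} in
/-- The class of a group element in `H₁(G; ℚ)`. -/
def ratClass (x : G) : RatHOne G := (1 : ℚ) ⊗ₜ[ℤ] Additive.ofMul (Abelianization.of x)

/-- The augmentation of the rational group ring. -/
def groupAug : MonoidAlgebra ℚ G →ₐ[ℚ] ℚ := MonoidAlgebra.lift ℚ ℚ G 1

/-- The completion of the rational group ring at its augmentation ideal. -/
abbrev GroupCompletion : Type _ := AugCompletion (groupAug G)

/-- A Magnus expansion: a multiplicative map `θ : G → 1 + T̂₁` such that `θ(x) = 1 + [x]` up to terms
of degree at least `2`. -/
structure MagnusExpansion where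
  toHom : G →* complTensor (RatHOne G)
  coeff_zero : ∀ x, PowerSeries.coeff 0 (toHom x).1 = 1
  coeff_one : ∀ x, PowerSeries.coeff 1 (toHom x).1 = TensorAlgebra.ι ℚ (ratClass x)

namespace MagnusExpansion

variable {G} (θ : MagnusExpansion G)

/-- The algebra map `ℚG → T̂` extending `θ`. -/
def algHom : MonoidAlgebra ℚ G →ₐ[ℚ] complTensor (RatHOne G) :=
  MonoidAlgebra.lift ℚ _ G θ.toHom

/-- The degree `n` part, in `H^{⊗ n}`, of the image of an element of `ℚG`. -/
def part (n : ℕ) : MonoidAlgebra ℚ G →ₗ[ℚ] ⨂[ℚ]^n (RatHOne G) :=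
  DirectSum.component ℚ ℕ (fun n => ⨂[ℚ]^n (RatHOne G)) n ∘ₗ
    (TensorAlgebra.toDirectSum (R := ℚ) (M := RatHOne G)).toLinearMap ∘ₗ
    (PowerSeries.coeff n : PowerSeries (TensorAlgebra ℚ (RatHOne G)) →ₗ[_] _).restrictScalars ℚ ∘ₗ
    (complTensor (RatHOne G)).val.toLinearMap ∘ₗ θ.algHom.toLinearMap

theorem coeff_algHom_zero (a : MonoidAlgebra ℚ G) :
    PowerSeries.coeff 0 (θ.algHom a).1 = algebraMap ℚ _ (groupAug G a) := by
  induction a using MonoidAlgebra.induction_linear with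
  | zero => simp
  | add a b ha hb => rw [map_add, map_add, map_add, ← ha, ← hb]; simp
  | single x r =>
    simp [algHom, groupAug, MonoidAlgebra.lift_single, θ.coeff_zero, Algebra.algebraMap_eq_smul_one]

theorem coeff_algHom_eq_zero (k : ℕ) : ∀ a ∈ RingHom.ker (groupAug G) ^ k, ∀ i < k,
    PowerSeries.coeff i (θ.algHom a).1 = 0 := by
  induction k with
  | zero => intro a _ i hi; omega
  | succ k ih =>
    intro a ha
    rw [Submodule.pow_succ] at ha
    refine Submodule.smul_induction_on ha ?_ ?_
    · intro x hx y hy i hi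
      rw [smul_eq_mul, map_mul]
      show PowerSeries.coeff i ((θ.algHom x).1 * (θ.algHom y).1) = 0
      rw [PowerSeries.coeff_mul]
      refine Finset.sum_eq_zero fun p hp => ?_
      rw [Finset.HasAntidiagonal.mem_antidiagonal] at hp
      by_cases h0 : p.2 = 0
      · rw [h0, coeff_algHom_zero, RingHom.mem_ker.1 hy, map_zero, mul_zero]
      · rw [ih x hx p.1 (by omega), zero_mul]
    · intro x y hx hy i hi
      rw [map_add]
      show PowerSeries.coeff i ((θ.algHom x).1 + (θ.algHom y).1) = 0
      rw [map_add, hx i hi, hy i hi, add_zero]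

theorem part_eq_zero (n : ℕ) (a : MonoidAlgebra ℚ G)
    (ha : a ∈ RingHom.ker (groupAug G) ^ (n + 1)) : θ.part n a = 0 := by
  have h := θ.coeff_algHom_eq_zero (n + 1) a ha n (Nat.lt_succ_self n)
  show DirectSum.component ℚ ℕ (fun n => ⨂[ℚ]^n (RatHOne G)) n
    (TensorAlgebra.toDirectSum (PowerSeries.coeff n (θ.algHom a).1)) = 0
  rw [h, map_zero, map_zero]

/-- The degree `n` part, in `H^{⊗ n}`, of the extension of `θ` to the completion of `ℚG`. As `θ`
sends `Iⁿ⁺¹` to series of order at least `n + 1`, it is computed on `ℚG / Iⁿ⁺¹`. -/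
def complPart (n : ℕ) : GroupCompletion G →ₗ[ℚ] ⨂[ℚ]^n (RatHOne G) :=
  (((RingHom.ker (groupAug G) ^ (n + 1)).restrictScalars ℚ).liftQ (θ.part n)
      (fun a ha => θ.part_eq_zero n a ha)) ∘ₗ
    (Submodule.Quotient.restrictScalarsEquiv ℚ
      (RingHom.ker (groupAug G) ^ (n + 1))).symm.toLinearMap ∘ₗ
    (complProj (groupAug G) (n + 1)).toLinearMap

/-- The image of `x` in `∏_{n ≥ 1} H^{⊗ n} / ℤ_n` under the extension of `θ`. -/
def cyclicPart (x : GroupCompletion G) : ∀ n : ℕ+, CyclicTensor (RatHOne G) n :=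
  fun n => Submodule.Quotient.mk (θ.complPart n x)

end MagnusExpansion

end Magnus

end

/-! The surface is a disc with `2g` pairs of boundary arcs glued, and its group is free on the loops
that leave through one arc of a pair and return through the other. The image of the disc without the
arcs, and the images of the strips around each pair of arcs, form an open cover whose members
contract in the surface. Composing paths along this cover shows that the loops generate
(`closure_arcLoop`). A locally constant cocycle that jumps by `c i` across the `i`-th pair of arcs
defines a covering, and its monodromy is a homomorphism with prescribed values on the loops
(`exists_hom_arcLoop`). Freeness yields Magnus expansions with any admissible values on a basis
(`IsFreeBasis.exists_magnusExpansion`).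

A Magnus expansion identifies `Iⁿ / Iⁿ⁺¹` with `H^{⊗ n}` (`mem_pow_succ_of_part_eq_zero`,
`exists_part_eq`). By successive approximation, the completion is then the completed tensor algebra
(`complPart_ext`, `exists_complPart_eq_all`, `complCoeff_mul`). The cyclic coinvariants are the
tensors modulo commutators. More precisely, a tensor of positive degree that dies there is a sum of
commutators `[eᵢ, wᵢ]` with a fixed finite spanning family `eᵢ` of `H` (`exists_commutators`). The
`wᵢ` of all degrees can be collected in one series, so finitely many commutators suffice for a whole
series and the bracket need not be closed up (`exists_sum_commutators`). This gives `θ_*`.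

The trace of the logarithm is additive modulo commutators: along the family `(1 + tx)(1 + y)`, the
derivative of its trace is that for `1 + tx` (`trace_truncLog_mul`). With the determinant of the
augmentation this defines `Φ_θ` on `K₁` (`MagnusExpansion.exists_phi`). The completion is local with
residue field `ℚ`, so elimination shows that units exhaust `K₁` (`KOne.ofUnitHom_surjective`).

The crux is `mem_commutator_of_cycLog_eq_one`: a unit with trivial invariants is a product of
commutators of units. It is written as `∏ [aᵢ, zᵢ]`, where the `aᵢ` are the group generators and the
`zᵢ` are found by successive approximation. The leading term of the error is a sum of `[eᵢ, wᵢ]`,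
which is removed by multiplying `zᵢ` by `1 + Wᵢ` with `Wᵢ` a lift of `wᵢ` (`exists_commProd_step`).
The number of commutators stays fixed, so the limit is again such a product. Hence both `(R̂ˣ)_ab →
K₁(R̂)` and `Φ_θ` are injective. Surjectivity of `Φ_θ` is another successive approximation
(`exists_unit_cycLog_eq`), and the logarithmic determinant is `Φ_θ` followed by the inverse of
`θ_*`.

For the dependence on `θ`, a generator is sent to a geometric series or to its truncation after
degree one; the logarithms then differ by a nonzero square in degree two. -/

noncomputable section

/-! ### Homotopy classes of paths and holonomy of locally constant cocycles -/

section PathClasses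

open scoped unitInterval Topology

variable {X : Type*} [TopologicalSpace X]

/-- A property of homotopy classes of paths that is stable under composition holds for all classes
if it holds for the paths that stay in a member of some open cover. -/
theorem pathClass_induction {κ : Type*} {U : κ → Set X} (hU : ∀ k, IsOpen (U k))
    (hcov : ∀ x, ∃ k, x ∈ U k) {P : ∀ x y : X, Path.Homotopic.Quotient x y → Prop}
    (htrans : ∀ x y z (p : Path.Homotopic.Quotient x y) (q : Path.Homotopic.Quotient y z),
      P x y p → P y z q → P x z (p.trans q))
    (hloc : ∀ k x y (γ : Path x y), (∀ t, γ t ∈ U k) → P x y (.mk γ)) {x y : X}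
    (p : Path.Homotopic.Quotient x y) : P x y p := by
  induction p using Path.Homotopic.Quotient.ind with | mk γ => ?_
  obtain ⟨t, h0, hmono, ⟨n, hn⟩, ht⟩ := exists_monotone_Icc_subset_open_cover_unitInterval
    (c := fun k => γ ⁻¹' U k) (fun k => (hU k).preimage γ.continuous)
    (fun s _ => Set.mem_iUnion.2 (hcov (γ s)))
  have key : ∀ m, P _ _ (.mk (γ.subpath (t 0) (t m))) := by
    intro m
    induction m with
    | zero =>
      obtain ⟨k, hk⟩ := hcov (γ (t 0))
      refine hloc k _ _ _ fun s => ?_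
      simpa using hk
    | succ m ih =>
      obtain ⟨k, hk⟩ := ht m
      have h2 : P _ _ (.mk (γ.subpath (t m) (t (m + 1)))) := by
        refine hloc k _ _ _ fun s => ?_
        have : (γ.subpath (t m) (t (m + 1))) s ∈ γ '' Set.Icc (t m) (t (m + 1)) := by
          rw [← Path.range_subpath_of_le _ _ _ (hmono (Nat.le_succ m))]
          exact Set.mem_range_self s
        obtain ⟨r, hr, hrs⟩ := this
        rw [← hrs]
        exact hk hr
      have h3 := htrans _ _ _ _ _ ih h2
      rwa [← Path.Homotopic.Quotient.mk_trans,
        Path.Homotopic.Quotient.eq.2 ⟨Path.Homotopy.subpathTransSubpath γ _ _ _⟩] at h3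
  have h1 := key n
  rw [hn n le_rfl, h0, Path.subpath_zero_one] at h1
  have hcast : ∀ (a b : X) (ha : a = x) (hb : b = y), P a b (.mk (γ.cast ha hb)) →
      P x y (.mk γ) := by
    rintro a b rfl rfl h
    exact h
  exact hcast _ _ _ _ h1

/-- The bundle core of a locally constant cocycle `x ↦ g k x * (g j x)⁻¹` with values in a discrete
group. -/
def cocycleCore {κ : Type*} {U : κ → Set X} (hU : ∀ k, IsOpen (U k))
    (hcov : ∀ x, ∃ k, x ∈ U k) {G : Type*} [Group G] [TopologicalSpace G] [DiscreteTopology G]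
    (g : κ → X → G)
    (hg : ∀ j k, ∀ x ∈ U j ∩ U k, ∀ᶠ y in 𝓝 x, g k y * (g j y)⁻¹ = g k x * (g j x)⁻¹) :
    FiberBundleCore κ X G where
  baseSet := U
  isOpen_baseSet := hU
  indexAt x := (hcov x).choose
  mem_baseSet_at x := (hcov x).choose_spec
  coordChange i j x v := g j x * (g i x)⁻¹ * v
  coordChange_self i x _ v := by simp
  continuousOn_coordChange i j := by
    rintro ⟨x, v⟩ ⟨hx, -⟩
    refine ContinuousAt.continuousWithinAt ?_
    refine (continuousAt_const (y := g j x * (g i x)⁻¹ * v)).congr ?_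
    have h1 : ∀ᶠ p : X × G in 𝓝 (x, v), g j p.1 * (g i p.1)⁻¹ = g j x * (g i x)⁻¹ :=
      (continuousAt_fst (p := (x, v))).eventually (hg i j x hx)
    have h2 : ∀ᶠ p : X × G in 𝓝 (x, v), p.2 = v :=
      (continuousAt_snd (p := (x, v))).eventually (p := fun w => w = v) (by simp)
    filter_upwards [h1, h2] with p hp hv
    rw [hp, hv]
  coordChange_comp i j k x _ v := by
    simp only [mul_assoc, inv_mul_cancel_left]

/-- A locally constant cocycle `g k * (g j)⁻¹` has a holonomy: a multiplicative function on homotopy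
classes of paths that is `(g k y)⁻¹ * g k x` for the paths from `x` to `y` in `U k`. -/
theorem exists_holonomy {κ : Type*} {U : κ → Set X} (hU : ∀ k, IsOpen (U k))
    (hcov : ∀ x, ∃ k, x ∈ U k) {G : Type*} [Group G] (g : κ → X → G)
    (hg : ∀ j k, ∀ x ∈ U j ∩ U k, ∀ᶠ y in 𝓝 x, g k y * (g j y)⁻¹ = g k x * (g j x)⁻¹) :
    ∃ Θ : ∀ x y : X, Path.Homotopic.Quotient x y → G,
      (∀ x y z p q, Θ x z (p.trans q) = Θ y z q * Θ x y p) ∧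
      ∀ k x y (γ : Path x y), (∀ t, γ t ∈ U k) → Θ x y (.mk γ) = (g k y)⁻¹ * g k x := by
  let _ : TopologicalSpace G := ⊥
  have : DiscreteTopology G := ⟨rfl⟩
  -- The holonomy is the monodromy of the covering with discrete fibre `G` that the cocycle glues.
  let Z := cocycleCore hU hcov g hg
  have cov : IsCoveringMap Z.proj := FiberBundle.isCoveringMap
  -- If `v` is the coordinate of a point of the fibre in a chart `k`, then `w = (g k x)⁻¹ * v` does
  -- not depend on `k`. A lift of a path inside `U k` has constant `v`, which gives the formula for
  -- the change of `w` in `hloc`.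
  let e (x : X) (w : G) : Z.proj ⁻¹' {x} := ⟨⟨x, g (Z.indexAt x) x * w⟩, rfl⟩
  have he : ∀ x w w', e x w = e x w' → w = w' := by
    intro x w w' h
    have h2 : g (Z.indexAt x) x * w = g (Z.indexAt x) x * w' := by
      have := congrArg Subtype.val h
      exact eq_of_heq (Bundle.TotalSpace.mk.inj this).2
    exact mul_left_cancel h2
  have hloc : ∀ k x y (γ : Path x y), (∀ t, γ t ∈ U k) →
      ∀ w, cov.monodromy (.mk γ) (e x w) = e y ((g k y)⁻¹ * g k x * w) := by
    intro k x y γ hγ w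
    have hval : ∀ z, (Z.localTriv k).toOpenPartialHomeomorph.symm (z, g k x * w) =
        (⟨z, g (Z.indexAt z) z * ((g k z)⁻¹ * g k x * w)⟩ : Z.TotalSpace) := by
      intro z
      refine (Z.localTriv_symm_apply k _).trans ?_
      show (⟨z, g (Z.indexAt z) z * (g k z)⁻¹ * (g k x * w)⟩ : Z.TotalSpace) = _
      exact congrArg (Bundle.TotalSpace.mk z)
        (by simp only [mul_assoc] : g (Z.indexAt z) z * (g k z)⁻¹ * (g k x * w) =
          g (Z.indexAt z) z * ((g k z)⁻¹ * g k x * w))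
    let Γ : Path (e x w).1 (e y ((g k y)⁻¹ * g k x * w)).1 :=
      { toFun := fun t => (Z.localTriv k).toOpenPartialHomeomorph.symm (γ t, g k x * w)
        continuous_toFun := by
          refine (Z.localTriv k).toOpenPartialHomeomorph.symm.continuousOn.comp_continuous
            (by fun_prop) fun t => ?_
          show (γ t, g k x * w) ∈ (Z.localTriv k).target
          rw [(Z.localTriv k).mem_target]
          exact hγ t
        source' := by
          rw [γ.source, hval]
          simp [e]
        target' := by
          rw [γ.target, hval] }
    refine cov.monodromy_eq_of_map_eq (.mk Γ) ?_
    refine congrArg Path.Homotopic.Quotient.mk (?_ : Γ.map cov.continuous = γ.cast rfl rfl)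
    ext t
    show ((Z.localTriv k).toOpenPartialHomeomorph.symm (γ t, g k x * w)).proj = γ t
    rw [hval]
  have hall : ∀ x y (p : Path.Homotopic.Quotient x y), ∃ t : G, ∀ w,
      cov.monodromy p (e x w) = e y (t * w) := by
    intro x y p
    refine pathClass_induction hU hcov
      (P := fun x y p => ∃ t : G, ∀ w, cov.monodromy p (e x w) = e y (t * w)) ?_ ?_ p
    · rintro x y z p q ⟨t, ht⟩ ⟨s, hs⟩
      refine ⟨s * t, fun w => ?_⟩
      rw [cov.monodromy_trans_apply, ht, hs, mul_assoc]
    · intro k x y γ hγ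
      exact ⟨_, hloc k x y γ hγ⟩
  choose Θ hΘ using hall
  refine ⟨Θ, ?_, ?_⟩
  · intro x y z p q
    have h := hΘ _ _ (p.trans q) 1
    rw [cov.monodromy_trans_apply, hΘ, hΘ, mul_one] at h
    simpa using (he _ _ _ h).symm
  · intro k x y γ hγ
    have h := hΘ _ _ (.mk γ) 1
    rw [hloc k x y γ hγ] at h
    simpa using (he _ _ _ h).symm

end PathClasses

/-! ### The quotient map from the rectangle and contractions in the surface -/

section SurfaceTopology

open scoped unitInterval Topology

variable {g : ℕ}

theorem convex_rect : Convex ℝ (Set.Icc (0 : ℝ) (8 * g + 1) ×ˢ Set.Icc (0 : ℝ) 1) :=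
  (convex_Icc _ _).prod (convex_Icc _ _)

/-- The point `(0, 1)` of the rectangle. -/
def rectBase (g : ℕ) : Rect g :=
  ⟨(0, 1), ⟨⟨le_rfl, by positivity⟩, ⟨zero_le_one, le_rfl⟩⟩⟩

instance : SimplyConnectedSpace (Rect g) :=
  haveI : ContractibleSpace (Rect g) := convex_rect.contractibleSpace ⟨_, (rectBase g).2⟩
  inferInstance

/-- The projection of the rectangle to the surface. -/
def surfaceMk : C(Rect g, Surface g) := ⟨Quot.mk _, continuous_quot_mk⟩

theorem surfaceMk_surjective : Function.Surjective (surfaceMk (g := g)) := Quot.mk_surjective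

theorem isQuotientMap_surfaceMk : Topology.IsQuotientMap (surfaceMk (g := g)) :=
  isQuotientMap_quot_mk

/-- The points of the segment from `p` to `p'`. -/
def rectSegment (p p' : Rect g) (t : I) : Rect g :=
  ⟨AffineMap.lineMap p.1 p'.1 (t : ℝ), convex_rect.lineMap_mem p.2 p'.2 t.2⟩

/-- The straight path in the rectangle. -/
def rectPath (p p' : Rect g) : Path p p' where
  toFun := rectSegment p p'
  continuous_toFun := Continuous.subtype_mk (by
    simp only [AffineMap.lineMap_apply]
    fun_prop) _
  source' := by ext1; simp [rectSegment]
  target' := by ext1; simp [rectSegment]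

theorem rectPath_fst (p p' : Rect g) (t : I) :
    (rectPath p p' t).1.1 = (1 - (t : ℝ)) * p.1.1 + t * p'.1.1 := by
  show (AffineMap.lineMap p.1 p'.1 (t : ℝ)).1 = _
  simp [AffineMap.lineMap_apply]; ring

theorem rectPath_snd (p p' : Rect g) (t : I) :
    (rectPath p p' t).1.2 = (1 - (t : ℝ)) * p.1.2 + t * p'.1.2 := by
  show (AffineMap.lineMap p.1 p'.1 (t : ℝ)).2 = _
  simp [AffineMap.lineMap_apply]; ring

/-- The class in the surface of the paths in the rectangle from `p` to `p'`. -/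
def rectClass (p p' : Rect g) : Path.Homotopic.Quotient (surfaceMk p) (surfaceMk p') :=
  (Path.Homotopic.Quotient.mk (rectPath p p')).map surfaceMk

/-- The rectangle is simply connected, so any path in it may be replaced by the straight one. -/
theorem mk_map_surfaceMk {p p' : Rect g} (γ : Path p p') :
    Path.Homotopic.Quotient.mk (γ.map surfaceMk.continuous) = rectClass p p' := by
  rw [Path.Homotopic.Quotient.mk_map, rectClass]
  exact congrArg (fun q => Path.Homotopic.Quotient.map q surfaceMk) (Subsingleton.elim _ _)

theorem rectClass_trans (p p' p'' : Rect g) :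
    (rectClass p p').trans (rectClass p' p'') = rectClass p p'' := by
  rw [← mk_map_surfaceMk (rectPath p p'), ← mk_map_surfaceMk (rectPath p' p''),
    ← Path.Homotopic.Quotient.mk_trans, ← Path.map_trans, mk_map_surfaceMk]

theorem rectClass_self (p : Rect g) : rectClass p p = .refl (surfaceMk p) := by
  rw [← mk_map_surfaceMk (Path.refl p)]; rfl

/-- A set of points of the rectangle that is a union of gluing classes. -/
def GlueSaturated (W : Set (Rect g)) : Prop := ∀ p p', SurfaceGlue g p p' → (p ∈ W ↔ p' ∈ W)

/-- The image in the surface of a saturated set. -/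
def surfaceSet {W : Set (Rect g)} (hW : GlueSaturated W) : Set (Surface g) :=
  {x | Quot.lift (· ∈ W) (fun p p' h => propext (hW p p' h)) x}

theorem surfaceMk_mem_surfaceSet {W : Set (Rect g)} (hW : GlueSaturated W) (p : Rect g) :
    surfaceMk p ∈ surfaceSet hW ↔ p ∈ W := Iff.rfl

theorem isOpen_surfaceSet {W : Set (Rect g)} (hW : GlueSaturated W) (h : IsOpen W) :
    IsOpen (surfaceSet hW) := isQuotientMap_surfaceMk.isOpen_preimage.1 h

/-- A function on a saturated set that is compatible with the gluing takes the same value at points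
with the same image. -/
theorem eq_of_surfaceMk_eq {W : Set (Rect g)} (hW : GlueSaturated W) {Y : Type*} (F : Rect g → Y)
    (hF : ∀ p p', p ∈ W → SurfaceGlue g p p' → F p = F p') {p p' : Rect g} (hp : p ∈ W)
    (h : surfaceMk p = surfaceMk p') : F p = F p' := by
  classical
  have hF' : ∀ p p', SurfaceGlue g p p' →
      (if p ∈ W then some (F p) else none) = if p' ∈ W then some (F p') else none := by
    intro p p' hpp
    by_cases hp : p ∈ W
    · rw [if_pos hp, if_pos ((hW p p' hpp).1 hp), hF p p' hp hpp]
    · rw [if_neg hp, if_neg (mt (hW p p' hpp).2 hp)]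
  have hp' : p' ∈ W := by
    rwa [← surfaceMk_mem_surfaceSet hW, ← h, surfaceMk_mem_surfaceSet hW]
  have := congrArg (Quot.lift _ hF') h
  change (if p ∈ W then some (F p) else none) = if p' ∈ W then some (F p') else none at this
  rwa [if_pos hp, if_pos hp', Option.some_inj] at this

/-- A contraction in the surface of an open saturated set, along the images of straight paths to
points `c p`, gives for every point of the set a class of paths to the centre. Paths in the set are
homotopic if they have the same end points. -/
theorem exists_contraction_classes {W : Set (Rect g)} (hW : GlueSaturated W) (hWo : IsOpen W)
    {c : Rect g → Rect g} (hc : Continuous c) (x₁ : Surface g)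
    (hc₁ : ∀ p ∈ W, x₁ = surfaceMk (c p))
    (hglue : ∀ p p', p ∈ W → SurfaceGlue g p p' →
      ∀ t, surfaceMk (rectPath p (c p) t) = surfaceMk (rectPath p' (c p') t)) :
    ∃ η : ∀ x ∈ surfaceSet hW, Path.Homotopic.Quotient x x₁,
      (∀ p (hp : p ∈ W), η (surfaceMk p) hp = (rectClass p (c p)).cast rfl (hc₁ p hp)) ∧
      ∀ x y (γ : Path x y) (_ : ∀ t, γ t ∈ surfaceSet hW) (hx : x ∈ surfaceSet hW)
        (hy : y ∈ surfaceSet hW), (Path.Homotopic.Quotient.mk γ).trans (η y hy) = η x hx := by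
  let h : C(Rect g × I, Surface g) :=
    ⟨fun z => surfaceMk (rectPath z.1 (c z.1) z.2), by
      refine surfaceMk.continuous.comp (Continuous.subtype_mk ?_ _)
      simp only [AffineMap.lineMap_apply]
      fun_prop⟩
  let V := surfaceSet hW
  have hVo : IsOpen V := isOpen_surfaceSet hW hWo
  have hq : Topology.IsQuotientMap (V.restrictPreimage surfaceMk) :=
    isQuotientMap_surfaceMk.restrictPreimage_isOpen hVo
  -- The contraction is curried: a map to the path space descends along the quotient map to `V`, and
  -- no product of a quotient map with the interval has to be considered.
  let f : C(surfaceMk ⁻¹' V, C(I, Surface g)) :=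
    ⟨fun p => h.curry p.1, h.curry.continuous.comp continuous_subtype_val⟩
  have hf : ∀ a b : surfaceMk ⁻¹' V, V.restrictPreimage surfaceMk a =
      V.restrictPreimage surfaceMk b → f a = f b := by
    intro a b hab
    have hab' : surfaceMk a.1 = surfaceMk b.1 := congrArg Subtype.val hab
    refine eq_of_surfaceMk_eq hW (fun p => h.curry p) ?_ (p := a.1) (p' := b.1) a.2 hab'
    intro p p' hp hpp
    ext t
    exact hglue p p' hp hpp t
  let q : C(surfaceMk ⁻¹' V, V) := ⟨_, hq.continuous⟩
  have hq' : Topology.IsQuotientMap q := hq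
  obtain ⟨H, hH⟩ : ∃ H : C(V, C(I, Surface g)), ∀ p (hp : p ∈ W) t,
      H ⟨surfaceMk p, hp⟩ t = surfaceMk (rectPath p (c p) t) := by
    refine ⟨hq'.lift f (fun a b => hf a b), fun p hp t => ?_⟩
    have := congrArg (fun k => k ⟨p, hp⟩) (hq'.lift_comp f (fun a b => hf a b))
    exact congrArg (fun k : C(I, Surface g) => k t) this
  let incl : C(V, Surface g) := ⟨Subtype.val, continuous_subtype_val⟩
  let K : incl.Homotopy (ContinuousMap.const V x₁) :=
    { toFun := fun z => H z.2 z.1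
      continuous_toFun := by
        have : Continuous fun z : I × V => (H z.2, z.1) := by fun_prop
        exact ContinuousEval.continuous_eval.comp this
      map_zero_left := by
        rintro ⟨x, hx⟩
        obtain ⟨p, rfl⟩ := surfaceMk_surjective x
        refine (hH p hx 0).trans ?_
        rw [(rectPath p (c p)).source]; rfl
      map_one_left := by
        rintro ⟨x, hx⟩
        obtain ⟨p, rfl⟩ := surfaceMk_surjective x
        refine (hH p hx 1).trans ?_
        rw [(rectPath p (c p)).target]
        exact (hc₁ p hx).symm }
  refine ⟨fun x hx => .mk (K.evalAt ⟨x, hx⟩), ?_, ?_⟩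
  · intro p hp
    rw [← mk_map_surfaceMk (rectPath p (c p)), ← Path.Homotopic.Quotient.mk_cast]
    refine congrArg Path.Homotopic.Quotient.mk (Path.ext (funext fun t => ?_))
    exact hH p hp t
  · intro x y γ hγ hx hy
    let γ' : Path (⟨x, hx⟩ : V) ⟨y, hy⟩ :=
      { toFun := fun t => ⟨γ t, hγ t⟩
        continuous_toFun := γ.continuous.subtype_mk _
        source' := by ext1; exact γ.source
        target' := by ext1; exact γ.target }
    -- Naturality of the homotopy `K` along `γ'`. Since `K` ends at a constant map, one side of the
    -- square is a constant path.
    have := Path.Homotopic.Quotient.eq.2 (Path.Homotopic.map_trans_evalAt K γ')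
    rw [Path.Homotopic.Quotient.mk_trans, Path.Homotopic.Quotient.mk_trans] at this
    have h1 : γ'.map (map_continuous incl) = γ := by ext t; rfl
    have h2 : γ'.map (map_continuous (ContinuousMap.const V x₁)) = Path.refl x₁ := by ext t; rfl
    rw [h1] at this
    refine this.trans ?_
    refine (congrArg _ (congrArg Path.Homotopic.Quotient.mk h2)).trans ?_
    exact Path.Homotopic.Quotient.trans_refl _

end SurfaceTopology

/-! ### The open cover of the surface by the cut disc and the strips -/

section SurfaceCover

open scoped unitInterval Topology

variable {g : ℕ}

/-- The left end point of the first of the two arcs that are glued to each other. The second one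
starts `4` units further to the right. -/
def arcStart (i : Fin g × Bool) : ℝ := 8 * (i.1 : ℝ) + bif i.2 then 3 else 1

theorem one_le_arcStart (i : Fin g × Bool) : 1 ≤ arcStart i := by
  have : (0 : ℝ) ≤ (i.1 : ℝ) := Nat.cast_nonneg _
  unfold arcStart
  cases i.2 <;> simp <;> linarith

theorem arcStart_le (i : Fin g × Bool) : arcStart i + 5 ≤ 8 * g + 1 := by
  have h : ((i.1 : ℕ) : ℝ) + 1 ≤ g := by exact_mod_cast i.1.2
  unfold arcStart
  cases i.2 <;> simp <;> linarith

theorem SurfaceGlue.exists_arc {p q : Rect g} (h : SurfaceGlue g p q) :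
    ∃ (i : Fin g × Bool) (t : ℝ), t ∈ Set.Icc (0 : ℝ) 1 ∧ p.1 = (arcStart i + t, 0) ∧
      q.1 = (arcStart i + 5 - t, 0) := by
  cases h with
  | first j t _ _ ht hp hq =>
    refine ⟨(j, false), t, ht, by simpa [arcStart] using hp, ?_⟩
    rw [hq]; simp [arcStart]; ring
  | second j t _ _ ht hp hq =>
    refine ⟨(j, true), t, ht, by simpa [arcStart] using hp, ?_⟩
    rw [hq]; simp [arcStart]; ring

theorem surfaceMk_eq_of_arc (i : Fin g × Bool) {t : ℝ} {p q : Rect g} (ht : t ∈ Set.Icc (0 : ℝ) 1)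
    (hp : p.1 = (arcStart i + t, 0)) (hq : q.1 = (arcStart i + 5 - t, 0)) :
    surfaceMk p = surfaceMk q := by
  obtain ⟨j, b⟩ := i
  cases b with
  | false =>
    refine Quot.sound (.first j t p q ht (by simpa [arcStart] using hp) ?_)
    rw [hq]; simp [arcStart]; ring
  | true =>
    refine Quot.sound (.second j t p q ht (by simpa [arcStart] using hp) ?_)
    rw [hq]; simp [arcStart]; ring

/-- The open strip above the first arc. -/
def firstStrip (i : Fin g × Bool) : Set (Rect g) :=
  {p | arcStart i - 1 / 2 < p.1.1 ∧ p.1.1 < arcStart i + 3 / 2}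

/-- The open strip above the second arc. -/
def secondStrip (i : Fin g × Bool) : Set (Rect g) :=
  {p | arcStart i + 7 / 2 < p.1.1 ∧ p.1.1 < arcStart i + 11 / 2}

theorem isOpen_firstStrip (i : Fin g × Bool) : IsOpen (firstStrip i) :=
  isOpen_Ioo.preimage (continuous_fst.comp continuous_subtype_val)

theorem isOpen_secondStrip (i : Fin g × Bool) : IsOpen (secondStrip i) :=
  isOpen_Ioo.preimage (continuous_fst.comp continuous_subtype_val)

/-- The arcs start at distinct odd integers, and each strip has width `2`, from `1 / 2` before the
arc to `1 / 2` after it. Two starting points whose strips share `x` differ by less than `2`, hence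
coincide. -/
theorem arcStart_inj_of_lt {i i' : Fin g × Bool} {a a' : ℕ} {x : ℝ} (ha : a ≤ 1) (ha' : a' ≤ 1)
    (h1 : arcStart i + 4 * a - 1 / 2 < x) (h2 : x < arcStart i + 4 * a + 3 / 2)
    (h3 : arcStart i' + 4 * a' - 1 / 2 < x) (h4 : x < arcStart i' + 4 * a' + 3 / 2) :
    i = i' ∧ a = a' := by
  obtain ⟨j, b⟩ := i
  obtain ⟨j', b'⟩ := i'
  have hs : ∀ (k : Fin g) (c : Bool), arcStart (k, c) = ((8 * k.1 + (bif c then 3 else 1) : ℕ) : ℝ) := by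
    intro k c; cases c <;> simp [arcStart]
  rw [hs] at h1 h2 h3 h4
  set u := 8 * j.1 + (bif b then 3 else 1) with hu
  set u' := 8 * j'.1 + (bif b' then 3 else 1) with hu'
  have h5 : ((u + 4 * a : ℕ) : ℝ) < ((u' + 4 * a' + 2 : ℕ) : ℝ) := by push_cast; linarith
  have h6 : ((u' + 4 * a' : ℕ) : ℝ) < ((u + 4 * a + 2 : ℕ) : ℝ) := by push_cast; linarith
  rw [Nat.cast_lt] at h5 h6
  have : j.1 = j'.1 ∧ b = b' ∧ a = a' := by
    cases b <;> cases b' <;> simp at hu hu' ⊢ <;> omega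
  exact ⟨Prod.ext (Fin.ext this.1) this.2.1, this.2.2⟩

/-- The union of the two strips. -/
def strip (i : Fin g × Bool) : Set (Rect g) := firstStrip i ∪ secondStrip i

theorem disjoint_firstStrip_secondStrip {i : Fin g × Bool} {p : Rect g} (h : p ∈ firstStrip i)
    (h' : p ∈ secondStrip i) : False := by
  have h1 := h.2
  have h2 := h'.1
  linarith

theorem strip_inj {i i' : Fin g × Bool} {p : Rect g} (h : p ∈ strip i) (h' : p ∈ strip i') :
    i = i' := by
  have key : ∀ k : Fin g × Bool, p ∈ strip k → ∃ a : ℕ, a ≤ 1 ∧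
      arcStart k + 4 * a - 1 / 2 < p.1.1 ∧ p.1.1 < arcStart k + 4 * a + 3 / 2 := by
    rintro k (⟨h1, h2⟩ | ⟨h1, h2⟩)
    · exact ⟨0, zero_le_one, by simpa using h1, by simpa using h2⟩
    · exact ⟨1, le_rfl, by push_cast; linarith, by push_cast; linarith⟩
  obtain ⟨a, ha, h1, h2⟩ := key i h
  obtain ⟨a', ha', h3, h4⟩ := key i' h'
  exact (arcStart_inj_of_lt ha ha' h1 h2 h3 h4).1

/-- The complement of the arcs. -/
def offArcs (g : ℕ) : Set (Rect g) :=
  {p | ∀ i : Fin g × Bool, ¬ (p.1.2 = 0 ∧ (p.1.1 ∈ Set.Icc (arcStart i) (arcStart i + 1) ∨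
    p.1.1 ∈ Set.Icc (arcStart i + 4) (arcStart i + 5)))}

theorem isOpen_offArcs : IsOpen (offArcs g) := by
  have : offArcs g = ⋂ i : Fin g × Bool, {p | ¬ (p.1.2 = 0 ∧
      (p.1.1 ∈ Set.Icc (arcStart i) (arcStart i + 1) ∨
        p.1.1 ∈ Set.Icc (arcStart i + 4) (arcStart i + 5)))} := by
    ext p; simp [offArcs]
  rw [this]
  refine isOpen_iInter_of_finite fun i => ?_
  refine isOpen_compl_iff.2 (?_ : IsClosed {p : Rect g | p.1.2 = 0 ∧
      (p.1.1 ∈ Set.Icc (arcStart i) (arcStart i + 1) ∨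
        p.1.1 ∈ Set.Icc (arcStart i + 4) (arcStart i + 5))})
  refine (isClosed_eq (by fun_prop) continuous_const).inter (IsClosed.union ?_ ?_)
  · exact isClosed_Icc.preimage (continuous_fst.comp continuous_subtype_val)
  · exact isClosed_Icc.preimage (continuous_fst.comp continuous_subtype_val)

theorem mem_offArcs_of_pos {p : Rect g} (h : 0 < p.1.2) : p ∈ offArcs g :=
  fun _ hi => h.ne' hi.1

theorem not_mem_offArcs {p q : Rect g} (h : SurfaceGlue g p q) : p ∉ offArcs g ∧ q ∉ offArcs g := by
  obtain ⟨i, t, ⟨h0, h1⟩, hp, hq⟩ := h.exists_arc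
  refine ⟨fun hW => hW i ?_, fun hW => hW i ?_⟩
  · rw [hp]; exact ⟨rfl, Or.inl ⟨by simpa using h0, by simpa using h1⟩⟩
  · rw [hq]; exact ⟨rfl, Or.inr ⟨by simp only; linarith, by simp only; linarith⟩⟩

/-- The cover of the rectangle by the complement of the arcs and the strips. -/
def rectCover (g : ℕ) : Option (Fin g × Bool) → Set (Rect g)
  | none => offArcs g
  | some i => strip i

theorem isOpen_rectCover : ∀ k, IsOpen (rectCover g k)
  | none => isOpen_offArcs
  | some i => (isOpen_firstStrip i).union (isOpen_secondStrip i)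

theorem mem_strip_of_glue {p q : Rect g} (h : SurfaceGlue g p q) :
    ∃ i, p ∈ firstStrip i ∧ q ∈ secondStrip i := by
  obtain ⟨i, t, ⟨h0, h1⟩, hp, hq⟩ := h.exists_arc
  refine ⟨i, ?_, ?_⟩
  · rw [firstStrip, Set.mem_ofPred_eq, hp]; constructor <;> simp only <;> linarith
  · rw [secondStrip, Set.mem_ofPred_eq, hq]; constructor <;> simp only <;> linarith

theorem glueSaturated_rectCover : ∀ k, GlueSaturated (rectCover g k)
  | none => fun _ _ h => iff_of_false (not_mem_offArcs h).1 (not_mem_offArcs h).2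
  | some i => by
    intro p q h
    obtain ⟨i', hp, hq⟩ := mem_strip_of_glue h
    have hp' : p ∈ strip i' := Or.inl hp
    have hq' : q ∈ strip i' := Or.inr hq
    constructor
    · intro h1; rw [strip_inj (i := i) h1 hp']; exact hq'
    · intro h1; rw [strip_inj (i := i) h1 hq']; exact hp'

theorem glueSaturated_inter_offArcs (W : Set (Rect g)) : GlueSaturated (W ∩ offArcs g) :=
  fun _ _ h => iff_of_false (fun h' => (not_mem_offArcs h).1 h'.2) fun h' => (not_mem_offArcs h).2 h'.2

/-- The cover of the surface. -/
def surfaceCover (g : ℕ) (k : Option (Fin g × Bool)) : Set (Surface g) :=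
  surfaceSet (glueSaturated_rectCover k)

theorem isOpen_surfaceCover (k : Option (Fin g × Bool)) : IsOpen (surfaceCover g k) :=
  isOpen_surfaceSet _ (isOpen_rectCover k)

theorem exists_mem_surfaceCover (x : Surface g) : ∃ k, x ∈ surfaceCover g k := by
  obtain ⟨p, rfl⟩ := surfaceMk_surjective x
  by_cases h : p ∈ offArcs g
  · exact ⟨none, h⟩
  · simp only [offArcs, Set.mem_ofPred_eq, not_forall, not_not] at h
    obtain ⟨i, -, h | h⟩ := h
    · refine ⟨some i, Or.inl ⟨?_, ?_⟩⟩ <;> linarith [h.1, h.2]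
    · refine ⟨some i, Or.inr ⟨?_, ?_⟩⟩ <;> linarith [h.1, h.2]

/-- The point of abscissa `arcStart i + a` and ordinate `y`. -/
def stripPoint (i : Fin g × Bool) (a : Set.Icc (0 : ℝ) 5) (y : I) : Rect g :=
  ⟨(arcStart i + a, y), ⟨⟨by simp only; linarith [one_le_arcStart i, a.2.1],
    by simp only; linarith [arcStart_le i, a.2.2]⟩, y.2⟩⟩

/-- The abscissa, relative to `arcStart i`, of the middle of the first arc. -/
def firstMid : Set.Icc (0 : ℝ) 5 := ⟨1 / 2, by norm_num, by norm_num⟩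

/-- The abscissa, relative to `arcStart i`, of the middle of the second arc. -/
def secondMid : Set.Icc (0 : ℝ) 5 := ⟨9 / 2, by norm_num, by norm_num⟩

theorem surfaceMk_mid (i : Fin g × Bool) :
    surfaceMk (stripPoint i firstMid 0) = surfaceMk (stripPoint i secondMid 0) := by
  refine surfaceMk_eq_of_arc i (t := 1 / 2) ⟨by norm_num, by norm_num⟩ ?_ ?_ <;>
    ext <;> simp [stripPoint, firstMid, secondMid]
  ring

/-- The middle of the first arc on the first strip, and the middle of the second arc on the second
strip. -/
def stripCentre (i : Fin g × Bool) (p : Rect g) : Rect g :=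
  -- The clamp is `0` up to `arcStart i + 2` and `1` from `arcStart i + 3` on. The strips lie on
  -- either side of this gap, so the function is continuous on the whole rectangle and constant on
  -- each strip.
  stripPoint i ⟨1 / 2 + 4 * max 0 (min 1 (p.1.1 - arcStart i - 2)), by positivity, by
    have : max 0 (min 1 (p.1.1 - arcStart i - 2)) ≤ 1 := max_le zero_le_one (min_le_left _ _)
    linarith⟩ 0

theorem continuous_stripCentre (i : Fin g × Bool) : Continuous (stripCentre i) := by
  unfold stripCentre stripPoint
  fun_prop

theorem stripCentre_of_first {i : Fin g × Bool} {p : Rect g} (h : p ∈ firstStrip i) :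
    stripCentre i p = stripPoint i firstMid 0 := by
  have h1 : min 1 (p.1.1 - arcStart i - 2) ≤ 0 := (min_le_right _ _).trans (by linarith [h.2])
  unfold stripCentre firstMid
  congr 2
  rw [max_eq_left h1]
  ring

theorem stripCentre_of_second {i : Fin g × Bool} {p : Rect g} (h : p ∈ secondStrip i) :
    stripCentre i p = stripPoint i secondMid 0 := by
  have h1 : min 1 (p.1.1 - arcStart i - 2) = 1 := min_eq_left (by linarith [h.1])
  unfold stripCentre secondMid
  congr 2
  rw [h1, max_eq_right zero_le_one]
  norm_num

/-- Points off the arcs are not glued to anything, so every segment to the corner is admissible. -/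
theorem exists_contraction_offArcs :
    ∃ η : ∀ x ∈ surfaceCover g none, Path.Homotopic.Quotient x (surfaceMk (rectBase g)),
      (∀ p (hp : p ∈ offArcs g), η (surfaceMk p) hp = rectClass p (rectBase g)) ∧
      ∀ x y (γ : Path x y) (_ : ∀ t, γ t ∈ surfaceCover g none) (hx : x ∈ surfaceCover g none)
        (hy : y ∈ surfaceCover g none),
        (Path.Homotopic.Quotient.mk γ).trans (η y hy) = η x hx :=
  exists_contraction_classes (glueSaturated_rectCover none) isOpen_offArcs
    (c := fun _ => rectBase g) continuous_const _ (fun _ _ => rfl)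
    (fun _ _ hp h => ((not_mem_offArcs h).1 hp).elim)

theorem exists_contraction_strip (i : Fin g × Bool) :
    ∃ η : ∀ x ∈ surfaceCover g (some i),
        Path.Homotopic.Quotient x (surfaceMk (stripPoint i firstMid 0)),
      (∀ p (hp : p ∈ firstStrip i),
        η (surfaceMk p) (Or.inl hp) = rectClass p (stripPoint i firstMid 0)) ∧
      (∀ p (hp : p ∈ secondStrip i), η (surfaceMk p) (Or.inr hp) =
        (rectClass p (stripPoint i secondMid 0)).cast rfl (surfaceMk_mid i)) ∧
      ∀ x y (γ : Path x y) (_ : ∀ t, γ t ∈ surfaceCover g (some i))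
        (hx : x ∈ surfaceCover g (some i)) (hy : y ∈ surfaceCover g (some i)),
        (Path.Homotopic.Quotient.mk γ).trans (η y hy) = η x hx := by
  have hc₁ : ∀ p ∈ strip i, surfaceMk (stripPoint i firstMid 0) = surfaceMk (stripCentre i p) := by
    rintro p (hp | hp)
    · rw [stripCentre_of_first hp]
    · rw [stripCentre_of_second hp, surfaceMk_mid]
  obtain ⟨η, h1, h2⟩ := exists_contraction_classes (glueSaturated_rectCover (some i))
    (isOpen_rectCover (some i)) (continuous_stripCentre i) _ hc₁ (by
      intro p q hp h t
      obtain ⟨i', s, ⟨h0, h1⟩, hp', hq'⟩ := h.exists_arc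
      obtain ⟨i'', hpf, hqs⟩ := mem_strip_of_glue h
      obtain rfl : i' = i'' := by
        refine strip_inj (p := p) (Or.inl ?_) (Or.inl hpf)
        rw [firstStrip, Set.mem_ofPred_eq, hp']; constructor <;> simp only <;> linarith
      obtain rfl : i = i' := strip_inj hp (Or.inl hpf)
      rw [stripCentre_of_first hpf, stripCentre_of_second hqs]
      have ht0 : (0 : ℝ) ≤ t := t.2.1
      have ht1 : (t : ℝ) ≤ 1 := t.2.2
      -- In abscissas relative to `arcStart i`, the gluing is the affine map `a ↦ 5 - a`, which
      -- exchanges the midpoints `1 / 2` and `9 / 2`. It therefore matches the segments from glued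
      -- points to the midpoints at each time.
      refine surfaceMk_eq_of_arc i (t := (1 - t) * s + t * (1 / 2)) ⟨?_, ?_⟩ ?_ ?_
      · have := mul_nonneg (sub_nonneg.2 ht1) h0
        linarith
      · have := mul_nonneg (sub_nonneg.2 ht1) (sub_nonneg.2 h1)
        nlinarith
      · refine Prod.ext ?_ ?_
        · rw [rectPath_fst, hp']; simp [stripPoint, firstMid]; ring
        · rw [rectPath_snd, hp']; simp [stripPoint]
      · refine Prod.ext ?_ ?_
        · rw [rectPath_fst, hq']; simp [stripPoint, secondMid]; ring
        · rw [rectPath_snd, hq']; simp [stripPoint])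
  refine ⟨η, fun p hp => ?_, fun p hp => ?_, h2⟩
  · rw [h1 p (Or.inl hp)]
    have : ∀ r (hr : r = stripPoint i firstMid 0) (h : _ = surfaceMk r),
        (rectClass p r).cast rfl h = rectClass p (stripPoint i firstMid 0) := by
      rintro r rfl h; exact Path.Homotopic.Quotient.cast_rfl_rfl _
    exact this _ (stripCentre_of_first hp) _
  · rw [h1 p (Or.inr hp)]
    have : ∀ r (hr : r = stripPoint i secondMid 0) (h : _ = surfaceMk r),
        (rectClass p r).cast rfl h =
          (rectClass p (stripPoint i secondMid 0)).cast rfl (surfaceMk_mid i) := by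
      rintro r rfl h; rfl
    exact this _ (stripCentre_of_second hp) _

end SurfaceCover

/-! ### The fundamental group of the surface is free -/

section SurfaceGroupFree

open scoped unitInterval Topology
open CategoryTheory

/-- A finite family of elements that generates a group and can be sent to any family of elements of
any group: a finite free basis. -/
def IsFreeBasis {ι G : Type*} [Group G] (l : ι → G) : Prop :=
  Subgroup.closure (Set.range l) = ⊤ ∧
    ∀ (K : Type) [Group K] (c : ι → K), ∃ f : G →* K, ∀ i, f (l i) = c i

theorem IsFreeBasis.map {ι G G' : Type*} [Group G] [Group G'] {l : ι → G} (h : IsFreeBasis l)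
    (e : G ≃* G') : IsFreeBasis (e ∘ l) := by
  refine ⟨?_, fun K _ c => ?_⟩
  · rw [Set.range_comp]
    refine (MonoidHom.map_closure e.toMonoidHom (Set.range l)).symm.trans ?_
    rw [h.1]
    exact Subgroup.map_top_of_surjective _ e.surjective
  · obtain ⟨f, hf⟩ := h.2 K c
    exact ⟨f.comp e.symm.toMonoidHom, fun i => by simp [hf]⟩

variable {g : ℕ}

/-- The class of paths from the middle of the second arc to the base point. -/
def secondReturn (i : Fin g × Bool) :
    Path.Homotopic.Quotient (surfaceMk (stripPoint i firstMid 0)) (surfaceMk (rectBase g)) :=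
  (rectClass (stripPoint i secondMid 0) (rectBase g)).cast (surfaceMk_mid i) rfl

/-- The loop that leaves the rectangle through the first arc and comes back through the second. -/
def arcLoop (i : Fin g × Bool) : FundamentalGroup (Surface g) (surfaceMk (rectBase g)) :=
  (rectClass (rectBase g) (stripPoint i firstMid 0)).trans (secondReturn i)

/-- Every point gets a class of paths to the base point which, in each member of the cover, differs
from the contraction of that member by an element of the subgroup. A path inside one member, closed
up by these classes, then lies in the subgroup, and `pathClass_induction` extends this to all paths.
-/
theorem closure_arcLoop : Subgroup.closure (Set.range (arcLoop (g := g))) = ⊤ := by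
  classical
  set S := Subgroup.closure (Set.range (arcLoop (g := g)))
  obtain ⟨η₀, hη₀, hpath₀⟩ := exists_contraction_offArcs (g := g)
  choose η hηf hηs hpath using exists_contraction_strip (g := g)
  have hκ : ∀ x : Surface g, ∃ κ : Path.Homotopic.Quotient x (surfaceMk (rectBase g)),
      (∀ hx : x ∈ surfaceCover g none, κ = η₀ x hx) ∧
      ∀ i (hx : x ∈ surfaceCover g (some i)), ∃ s ∈ S,
        κ = ((η i x hx).trans (rectClass (stripPoint i firstMid 0) (rectBase g))).trans s := by
    intro x
    by_cases h0 : x ∈ surfaceCover g none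
    · refine ⟨η₀ x h0, fun _ => rfl, fun i hx => ?_⟩
      obtain ⟨p, rfl⟩ := surfaceMk_surjective x
      rcases hx with hx | hx
      · refine ⟨1, one_mem _, ?_⟩
        rw [hηf i p hx, rectClass_trans, hη₀ p h0]
        exact (Path.Homotopic.Quotient.trans_refl _).symm
      -- From the second strip, the contraction leads to the common image of the two midpoints, and
      -- the return then starts at the first one. The loop corrects this to a return from the
      -- second.
      · refine ⟨arcLoop i, Subgroup.subset_closure ⟨i, rfl⟩, ?_⟩
        rw [hηs i p hx, hη₀ p h0, arcLoop, Path.Homotopic.Quotient.trans_assoc,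
          ← Path.Homotopic.Quotient.trans_assoc (rectClass (stripPoint i firstMid 0) (rectBase g)),
          rectClass_trans, rectClass_self, Path.Homotopic.Quotient.refl_trans, secondReturn]
        have : ∀ (z : Surface g) (h : z = surfaceMk (stripPoint i secondMid 0)),
            ((rectClass p (stripPoint i secondMid 0)).cast rfl h).trans
              ((rectClass (stripPoint i secondMid 0) (rectBase g)).cast h rfl) =
                rectClass p (rectBase g) := by
          rintro z rfl
          exact rectClass_trans _ _ _
        exact (this _ _).symm
    · by_cases h1 : ∃ i, x ∈ surfaceCover g (some i)
      · obtain ⟨i, hi⟩ := h1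
        refine ⟨(η i x hi).trans (rectClass (stripPoint i firstMid 0) (rectBase g)),
          fun h => (h0 h).elim, fun i' hi' => ?_⟩
        obtain rfl : i = i' := by
          obtain ⟨p, rfl⟩ := surfaceMk_surjective x
          exact strip_inj (p := p) hi hi'
        exact ⟨1, one_mem _, (Path.Homotopic.Quotient.trans_refl _).symm⟩
      · obtain ⟨k, hk⟩ := exists_mem_surfaceCover x
        cases k with
        | none => exact (h0 hk).elim
        | some i => exact (h1 ⟨i, hk⟩).elim
  choose κ hκ₀ hκ₁ using hκ
  have key : ∀ (x y : Surface g) (p : Path.Homotopic.Quotient x y),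
      ((κ x).symm.trans (p.trans (κ y)) : FundamentalGroup (Surface g) _) ∈ S := by
    intro x y p
    refine pathClass_induction isOpen_surfaceCover exists_mem_surfaceCover
      (P := fun x y p => ((κ x).symm.trans (p.trans (κ y)) : FundamentalGroup (Surface g) _) ∈ S)
      ?_ ?_ p
    · intro x y z p q hp hq
      -- A product in the fundamental group is the composition of paths in the opposite order.
      have h := S.mul_mem hq hp
      rw [FundamentalGroup.mul_def] at h
      convert h using 1
      simp only [Path.Homotopic.Quotient.trans_assoc]
      rw [← Path.Homotopic.Quotient.trans_assoc (κ y), Path.Homotopic.Quotient.trans_symm,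
        Path.Homotopic.Quotient.refl_trans]
    · intro k x y γ hγ
      have hx : x ∈ surfaceCover g k := by simpa using hγ 0
      have hy : y ∈ surfaceCover g k := by simpa using hγ 1
      cases k with
      | none =>
        rw [hκ₀ x hx, hκ₀ y hy, hpath₀ x y γ hγ hx hy, Path.Homotopic.Quotient.symm_trans]
        exact one_mem S
      | some i =>
        obtain ⟨s, hs, hs'⟩ := hκ₁ x i hx
        obtain ⟨t, ht, ht'⟩ := hκ₁ y i hy
        have h : (Path.Homotopic.Quotient.mk γ).trans (κ y) =
            (κ x).trans ((Path.Homotopic.Quotient.symm s).trans t) := by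
          rw [hs', ht', Path.Homotopic.Quotient.trans_assoc, Path.Homotopic.Quotient.trans_assoc,
            ← Path.Homotopic.Quotient.trans_assoc s, Path.Homotopic.Quotient.trans_symm,
            Path.Homotopic.Quotient.refl_trans, ← Path.Homotopic.Quotient.trans_assoc,
            ← Path.Homotopic.Quotient.trans_assoc, hpath i x y γ hγ hx hy]
        rw [h, ← Path.Homotopic.Quotient.trans_assoc, Path.Homotopic.Quotient.symm_trans,
          Path.Homotopic.Quotient.refl_trans]
        exact S.mul_mem ht (S.inv_mem hs)
  rw [eq_top_iff]
  intro p _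
  have hb : rectBase g ∈ offArcs g := mem_offArcs_of_pos one_pos
  have hκb : κ (surfaceMk (rectBase g)) = .refl _ := by
    rw [hκ₀ _ hb, hη₀ _ hb, rectClass_self]
  have h := key _ _ p
  rw [hκb] at h
  convert h using 1
  refine Eq.trans ?_ (Path.Homotopic.Quotient.refl_trans _).symm
  exact (Path.Homotopic.Quotient.trans_refl _).symm

/-- The function of the cocycle is `1` on the cut disc. On the `i`-th pair of strips it is `c i`
over the first strip off the arcs, and `1` elsewhere. Off the arcs the two strips are disjoint open
sets, so the transition is locally constant, and a loop that enters the first arc and leaves the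
second collects exactly `c i`. -/
theorem exists_hom_arcLoop {K : Type*} [Group K] (c : Fin g × Bool → K) :
    ∃ f : FundamentalGroup (Surface g) (surfaceMk (rectBase g)) →* K,
      ∀ i, f (arcLoop i) = c i := by
  classical
  let A (i : Fin g × Bool) : Set (Surface g) :=
    surfaceSet (glueSaturated_inter_offArcs (firstStrip i))
  let B (i : Fin g × Bool) : Set (Surface g) :=
    surfaceSet (glueSaturated_inter_offArcs (secondStrip i))
  have hA : ∀ i, IsOpen (A i) :=
    fun i => isOpen_surfaceSet _ ((isOpen_firstStrip i).inter isOpen_offArcs)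
  have hB : ∀ i, IsOpen (B i) :=
    fun i => isOpen_surfaceSet _ ((isOpen_secondStrip i).inter isOpen_offArcs)
  have hAB : ∀ i x, x ∈ A i → x ∈ B i → False := by
    intro i x hxA hxB
    obtain ⟨p, rfl⟩ := surfaceMk_surjective x
    exact disjoint_firstStrip_secondStrip hxA.1 hxB.1
  let G : Option (Fin g × Bool) → Surface g → K :=
    fun k x => k.elim 1 fun i => if x ∈ A i then c i else 1
  have hG : ∀ i, ∀ x ∈ surfaceCover g none ∩ surfaceCover g (some i),
      ∀ᶠ y in 𝓝 x, G (some i) y = G (some i) x := by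
    rintro i x ⟨hx0, hxi⟩
    obtain ⟨p, rfl⟩ := surfaceMk_surjective x
    rcases hxi with hxi | hxi
    · have hx : surfaceMk p ∈ A i := ⟨hxi, hx0⟩
      filter_upwards [(hA i).mem_nhds hx] with y hy
      show (if y ∈ A i then c i else 1) = if surfaceMk p ∈ A i then c i else 1
      rw [if_pos hy, if_pos hx]
    · have hx : surfaceMk p ∈ B i := ⟨hxi, hx0⟩
      filter_upwards [(hB i).mem_nhds hx] with y hy
      show (if y ∈ A i then c i else 1) = if surfaceMk p ∈ A i then c i else 1
      rw [if_neg fun h => hAB i y h hy, if_neg fun h => hAB i _ h hx]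
  obtain ⟨Θ, hmul, hloc⟩ := exists_holonomy isOpen_surfaceCover exists_mem_surfaceCover G (by
    intro j k x hx
    rcases j with _ | j <;> rcases k with _ | k
    · exact Filter.Eventually.of_forall fun y => rfl
    · filter_upwards [hG k x hx] with y hy
      rw [hy]; rfl
    · filter_upwards [hG j x hx.symm] with y hy
      rw [hy]; rfl
    · obtain ⟨p, rfl⟩ := surfaceMk_surjective x
      obtain rfl : j = k := strip_inj (p := p) hx.1 hx.2
      refine Filter.Eventually.of_forall fun y => ?_
      rw [mul_inv_cancel, mul_inv_cancel])
  let f : FundamentalGroup (Surface g) (surfaceMk (rectBase g)) →* K :=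
    MonoidHom.mk' (fun p => Θ _ _ p) fun p q => hmul _ _ _ q p
  refine ⟨f, fun i => ?_⟩
  have hrect : ∀ k (p p' : Rect g), (∀ t, rectPath p p' t ∈ rectCover g k) →
      Θ _ _ (rectClass p p') = (G k (surfaceMk p'))⁻¹ * G k (surfaceMk p) := by
    intro k p p' h
    rw [← mk_map_surfaceMk (rectPath p p')]
    exact hloc k _ _ _ h
  have htop : ∀ a (p : Rect g), p = stripPoint i a 1 →
      (∀ t, rectPath (rectBase g) p t ∈ rectCover g none) ∧
      ∀ t, rectPath p (rectBase g) t ∈ rectCover g none := by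
    rintro a p rfl
    refine ⟨fun t => mem_offArcs_of_pos ?_, fun t => mem_offArcs_of_pos ?_⟩ <;>
      rw [rectPath_snd] <;> simp [rectBase, stripPoint]
  have hvert : ∀ a (y y' : I) t, (rectPath (stripPoint i a y) (stripPoint i a y') t).1.1 =
      arcStart i + a := by
    intro a y y' t
    rw [rectPath_fst]; simp [stripPoint]; ring
  have hmidf : ∀ p : Rect g, p.1.1 = arcStart i + firstMid → p ∈ firstStrip i := by
    intro p hp
    constructor <;> rw [hp] <;> simp only [firstMid] <;> linarith
  have hmids : ∀ p : Rect g, p.1.1 = arcStart i + secondMid → p ∈ secondStrip i := by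
    intro p hp
    constructor <;> rw [hp] <;> simp only [secondMid] <;> linarith
  have hoff : ∀ a, stripPoint i a 1 ∈ offArcs g := fun a => mem_offArcs_of_pos one_pos
  have e1 : Θ _ _ (rectClass (rectBase g) (stripPoint i firstMid 1)) = 1 := by
    rw [hrect none _ _ (htop _ _ rfl).1]
    show (1 : K)⁻¹ * 1 = 1
    simp
  -- The value of `G (some i)` at the arc itself is left unevaluated: it cancels against the one in
  -- `e4`, as the two midpoints have the same image.
  have e2 : Θ _ _ (rectClass (stripPoint i firstMid 1) (stripPoint i firstMid 0)) =
      (G (some i) (surfaceMk (stripPoint i firstMid 0)))⁻¹ * c i := by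
    rw [hrect (some i) _ _ fun t => Or.inl (hmidf _ (hvert _ _ _ t))]
    congr 1
    exact if_pos (⟨hmidf _ rfl, hoff _⟩ : surfaceMk (stripPoint i firstMid 1) ∈ A i)
  have e3 : Θ _ _ (rectClass (stripPoint i secondMid 1) (rectBase g)) = 1 := by
    rw [hrect none _ _ (htop _ _ rfl).2]
    show (1 : K)⁻¹ * 1 = 1
    simp
  have e4 : Θ _ _ (rectClass (stripPoint i secondMid 0) (stripPoint i secondMid 1)) =
      G (some i) (surfaceMk (stripPoint i secondMid 0)) := by
    rw [hrect (some i) _ _ fun t => Or.inr (hmids _ (hvert _ _ _ t))]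
    have : G (some i) (surfaceMk (stripPoint i secondMid 1)) = 1 := if_neg fun h =>
      hAB i _ h (⟨hmids _ rfl, hoff _⟩ : surfaceMk (stripPoint i secondMid 1) ∈ B i)
    rw [this, inv_one, one_mul]
  have e5 : ∀ (x : Surface g) (h : x = surfaceMk (stripPoint i secondMid 0)),
      Θ _ _ ((rectClass (stripPoint i secondMid 0) (rectBase g)).cast h rfl) = G (some i) x := by
    rintro x rfl
    rw [Path.Homotopic.Quotient.cast_rfl_rfl, ← rectClass_trans _ (stripPoint i secondMid 1), hmul,
      e3, e4, one_mul]
  show Θ _ _ ((rectClass (rectBase g) (stripPoint i firstMid 0)).trans (secondReturn i)) = c i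
  rw [hmul, secondReturn, e5, ← rectClass_trans _ (stripPoint i firstMid 1), hmul, e1, e2, mul_one,
    mul_inv_cancel_left]

/-- The fundamental group of the surface is free of rank `2g`. -/
theorem exists_isFreeBasis_surfaceGroup (x₀ : Surface g) :
    ∃ l : Fin g × Bool → SurfaceGroup g x₀, IsFreeBasis l := by
  obtain ⟨p, rfl⟩ := surfaceMk_surjective x₀
  have h : IsFreeBasis (arcLoop (g := g)) :=
    ⟨closure_arcLoop, fun K _ c => exists_hom_arcLoop c⟩
  exact ⟨_, h.map (FundamentalGroup.fundamentalGroupMulEquivOfPath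
    ((rectPath (rectBase g) p).map surfaceMk.continuous))⟩

end SurfaceGroupFree

/-! ### The filtration of the completion; the completion is a local ring -/

section CompletionFiltration

variable {R : Type*} [Ring R] [Algebra ℚ R] (ε : R →ₐ[ℚ] ℚ)

theorem factor_complProj {m n : ℕ} (h : m ≤ n) (a : AugCompletion ε) :
    Ideal.Quotient.factorₐ ℚ (Ideal.pow_le_pow_right h) (complProj ε n a) = complProj ε m a :=
  a.2 m n h

variable {ε} in
theorem AugCompletion.ext {a b : AugCompletion ε} (h : ∀ n, complProj ε n a = complProj ε n b) :
    a = b :=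
  Subtype.ext (funext h)

/-- The canonical map from an algebra to its completion. -/
def toCompl : R →ₐ[ℚ] AugCompletion ε :=
  AlgHom.codRestrict (AlgHom.pi
    fun n => Ideal.Quotient.mkₐ ℚ (RingHom.ker ε ^ n)) (compatSeq ε) fun _ _ _ _ => rfl

theorem complProj_toCompl (n : ℕ) (r : R) :
    complProj ε n (toCompl ε r) = Ideal.Quotient.mk (RingHom.ker ε ^ n) r := rfl

theorem complAug_toCompl (r : R) : complAug ε (toCompl ε r) = ε r := rfl

theorem complProj_eq_of_le {m n : ℕ} (h : m ≤ n) {a b : AugCompletion ε}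
    (hab : complProj ε n a = complProj ε n b) : complProj ε m a = complProj ε m b := by
  rw [← factor_complProj ε h, ← factor_complProj ε h, hab]

theorem exists_toCompl (n : ℕ) (a : AugCompletion ε) :
    ∃ r, ∀ m ≤ n, complProj ε m a = complProj ε m (toCompl ε r) := by
  obtain ⟨r, hr⟩ := Ideal.Quotient.mk_surjective (complProj ε n a)
  exact ⟨r, fun m hm => complProj_eq_of_le ε hm (hr.symm.trans (complProj_toCompl ε n r).symm)⟩

/-- Completeness in the form used by every successive approximation below. The diagonal sequence
`complProj ε n (a n)` is compatible. -/
theorem exists_limit (a : ℕ → AugCompletion ε)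
    (h : ∀ n, complProj ε n (a (n + 1)) = complProj ε n (a n)) :
    ∃ b, ∀ n, complProj ε n b = complProj ε n (a n) := by
  have h' : ∀ m n, m ≤ n → complProj ε m (a n) = complProj ε m (a m) := by
    intro m n hmn
    induction n, hmn using Nat.le_induction with
    | base => rfl
    | succ n hmn ih => exact (complProj_eq_of_le ε hmn (h n)).trans ih
  refine ⟨⟨fun n => complProj ε n (a n), fun m n hmn => ?_⟩, fun n => rfl⟩
  exact (factor_complProj ε hmn _).trans (h' m n hmn)

/-- The `I`-adic filtration of the completion. -/
def complFilt (n : ℕ) : Submodule ℚ (AugCompletion ε) := LinearMap.ker (complProj ε n).toLinearMap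

variable {ε}

theorem mem_complFilt {n : ℕ} {a : AugCompletion ε} : a ∈ complFilt ε n ↔ complProj ε n a = 0 :=
  Iff.rfl

theorem sub_mem_complFilt {n : ℕ} {a b : AugCompletion ε} :
    a - b ∈ complFilt ε n ↔ complProj ε n a = complProj ε n b := by
  rw [mem_complFilt, map_sub, sub_eq_zero]

theorem complFilt_anti {m n : ℕ} (h : m ≤ n) : complFilt ε n ≤ complFilt ε m := by
  intro a ha
  rw [mem_complFilt] at ha ⊢
  rw [← factor_complProj ε h, ha, map_zero]

theorem mem_complFilt_zero (a : AugCompletion ε) : a ∈ complFilt ε 0 := by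
  obtain ⟨r, hr⟩ := exists_toCompl ε 0 a
  rw [mem_complFilt, hr 0 le_rfl, complProj_toCompl, Ideal.Quotient.eq_zero_iff_mem, Submodule.pow_zero,
    Ideal.one_eq_top]
  trivial

theorem toCompl_mem_complFilt {n : ℕ} {r : R} :
    toCompl ε r ∈ complFilt ε n ↔ r ∈ RingHom.ker ε ^ n := by
  rw [mem_complFilt, complProj_toCompl, Ideal.Quotient.eq_zero_iff_mem]

/-- Only the projection to level `m + n` matters. Up to that level both factors may be replaced by
elements of `R`, and there the powers of the two-sided ideal multiply. -/
theorem mul_mem_complFilt {m n : ℕ} {a b : AugCompletion ε} (ha : a ∈ complFilt ε m)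
    (hb : b ∈ complFilt ε n) : a * b ∈ complFilt ε (m + n) := by
  obtain ⟨r, hr⟩ := exists_toCompl ε (m + n) a
  obtain ⟨s, hs⟩ := exists_toCompl ε (m + n) b
  rw [mem_complFilt, hr m (Nat.le_add_right _ _), ← mem_complFilt, toCompl_mem_complFilt] at ha
  rw [mem_complFilt, hs n (Nat.le_add_left _ _), ← mem_complFilt, toCompl_mem_complFilt] at hb
  rw [mem_complFilt, map_mul, hr _ le_rfl, hs _ le_rfl, ← map_mul, ← map_mul, ← mem_complFilt,
    toCompl_mem_complFilt, Ideal.IsTwoSided.pow_add]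
  exact Ideal.mul_mem_mul ha hb

theorem mul_mem_complFilt_left {n : ℕ} (a : AugCompletion ε) {b : AugCompletion ε}
    (hb : b ∈ complFilt ε n) : a * b ∈ complFilt ε n := by
  simpa using mul_mem_complFilt (mem_complFilt_zero a) hb

theorem mul_mem_complFilt_right {n : ℕ} {a : AugCompletion ε} (b : AugCompletion ε)
    (ha : a ∈ complFilt ε n) : a * b ∈ complFilt ε n := by
  simpa using mul_mem_complFilt ha (mem_complFilt_zero b)

theorem pow_mem_complFilt {a : AugCompletion ε} (ha : a ∈ complFilt ε 1) (n : ℕ) :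
    a ^ n ∈ complFilt ε n := by
  induction n with
  | zero => exact mem_complFilt_zero _
  | succ n ih => rw [pow_succ]; exact mul_mem_complFilt ih ha

theorem complAug_eq_zero_iff {a : AugCompletion ε} : complAug ε a = 0 ↔ a ∈ complFilt ε 1 := by
  obtain ⟨r, hr⟩ := exists_toCompl ε 1 a
  have h : complAug ε a = ε r := by
    rw [← complAug_toCompl]
    exact congrArg (Ideal.Quotient.liftₐ (RingHom.ker ε ^ 1) ε
      fun a ha => by rwa [Submodule.pow_one, RingHom.mem_ker] at ha) (hr 1 le_rfl)
  rw [h, mem_complFilt, hr 1 le_rfl, ← mem_complFilt, toCompl_mem_complFilt, Submodule.pow_one,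
    RingHom.mem_ker]

theorem mem_complIdeal_iff {a : AugCompletion ε} : a ∈ complIdeal ε ↔ a ∈ complFilt ε 1 :=
  complAug_eq_zero_iff

/-- The geometric series. -/
theorem isUnit_one_sub {z : AugCompletion ε} (hz : z ∈ complFilt ε 1) : IsUnit (1 - z) := by
  obtain ⟨b, hb⟩ := exists_limit ε (fun n => ∑ k ∈ Finset.range n, z ^ k) (by
    intro n
    rw [Finset.sum_range_succ, map_add, mem_complFilt.1 (pow_mem_complFilt hz n), add_zero])
  have h0 : ∀ n, complProj ε n z ^ n = 0 := by
    intro n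
    rw [← map_pow]
    exact pow_mem_complFilt hz n
  refine ⟨⟨1 - z, b, AugCompletion.ext fun n => ?_, AugCompletion.ext fun n => ?_⟩, rfl⟩
  · rw [map_mul, hb, map_sub, map_one, map_sum]
    simp only [map_pow]
    rw [mul_neg_geom_sum, h0, sub_zero]
  · rw [map_mul, hb, map_sub, map_one, map_sum]
    simp only [map_pow]
    rw [geom_sum_mul_neg, h0, sub_zero]

/-- Dividing by the augmentation leaves `1` minus an element of positive filtration. This is the
local ring property on which the elimination in `K₁` rests. -/
theorem isUnit_of_complAug_ne_zero {a : AugCompletion ε} (h : complAug ε a ≠ 0) : IsUnit a := by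
  set q := complAug ε a
  have h1 : 1 - q⁻¹ • a ∈ complFilt ε 1 := by
    rw [← complAug_eq_zero_iff, map_sub, map_one, map_smul, smul_eq_mul, inv_mul_cancel₀ h,
      sub_self]
  have h2 := isUnit_one_sub h1
  rw [sub_sub_cancel] at h2
  have h3 : a = algebraMap ℚ (AugCompletion ε) q * (q⁻¹ • a) := by
    rw [← Algebra.smul_def, smul_smul, mul_inv_cancel₀ h, one_smul]
  rw [h3]
  exact ((IsUnit.mk0 q h).map (algebraMap ℚ (AugCompletion ε))).mul h2

theorem isUnit_of_sub_one_mem {a : AugCompletion ε} (h : a - 1 ∈ complFilt ε 1) : IsUnit a := by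
  have h' := isUnit_one_sub (neg_mem h)
  rwa [sub_neg_eq_add, add_sub_cancel] at h'

end CompletionFiltration

/-! ### Additivity of the logarithm under a trace -/

section LogTrace

open Polynomial

variable {S V : Type*} [Ring S] [Algebra ℚ S] [AddCommGroup V] [Module ℚ V]

/-- The truncation `∑_{k < m} (-1)ᵏ / (k + 1) cᵏ⁺¹` of `log (1 + c)`. -/
def truncLog {S : Type*} [Ring S] [Algebra ℚ S] (m : ℕ) (c : S) : S :=
  ∑ k ∈ Finset.range m, ((-1 : ℚ) ^ k / (k + 1)) • c ^ (k + 1)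

theorem map_truncLog {S' : Type*} [Ring S'] [Algebra ℚ S'] (f : S →ₐ[ℚ] S') (m : ℕ) (c : S) :
    f (truncLog m c) = truncLog m (f c) := by
  simp [truncLog]

/-- Under a trace, the derivative of a power is as in the commutative case. -/
theorem trace_derivative_pow (σ : S[X] →ₗ[ℚ] V) (hσ : ∀ p q, σ (p * q) = σ (q * p)) (c : S[X])
    (k : ℕ) : σ (derivative (c ^ (k + 1))) = ((k : ℚ) + 1) • σ (c ^ k * derivative c) := by
  have key : ∀ n : ℕ, ∀ a : S[X], σ (a * derivative (c ^ n)) + σ (c ^ n * derivative a) =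
      σ (derivative (a * c ^ n)) := by
    intro n a
    rw [derivative_mul, map_add, add_comm, hσ (c ^ n)]
  have h : ∀ n j : ℕ, σ (c ^ j * derivative (c ^ (n + 1))) =
      ((n : ℚ) + 1) • σ (c ^ (j + n) * derivative c) := by
    intro n
    induction n with
    | zero => intro j; simp
    | succ n ih =>
      intro j
      rw [pow_succ c (n + 1), derivative_mul, mul_add, map_add, ← mul_assoc, hσ, ← mul_assoc,
        ← pow_succ', ih, ← mul_assoc, ← pow_add]
      have e1 : j + 1 + n = j + (n + 1) := by ring
      rw [e1]
      push_cast
      rw [add_smul ((n : ℚ) + 1), one_smul]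
  simpa using h k 0

/-- The polynomials whose coefficients are in a given subspace. -/
def coeffIn (J : Submodule ℚ S) : Set S[X] := {p | ∀ i, p.coeff i ∈ J}

theorem mul_mem_coeffIn {J : ℕ → Submodule ℚ S}
    (hJ : ∀ m n x y, x ∈ J m → y ∈ J n → x * y ∈ J (m + n)) {m n : ℕ} {p q : S[X]}
    (hp : p ∈ coeffIn (J m)) (hq : q ∈ coeffIn (J n)) : p * q ∈ coeffIn (J (m + n)) := by
  intro i
  rw [coeff_mul]
  exact Submodule.sum_mem _ fun x _ => hJ _ _ _ _ (hp _) (hq _)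

/-- The logarithm is additive under a trace that vanishes on `J m`. -/
theorem trace_truncLog_mul {J : ℕ → Submodule ℚ S} (h0 : J 0 = ⊤)
    (hJ : ∀ m n x y, x ∈ J m → y ∈ J n → x * y ∈ J (m + n)) (τ : S →ₗ[ℚ] V)
    (hτ : ∀ x y, τ (x * y) = τ (y * x)) {m : ℕ} (hm : ∀ x ∈ J m, τ x = 0) {x y : S}
    (hx : x ∈ J 1) (hy : y ∈ J 1) :
    τ (truncLog m (x + y + x * y)) = τ (truncLog m x) + τ (truncLog m y) := by
  have htop : ∀ p : S[X], p ∈ coeffIn (J 0) := fun p i => by rw [h0]; trivial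
  have hpow : ∀ p : S[X], p ∈ coeffIn (J 1) → ∀ n, p ^ n ∈ coeffIn (J n) := by
    intro p hp n
    induction n with
    | zero => exact htop _
    | succ n ih => rw [pow_succ]; exact mul_mem_coeffIn hJ ih hp
  have hJ1 : ∀ u v, v ∈ J 1 → u * v ∈ J 1 := fun u v hv => by
    simpa using hJ 0 1 u v (by rw [h0]; trivial) hv
  let σ (j : ℕ) : S[X] →ₗ[ℚ] V := τ ∘ₗ (lcoeff S j).restrictScalars ℚ
  have hσ : ∀ j p q, σ j (p * q) = σ j (q * p) := by
    intro j p q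
    show τ ((p * q).coeff j) = τ ((q * p).coeff j)
    rw [coeff_mul, coeff_mul, map_sum, map_sum, ← Finset.Nat.sum_antidiagonal_swap]
    exact Finset.sum_congr rfl fun _ _ => hτ _ _
  have hσ0 : ∀ j p, p ∈ coeffIn (J m) → σ j p = 0 := fun j p hp => hm _ (hp j)
  have hσm : ∀ j p q r, p ∈ coeffIn (J m) → σ j (q * p * r) = 0 := by
    intro j p q r hp
    refine hσ0 j _ ?_
    simpa using mul_mem_coeffIn hJ (mul_mem_coeffIn hJ (htop q) hp) (htop r)
  -- The family `1 + c = (1 + xX)(1 + y)` joins `1 + y` at `X = 0` to `(1 + x)(1 + y)` at `X = 1`,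
  -- while `1 + a = 1 + xX` joins `1` to `1 + x`. The two logarithms have the same traced
  -- derivative, so their traces change by the same amount.
  let a : S[X] := C x * X
  let c : S[X] := C x * X + C y + C (x * y) * X
  have ha : a ∈ coeffIn (J 1) := by
    intro i
    simp only [a, coeff_C_mul, coeff_X]
    split_ifs
    · simpa using hx
    · simp
  have hc : c ∈ coeffIn (J 1) := by
    intro i
    simp only [c, coeff_add, coeff_C_mul, coeff_X, coeff_C]
    refine add_mem (add_mem ?_ ?_) ?_ <;> split_ifs
    · simpa using hx
    · simp
    · exact hy
    · exact zero_mem _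
    · simpa using hJ1 x y hy
    · simp
  have hda : derivative a = C x := by simp [a]
  have hdc : derivative c = C x * C (1 + y) := by
    simp [c, mul_add]
  have hac : (1 + a) * C (1 + y) = 1 + c := by
    simp only [a, c, map_add, map_mul, map_one, add_mul, mul_add, one_mul, mul_one]
    rw [mul_assoc (C x) X, X_mul_C, ← mul_assoc]
    abel
  have hdlog : ∀ j (p : S[X]), σ j (derivative (truncLog m p)) =
      σ j ((∑ k ∈ Finset.range m, (-p) ^ k) * derivative p) := by
    intro j p
    rw [truncLog, map_sum, map_sum, Finset.sum_mul, map_sum]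
    refine Finset.sum_congr rfl fun k _ => ?_
    have hk : ((k : ℚ) + 1) ≠ 0 := by positivity
    rw [derivative_smul, map_smul, trace_derivative_pow (σ j) (hσ j), smul_smul,
      div_mul_cancel₀ _ hk, ← map_smul, neg_pow p, mul_assoc]
    congr 1
    rw [Algebra.smul_def]
    congr 1
    simp
  set sa := ∑ k ∈ Finset.range m, (-a) ^ k with hsa
  set sc := ∑ k ∈ Finset.range m, (-c) ^ k with hsc
  have hsa' : sa * (1 + a) = 1 - (-a) ^ m := by
    have := geom_sum_mul_neg (-a) m
    rwa [sub_neg_eq_add] at this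
  have hsc' : (1 + c) * sc = 1 - (-c) ^ m := by
    have := mul_neg_geom_sum (-c) m
    rwa [sub_neg_eq_add] at this
  have hneg : ∀ p : S[X], p ∈ coeffIn (J 1) → (-p) ^ m ∈ coeffIn (J m) := by
    intro p hp
    refine hpow _ (fun i => ?_) m
    rw [coeff_neg]
    exact neg_mem (hp i)
  -- Modulo `J m`, `sa` and `sc` are the inverses of `1 + a` and `1 + c = (1 + a) C(1 + y)`.
  -- Cyclicity moves `C (1 + y)` to the front, where it turns `sc` into `sa`.
  have hmain : ∀ j, σ j (derivative (truncLog m c)) = σ j (derivative (truncLog m a)) := by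
    intro j
    rw [hdlog, hdlog, hda, hdc, ← hsa, ← hsc, ← mul_assoc, hσ]
    have e : (1 - (-a) ^ m) * (C (1 + y) * sc * C x) = sa * (1 - (-c) ^ m) * C x := by
      rw [← hsa', ← hsc', ← hac]
      simp only [mul_assoc]
    have e' : C (1 + y) * (sc * C x) = sa * C x - sa * (-c) ^ m * C x +
        1 * (-a) ^ m * (C (1 + y) * sc * C x) := by
      have : sa * C x - sa * (-c) ^ m * C x = sa * (1 - (-c) ^ m) * C x := by
        rw [mul_sub, sub_mul, mul_one]
      rw [this, ← e]
      simp only [sub_mul, one_mul, mul_assoc]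
      abel
    rw [e', map_add, map_sub, hσm j _ _ _ (hneg c hc), hσm j _ _ _ (hneg a ha), sub_zero, add_zero]
  -- Differentiation multiplies the coefficient of degree `j + 1` by `j + 1`, which is invertible
  -- over `ℚ`. Only the constant coefficients can differ.
  have hcoeff : ∀ j, τ ((truncLog m c).coeff (j + 1)) = τ ((truncLog m a).coeff (j + 1)) := by
    intro j
    have h := hmain j
    change τ ((derivative (truncLog m c)).coeff j) = τ ((derivative (truncLog m a)).coeff j) at h
    rw [coeff_derivative, coeff_derivative] at h
    have hj : ((j : S) + 1) = algebraMap ℚ S ((j : ℚ) + 1) := by simp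
    rw [hj, ← Algebra.commutes, ← Algebra.smul_def, ← Algebra.commutes, ← Algebra.smul_def,
      map_smul, map_smul] at h
    have hj' : ((j : ℚ) + 1) ≠ 0 := by positivity
    exact smul_right_injective V hj' h
  let ev (s : ℚ) : S[X] →ₐ[ℚ] S :=
    { (eval₂RingHom' (RingHom.id S) (algebraMap ℚ S s) fun r => (Algebra.commutes s r).symm) with
      commutes' := fun r => by
        show eval₂ (RingHom.id S) (algebraMap ℚ S s) (algebraMap ℚ S[X] r) = _
        rw [Polynomial.algebraMap_apply, eval₂_C]
        rfl }
  have hev1 : ∀ p : S[X], ev 1 p = p.sum fun _ b => b := by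
    intro p
    show eval₂ (RingHom.id S) (algebraMap ℚ S 1) p = _
    rw [eval₂_eq_sum]; simp
  have hev0 : ∀ p : S[X], ev 0 p = p.coeff 0 := by
    intro p
    show eval₂ (RingHom.id S) (algebraMap ℚ S 0) p = _
    rw [map_zero, eval₂_at_zero]; rfl
  have hτ1 : ∀ p : S[X], τ (ev 1 p) = τ (p.coeff 0) + τ (p.divX.sum fun _ b => b) := by
    intro p
    conv_lhs => rw [← divX_mul_X_add p]
    rw [map_add, map_mul, map_add, add_comm]
    have e1 : ev 1 (C (p.coeff 0)) = p.coeff 0 := by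
      show eval₂ (RingHom.id S) (algebraMap ℚ S 1) _ = _
      simp
    have e2 : ev 1 X = 1 := by
      show eval₂ (RingHom.id S) (algebraMap ℚ S 1) _ = _
      simp
    rw [e1, e2, mul_one, hev1]
  have hdiv : τ ((truncLog m c).divX.sum fun _ b => b) =
      τ ((truncLog m a).divX.sum fun _ b => b) := by
    have : ∀ p : S[X], ∀ N, p.natDegree < N →
        τ (p.sum fun _ b => b) = ∑ j ∈ Finset.range N, τ (p.coeff j) := by
      intro p N hN
      rw [sum_over_range' p (fun _ => rfl) N hN, map_sum]
    rw [this _ (max (truncLog m c).divX.natDegree (truncLog m a).divX.natDegree + 1)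
      (Nat.lt_succ_of_le (le_max_left _ _)),
      this _ (max (truncLog m c).divX.natDegree (truncLog m a).divX.natDegree + 1)
      (Nat.lt_succ_of_le (le_max_right _ _))]
    refine Finset.sum_congr rfl fun j _ => ?_
    rw [coeff_divX, coeff_divX, hcoeff]
  have hc1 : ev 1 c = x + y + x * y := by
    show eval₂ (RingHom.id S) (algebraMap ℚ S 1) c = _
    simp [c]
  have ha1 : ev 1 a = x := by
    show eval₂ (RingHom.id S) (algebraMap ℚ S 1) a = _
    simp [a]
  have hc0 : ev 0 c = y := by
    rw [hev0]; simp [c]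
  have ha0 : ev 0 a = 0 := by
    rw [hev0]; simp [a]
  have htl0 : truncLog m (0 : S) = 0 := by simp [truncLog]
  rw [← hc1, ← map_truncLog, hτ1, hdiv, ← hev0, map_truncLog, hc0]
  have := hτ1 (truncLog m a)
  rw [← hev0, map_truncLog, map_truncLog, ha1, ha0, htl0, map_zero, zero_add] at this
  rw [this, add_comm]

end LogTrace

/-! ### Tensors, rotations and commutators -/

section CyclicTensors

variable {H : Type*} [AddCommGroup H] [Module ℚ H]

/-- The component of degree `n` of an element of the tensor algebra. -/
def tensorDeg (n : ℕ) : TensorAlgebra ℚ H →ₗ[ℚ] ⨂[ℚ]^n H :=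
  DirectSum.component ℚ ℕ (fun n => ⨂[ℚ]^n H) n ∘ₗ
    (TensorAlgebra.toDirectSum (R := ℚ) (M := H)).toLinearMap

theorem tensorDeg_tprod (n : ℕ) (x : Fin n → H) :
    tensorDeg n (TensorAlgebra.tprod ℚ H n x) = PiTensorProduct.tprod ℚ x := by
  show DirectSum.component ℚ ℕ (fun n => ⨂[ℚ]^n H) n (TensorAlgebra.toDirectSum _) = _
  rw [TensorAlgebra.toDirectSum_tensorPower_tprod]
  exact DirectSum.of_eq_same _ _

theorem tensorDeg_tprod_of_ne {m n : ℕ} (h : m ≠ n) (x : Fin m → H) :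
    tensorDeg n (TensorAlgebra.tprod ℚ H m x) = 0 := by
  show DirectSum.component ℚ ℕ (fun n => ⨂[ℚ]^n H) n (TensorAlgebra.toDirectSum _) = _
  rw [TensorAlgebra.toDirectSum_tensorPower_tprod]
  exact DirectSum.of_eq_of_ne _ _ _ h.symm

theorem tensorDeg_toTensorAlgebra (n : ℕ) (x : ⨂[ℚ]^n H) :
    tensorDeg n (TensorPower.toTensorAlgebra x) = x := by
  have : tensorDeg n ∘ₗ TensorPower.toTensorAlgebra = LinearMap.id (R := ℚ) (M := ⨂[ℚ]^n H) := by
    ext y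
    simp [tensorDeg_tprod, -TensorAlgebra.tprod_apply]
  exact LinearMap.congr_fun this x

theorem toTensorAlgebra_injective (n : ℕ) :
    Function.Injective (TensorPower.toTensorAlgebra : ⨂[ℚ]^n H →ₗ[ℚ] TensorAlgebra ℚ H) :=
  Function.LeftInverse.injective (tensorDeg_toTensorAlgebra n)

theorem ι_mul_tprod (n : ℕ) (m : H) (x : Fin n → H) :
    TensorAlgebra.ι ℚ m * TensorAlgebra.tprod ℚ H n x =
      TensorAlgebra.tprod ℚ H (n + 1) (Fin.cons m x) := by
  simp [TensorAlgebra.tprod_apply, List.ofFn_succ]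

theorem tprod_mul_ι (n : ℕ) (m : H) (x : Fin n → H) :
    TensorAlgebra.tprod ℚ H n x * TensorAlgebra.ι ℚ m =
      TensorAlgebra.tprod ℚ H (n + 1) (Fin.snoc x m) := by
  rw [TensorAlgebra.tprod_apply, TensorAlgebra.tprod_apply, List.ofFn_succ', List.concat_eq_append,
    List.prod_append]
  simp

theorem tprod_mem_range_ι_pow (n : ℕ) (x : Fin n → H) :
    TensorAlgebra.tprod ℚ H n x ∈ LinearMap.range (TensorAlgebra.ι ℚ (M := H)) ^ n := by
  induction n with
  | zero => simp
  | succ n ih =>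
    rw [← Fin.snoc_init_self x, ← tprod_mul_ι, pow_succ]
    exact Submodule.mul_mem_mul (ih _) (LinearMap.mem_range_self _ _)

theorem toTensorAlgebra_mem (n : ℕ) (x : ⨂[ℚ]^n H) :
    TensorPower.toTensorAlgebra x ∈ LinearMap.range (TensorAlgebra.ι ℚ (M := H)) ^ n := by
  have h : x ∈ Submodule.span ℚ (Set.range (PiTensorProduct.tprod ℚ (s := fun _ : Fin n => H))) := by
    rw [PiTensorProduct.span_tprod_eq_top]; trivial
  induction h using Submodule.span_induction with
  | mem x hx =>
    obtain ⟨y, rfl⟩ := hx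
    rw [TensorPower.toTensorAlgebra_tprod]
    exact tprod_mem_range_ι_pow n y
  | zero => rw [map_zero]; exact zero_mem _
  | add x y _ _ hx hy => rw [map_add]; exact add_mem hx hy
  | smul c x _ hx => rw [map_smul]; exact Submodule.smul_mem _ c hx

theorem toTensorAlgebra_tensorDeg {n : ℕ} {t : TensorAlgebra ℚ H}
    (ht : t ∈ LinearMap.range (TensorAlgebra.ι ℚ (M := H)) ^ n) :
    TensorPower.toTensorAlgebra (tensorDeg n t) = t := by
  have h : LinearMap.range (TensorAlgebra.ι ℚ (M := H)) ^ n ≤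
      Submodule.span ℚ (Set.range (TensorAlgebra.tprod ℚ H n)) := by
    clear ht
    induction n with
    | zero =>
      rw [pow_zero, Submodule.one_eq_span]
      refine Submodule.span_mono ?_
      rintro _ rfl
      exact ⟨Fin.elim0, by simp⟩
    | succ n ih =>
      rw [pow_succ']
      refine Submodule.mul_le.2 ?_
      rintro _ ⟨m, rfl⟩ t ht
      refine (Submodule.span_le.2 ?_ : Submodule.span ℚ (Set.range (TensorAlgebra.tprod ℚ H n)) ≤
        (Submodule.span ℚ (Set.range (TensorAlgebra.tprod ℚ H (n + 1)))).comap
          (LinearMap.mulLeft ℚ (TensorAlgebra.ι ℚ m))) (ih ht)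
      rintro _ ⟨y, rfl⟩
      refine Submodule.subset_span ⟨Fin.cons m y, ?_⟩
      rw [LinearMap.mulLeft_apply, ι_mul_tprod]
  have ht' := h ht
  clear ht
  induction ht' using Submodule.span_induction with
  | mem x hx =>
    obtain ⟨y, rfl⟩ := hx
    rw [tensorDeg_tprod, TensorPower.toTensorAlgebra_tprod]
  | zero => simp
  | add x y _ _ hx hy => rw [map_add, map_add, hx, hy]
  | smul c x _ hx => rw [map_smul, map_smul, hx]

theorem tensorAlgebra_linearMap_ext {V : Type*} [AddCommGroup V] [Module ℚ V]
    {f f' : TensorAlgebra ℚ H →ₗ[ℚ] V}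
    (h : ∀ n x, f (TensorAlgebra.tprod ℚ H n x) = f' (TensorAlgebra.tprod ℚ H n x)) : f = f' := by
  have h' : f ∘ₗ (TensorAlgebra.ofDirectSum (R := ℚ) (M := H)).toLinearMap =
      f' ∘ₗ (TensorAlgebra.ofDirectSum (R := ℚ) (M := H)).toLinearMap := by
    refine DirectSum.linearMap_ext ℚ fun n => PiTensorProduct.ext ?_
    ext x
    have := h n x
    rw [← TensorAlgebra.ofDirectSum_of_tprod] at this
    exact this
  ext t
  rw [← TensorAlgebra.ofDirectSum_toDirectSum t]
  exact LinearMap.congr_fun h' _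

/-- The rotation sends position `i` to `i + 1` and the last position to `0`. This relates the
coinvariants to the two products with an element of degree one. -/
theorem permTensor_finRotate (n : ℕ) (m : H) (x : Fin n → H) :
    permTensor H (n + 1) (finRotate (n + 1))
      (PiTensorProduct.tprod ℚ (Fin.snoc x m : Fin (n + 1) → H)) =
      PiTensorProduct.tprod ℚ (Fin.cons m x : Fin (n + 1) → H) := by
  refine (PiTensorProduct.reindex_tprod (s := fun _ : Fin (n + 1) => H) _ _).trans ?_
  congr 1
  funext i
  refine Fin.cases ?_ (fun i => ?_) i
  · have : (finRotate (n + 1)).symm 0 = Fin.last n := by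
      rw [Equiv.symm_apply_eq, finRotate_last]
    rw [this, Fin.snoc_last, Fin.cons_zero]
  · have : (finRotate (n + 1)).symm i.succ = i.castSucc := by
      rw [Equiv.symm_apply_eq, finRotate_apply, Fin.coeSucc_eq_succ]
    rw [this, Fin.snoc_castSucc, Fin.cons_succ]

variable (H) in
/-- The class in `H^{⊗ n} / ℤ_n` of the component of degree `n`. -/
def cycClass (n : ℕ) : TensorAlgebra ℚ H →ₗ[ℚ] CyclicTensor H n :=
  Submodule.mkQ _ ∘ₗ tensorDeg n

theorem cycClass_mul_ι (n : ℕ) (u : TensorAlgebra ℚ H) (m : H) :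
    cycClass H n (u * TensorAlgebra.ι ℚ m) = cycClass H n (TensorAlgebra.ι ℚ m * u) := by
  have h : cycClass H n ∘ₗ LinearMap.mulRight ℚ (TensorAlgebra.ι ℚ m) =
      cycClass H n ∘ₗ LinearMap.mulLeft ℚ (TensorAlgebra.ι ℚ m) := by
    refine tensorAlgebra_linearMap_ext fun k x => ?_
    rw [LinearMap.comp_apply, LinearMap.comp_apply, LinearMap.mulRight_apply,
      LinearMap.mulLeft_apply, ι_mul_tprod, tprod_mul_ι, cycClass, LinearMap.comp_apply,
      LinearMap.comp_apply]
    by_cases hk : k + 1 = n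
    · subst hk
      rw [tensorDeg_tprod, tensorDeg_tprod, eq_comm, ← sub_eq_zero, ← map_sub,
        ← permTensor_finRotate, Submodule.mkQ_apply, Submodule.Quotient.mk_eq_zero]
      exact Submodule.subset_span ⟨_, Subgroup.mem_zpowers _, _, rfl⟩
    · rw [tensorDeg_tprod_of_ne hk, tensorDeg_tprod_of_ne hk]
  exact LinearMap.congr_fun h u

/-- A product is moved around the circle one factor at a time, so the case of degree one suffices.
Thus `cycClass` is a trace on the tensor algebra. -/
theorem cycClass_mul_comm (n : ℕ) (u v : TensorAlgebra ℚ H) :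
    cycClass H n (u * v) = cycClass H n (v * u) := by
  induction v using TensorAlgebra.induction generalizing u with
  | algebraMap r => rw [Algebra.commutes]
  | ι m => exact cycClass_mul_ι n u m
  | mul a b ha hb => rw [← mul_assoc, hb, ← mul_assoc, ha, mul_assoc]
  | add a b ha hb => rw [mul_add, add_mul, map_add, map_add, ha, hb]

/-- The tensors that vanish in the cyclic coinvariants are sums of commutators with the elements of
a spanning set. -/
theorem exists_commutators {ι : Type*} [Fintype ι] {e : ι → H}
    (he : Submodule.span ℚ (Set.range e) = ⊤) {n : ℕ} {x : ⨂[ℚ]^(n + 1) H}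
    (hx : (Submodule.Quotient.mk x : CyclicTensor H (n + 1)) = 0) :
    ∃ w : ι → ⨂[ℚ]^n H, TensorPower.toTensorAlgebra x =
      ∑ i, (TensorAlgebra.ι ℚ (e i) * TensorPower.toTensorAlgebra (w i) -
        TensorPower.toTensorAlgebra (w i) * TensorAlgebra.ι ℚ (e i)) := by
  classical
  let br (m : H) : ⨂[ℚ]^n H →ₗ[ℚ] TensorAlgebra ℚ H :=
    (LinearMap.mulLeft ℚ (TensorAlgebra.ι ℚ m) - LinearMap.mulRight ℚ (TensorAlgebra.ι ℚ m)) ∘ₗ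
      TensorPower.toTensorAlgebra
  let Ψ : (ι → ⨂[ℚ]^n H) →ₗ[ℚ] TensorAlgebra ℚ H :=
    ∑ i, br (e i) ∘ₗ LinearMap.proj i
  let N : Submodule ℚ (⨂[ℚ]^(n + 1) H) :=
    (LinearMap.range Ψ).comap TensorPower.toTensorAlgebra
  suffices h : x ∈ N by
    obtain ⟨w, hw⟩ := h
    refine ⟨w, hw.symm.trans ?_⟩
    simp [Ψ, br]
  -- Commutators are linear in `m`, so those with the spanning family generate all of them.
  have hbr : ∀ m w, br m w ∈ LinearMap.range Ψ := by
    intro m w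
    have hm : m ∈ Submodule.span ℚ (Set.range e) := by rw [he]; trivial
    induction hm using Submodule.span_induction with
    | mem m hm =>
      obtain ⟨i, rfl⟩ := hm
      refine ⟨Pi.single i w, ?_⟩
      rw [LinearMap.sum_apply, Finset.sum_eq_single i]
      · simp
      · intro j _ hj; simp [Pi.single_eq_of_ne hj]
      · simp
    | zero => simp [br]
    | add a b _ _ ha hb =>
      have : br (a + b) w = br a w + br b w := by simp [br, add_mul, mul_add]; abel
      rw [this]; exact add_mem ha hb
    | smul c a _ ha =>
      have : br (c • a) w = c • br a w := by simp [br, smul_sub]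
      rw [this]; exact Submodule.smul_mem _ c ha
  have hrot : ∀ y, permTensor H (n + 1) (finRotate (n + 1)) y - y ∈ N := by
    intro y
    have hy : y ∈ Submodule.span ℚ
        (Set.range (PiTensorProduct.tprod ℚ (s := fun _ : Fin (n + 1) => H))) := by
      rw [PiTensorProduct.span_tprod_eq_top]; trivial
    induction hy using Submodule.span_induction with
    | mem y hy =>
      obtain ⟨z, rfl⟩ := hy
      rw [← Fin.snoc_init_self z, permTensor_finRotate]
      refine Submodule.mem_comap.2 ?_
      rw [map_sub, TensorPower.toTensorAlgebra_tprod, TensorPower.toTensorAlgebra_tprod,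
        ← ι_mul_tprod, ← tprod_mul_ι]
      convert hbr (z (Fin.last n)) (PiTensorProduct.tprod ℚ (Fin.init z)) using 1
      simp [br, -TensorAlgebra.tprod_apply]
    | zero => simp
    | add a b _ _ ha hb =>
      rw [map_add, add_sub_add_comm]; exact add_mem ha hb
    | smul c a _ ha =>
      rw [map_smul, ← smul_sub]; exact Submodule.smul_mem _ c ha
  -- The permutations that act trivially modulo `N` form a subgroup, so it is enough that the
  -- rotation is one of them.
  let K : Subgroup (Equiv.Perm (Fin (n + 1))) :=
    { carrier := {σ | ∀ y, permTensor H (n + 1) σ y - y ∈ N}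
      one_mem' := fun y => by
        have : permTensor H (n + 1) 1 y = y := by
          show PiTensorProduct.reindex ℚ (fun _ => H) (Equiv.refl _) y = y
          rw [PiTensorProduct.reindex_refl]; rfl
        rw [this, sub_self]; exact zero_mem _
      mul_mem' := fun {σ τ} hσ hτ y => by
        have : permTensor H (n + 1) (σ * τ) y = permTensor H (n + 1) σ (permTensor H (n + 1) τ y) :=
          (PiTensorProduct.reindex_reindex (R := ℚ) (s := fun _ => H) τ σ y).symm
        rw [this, ← sub_add_sub_cancel _ (permTensor H (n + 1) τ y)]
        exact add_mem (hσ _) (hτ y)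
      inv_mem' := fun {σ} hσ y => by
        have h1 := hσ (permTensor H (n + 1) σ⁻¹ y)
        have : permTensor H (n + 1) σ (permTensor H (n + 1) σ⁻¹ y) = y := by
          refine (PiTensorProduct.reindex_reindex (R := ℚ) (s := fun _ => H) σ⁻¹ σ y).trans ?_
          have : (σ⁻¹).trans σ = Equiv.refl _ := by ext; simp
          rw [this, PiTensorProduct.reindex_refl]; rfl
        rw [this] at h1
        rw [← neg_sub]
        exact neg_mem h1 }
  have hK : Subgroup.zpowers (finRotate (n + 1)) ≤ K := (Subgroup.zpowers_le).2 hrot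
  rw [Submodule.Quotient.mk_eq_zero] at hx
  refine (Submodule.span_le.2 ?_ : Submodule.span ℚ _ ≤ N) hx
  rintro _ ⟨σ, hσ, y, rfl⟩
  exact hK hσ y

end CyclicTensors

/-! ### The augmentation ideal and its quotient by its square -/

section MagnusGraded

variable {G : Type*} [Group G]

theorem ratClass_one : ratClass (1 : G) = 0 := by
  simp [ratClass]

theorem ratClass_mul (x y : G) : ratClass (x * y) = ratClass x + ratClass y := by
  simp [ratClass, TensorProduct.tmul_add]

theorem span_ratClass : Submodule.span ℚ (Set.range (ratClass (G := G))) = ⊤ := by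
  rw [eq_top_iff]
  intro t _
  induction t using TensorProduct.induction_on with
  | zero => exact zero_mem _
  | add a b ha hb => exact add_mem (ha trivial) (hb trivial)
  | tmul q x =>
    obtain ⟨y, rfl⟩ := Additive.ofMul.surjective x
    obtain ⟨x, rfl⟩ : ∃ x, Abelianization.of x = y := QuotientGroup.mk_surjective y
    have : q ⊗ₜ[ℤ] Additive.ofMul (Abelianization.of x) = q • ratClass x := by
      rw [ratClass, TensorProduct.smul_tmul', smul_eq_mul, mul_one]
    rw [this]
    exact Submodule.smul_mem _ _ (Submodule.subset_span ⟨x, rfl⟩)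

/-- The group elements in the group algebra, minus `1`, are in the augmentation ideal. -/
theorem single_sub_one_mem (x : G) :
    MonoidAlgebra.single x (1 : ℚ) - 1 ∈ RingHom.ker (groupAug G) := by
  rw [RingHom.mem_ker, map_sub, map_one]
  simp [groupAug]

/-- The augmentation ideal is spanned by the elements `x - 1`. -/
theorem sub_groupAug_mem_span (r : MonoidAlgebra ℚ G) :
    r - algebraMap ℚ _ (groupAug G r) ∈
      Submodule.span ℚ (Set.range fun x : G => MonoidAlgebra.single x (1 : ℚ) - 1) := by
  induction r using MonoidAlgebra.induction_linear with
  | zero => simp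
  | add a b ha hb =>
    rw [map_add, map_add, add_sub_add_comm]; exact add_mem ha hb
  | single x q =>
    have : MonoidAlgebra.single x q - algebraMap ℚ _ (groupAug G (MonoidAlgebra.single x q)) =
        q • (MonoidAlgebra.single x (1 : ℚ) - 1) := by
      rw [smul_sub, Algebra.algebraMap_eq_smul_one]
      simp [groupAug]
    rw [this]
    exact Submodule.smul_mem _ _ (Submodule.subset_span ⟨x, rfl⟩)

theorem linearMap_eq_of_mem_ker {V : Type*} [AddCommGroup V] [Module ℚ V]
    {f f' : MonoidAlgebra ℚ G →ₗ[ℚ] V}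
    (h : ∀ x : G, f (MonoidAlgebra.single x 1 - 1) = f' (MonoidAlgebra.single x 1 - 1))
    {r : MonoidAlgebra ℚ G} (hr : r ∈ RingHom.ker (groupAug G)) : f r = f' r := by
  have h1 := sub_groupAug_mem_span r
  rw [RingHom.mem_ker.1 hr, map_zero, sub_zero] at h1
  have h2 : Set.EqOn f f' (Set.range fun x : G => MonoidAlgebra.single x (1 : ℚ) - 1) := by
    rintro _ ⟨x, rfl⟩; exact h x
  exact LinearMap.eqOn_span h2 h1

/-- The isomorphism from `H₁(G; ℚ)` to `I / I²`, as a map to `ℚG / I²`. -/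
def ratHOneToQuot (G : Type*) [Group G] :
    RatHOne G →ₗ[ℚ] MonoidAlgebra ℚ G ⧸ RingHom.ker (groupAug G) ^ 2 :=
  LinearMap.liftBaseChange ℚ (AddMonoidHom.toIntLinearMap
    (MonoidHom.toAdditiveLeft (Abelianization.lift
      (MonoidHom.mk' (fun x : G => Multiplicative.ofAdd
        (Ideal.Quotient.mk (RingHom.ker (groupAug G) ^ 2) (MonoidAlgebra.single x (1 : ℚ) - 1)))
        (by
          intro x y
          rw [← ofAdd_add, ← map_add]
          congr 1
          rw [← sub_eq_zero, ← map_sub, Ideal.Quotient.eq_zero_iff_mem, Submodule.pow_succ,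
            Submodule.pow_one]
          have : MonoidAlgebra.single (x * y) (1 : ℚ) - 1 - (MonoidAlgebra.single x 1 - 1 +
              (MonoidAlgebra.single y 1 - 1)) =
              (MonoidAlgebra.single x 1 - 1) * (MonoidAlgebra.single y 1 - 1) := by
            have h : MonoidAlgebra.single (x * y) (1 : ℚ) =
              MonoidAlgebra.single x 1 * MonoidAlgebra.single y 1 := by
              simp [MonoidAlgebra.single_mul_single]
            rw [h]; noncomm_ring
          rw [this]
          exact Ideal.mul_mem_mul (single_sub_one_mem x) (single_sub_one_mem y))))))

theorem ratHOneToQuot_ratClass (x : G) : ratHOneToQuot G (ratClass x) =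
    Ideal.Quotient.mk (RingHom.ker (groupAug G) ^ 2) (MonoidAlgebra.single x (1 : ℚ) - 1) := by
  rw [ratHOneToQuot, ratClass, LinearMap.liftBaseChange_tmul, one_smul]
  rfl

end MagnusGraded

/-! ### Graded pieces of the group algebra under a Magnus expansion -/

namespace MagnusExpansion

variable {G : Type*} [Group G] (θ : MagnusExpansion G)

theorem toTensorAlgebra_part (n : ℕ) (r : MonoidAlgebra ℚ G) :
    TensorPower.toTensorAlgebra (θ.part n r) = PowerSeries.coeff n (θ.algHom r).1 :=
  toTensorAlgebra_tensorDeg ((θ.algHom r).2 n)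

theorem coeff_algHom_mul (n : ℕ) (r s : MonoidAlgebra ℚ G) :
    PowerSeries.coeff n (θ.algHom (r * s)).1 = ∑ p ∈ Finset.HasAntidiagonal.antidiagonal n,
      PowerSeries.coeff p.1 (θ.algHom r).1 * PowerSeries.coeff p.2 (θ.algHom s).1 := by
  rw [map_mul]
  exact PowerSeries.coeff_mul _ _ _

theorem algHom_single (x : G) :
    θ.algHom (MonoidAlgebra.single x 1) = θ.toHom x := by
  simp [algHom]

/-- The coefficient of degree `n` of the image of an element of the group algebra. -/
def coeffMap (n : ℕ) : MonoidAlgebra ℚ G →ₗ[ℚ] TensorAlgebra ℚ (RatHOne G) :=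
  TensorPower.toTensorAlgebra ∘ₗ θ.part n

theorem coeffMap_apply (n : ℕ) (r : MonoidAlgebra ℚ G) :
    θ.coeffMap n r = PowerSeries.coeff n (θ.algHom r).1 := θ.toTensorAlgebra_part n r

theorem coeffMap_sub_one {n : ℕ} (hn : n ≠ 0) (x : G) :
    θ.coeffMap n (MonoidAlgebra.single x 1 - 1) = PowerSeries.coeff n (θ.toHom x).1 := by
  rw [map_sub, coeffMap_apply, coeffMap_apply, algHom_single, map_one]
  have : PowerSeries.coeff n (1 : complTensor (RatHOne G)).1 = 0 := by
    rw [OneMemClass.coe_one, PowerSeries.coeff_one, if_neg hn]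
  rw [this, sub_zero]

/-- The degree `1` part, in `H`. -/
def degOne : MonoidAlgebra ℚ G →ₗ[ℚ] RatHOne G :=
  (TensorAlgebra.ιInv : TensorAlgebra ℚ (RatHOne G) →ₗ[ℚ] RatHOne G) ∘ₗ θ.coeffMap 1

theorem degOne_sub_one (x : G) : θ.degOne (MonoidAlgebra.single x 1 - 1) = ratClass x := by
  rw [degOne, LinearMap.comp_apply, coeffMap_sub_one _ one_ne_zero, θ.coeff_one]
  exact TensorAlgebra.ι_leftInverse _

theorem coeffMap_one_of_mem {r : MonoidAlgebra ℚ G} (hr : r ∈ RingHom.ker (groupAug G)) :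
    θ.coeffMap 1 r = TensorAlgebra.ι ℚ (θ.degOne r) := by
  refine linearMap_eq_of_mem_ker (f' := TensorAlgebra.ι ℚ ∘ₗ θ.degOne) (fun x => ?_) hr
  rw [LinearMap.comp_apply, degOne_sub_one, coeffMap_sub_one _ one_ne_zero, θ.coeff_one]

theorem ratHOneToQuot_degOne {r : MonoidAlgebra ℚ G} (hr : r ∈ RingHom.ker (groupAug G)) :
    ratHOneToQuot G (θ.degOne r) = Ideal.Quotient.mk (RingHom.ker (groupAug G) ^ 2) r := by
  refine linearMap_eq_of_mem_ker (f := ratHOneToQuot G ∘ₗ θ.degOne)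
    (f' := (Ideal.Quotient.mkₐ ℚ (RingHom.ker (groupAug G) ^ 2)).toLinearMap) (fun x => ?_) hr
  rw [LinearMap.comp_apply, degOne_sub_one, ratHOneToQuot_ratClass]
  rfl

/-- A linear section of the projection from the augmentation ideal to `H`. -/
theorem exists_section : ∃ s : RatHOne G →ₗ[ℚ] MonoidAlgebra ℚ G,
    (∀ h, s h ∈ RingHom.ker (groupAug G)) ∧ (∀ h, θ.degOne (s h) = h) ∧
    ∀ r ∈ RingHom.ker (groupAug G), r - s (θ.degOne r) ∈ RingHom.ker (groupAug G) ^ 2 := by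
  let I : Submodule ℚ (MonoidAlgebra ℚ G) := (RingHom.ker (groupAug G)).restrictScalars ℚ
  have hsurj : LinearMap.range (θ.degOne.domRestrict I) = ⊤ := by
    rw [eq_top_iff, ← span_ratClass, Submodule.span_le]
    rintro _ ⟨x, rfl⟩
    exact ⟨⟨_, single_sub_one_mem x⟩, θ.degOne_sub_one x⟩
  obtain ⟨s, hs⟩ := (θ.degOne.domRestrict I).exists_rightInverse_of_surjective hsurj
  have hs' : ∀ h, θ.degOne (s h).1 = h := fun h => LinearMap.congr_fun hs h
  refine ⟨I.subtype ∘ₗ s, fun h => (s h).2, hs', fun r hr => ?_⟩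
  show r - (s (θ.degOne r)).1 ∈ _
  rw [← Ideal.Quotient.eq_zero_iff_mem, map_sub, ← θ.ratHOneToQuot_degOne hr,
    ← θ.ratHOneToQuot_degOne (s (θ.degOne r)).2, hs', sub_self]

/-- A multiplicative lift of tensors to the group algebra, right inverse to `θ` on leading terms and
left inverse to `θ` modulo higher powers of the augmentation ideal. -/
theorem exists_lift : ∃ σ : TensorAlgebra ℚ (RatHOne G) →ₐ[ℚ] MonoidAlgebra ℚ G,
    ∀ n, (∀ t ∈ LinearMap.range (TensorAlgebra.ι ℚ (M := RatHOne G)) ^ n,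
      σ t ∈ RingHom.ker (groupAug G) ^ n ∧ θ.coeffMap n (σ t) = t) ∧
    ∀ r ∈ RingHom.ker (groupAug G) ^ n,
      ∃ t ∈ LinearMap.range (TensorAlgebra.ι ℚ (M := RatHOne G)) ^ n,
        r - σ t ∈ RingHom.ker (groupAug G) ^ (n + 1) := by
  obtain ⟨s, hsI, hs1, hs2⟩ := θ.exists_section
  refine ⟨TensorAlgebra.lift ℚ s, fun n => ?_⟩
  set σ := TensorAlgebra.lift ℚ s
  have hσι : ∀ h, σ (TensorAlgebra.ι ℚ h) = s h := fun h => TensorAlgebra.lift_ι_apply _ _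
  induction n with
  | zero =>
    constructor
    · intro t ht
      rw [Submodule.pow_zero, Ideal.one_eq_top]
      refine ⟨trivial, ?_⟩
      rw [pow_zero, Submodule.mem_one] at ht
      obtain ⟨q, rfl⟩ := ht
      rw [coeffMap_apply, coeff_algHom_zero, AlgHom.commutes, AlgHom.commutes]
      simp
    · intro r _
      refine ⟨algebraMap ℚ _ (groupAug G r), ?_, ?_⟩
      · rw [pow_zero]; exact Submodule.algebraMap_mem _
      · rw [zero_add, Submodule.pow_one, RingHom.mem_ker, map_sub, AlgHom.commutes,
          AlgHom.commutes]
        simp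
  | succ n ih =>
    obtain ⟨ih1, ih2⟩ := ih
    constructor
    · intro t ht
      rw [pow_succ] at ht
      induction ht using Submodule.mul_induction_on' with
      | mem_mul_mem t ht m hm =>
        obtain ⟨h, rfl⟩ := hm
        obtain ⟨h1, h2⟩ := ih1 t ht
        rw [map_mul, hσι]
        constructor
        · rw [Submodule.pow_succ]; exact Ideal.mul_mem_mul h1 (hsI h)
        -- The only contribution is from degrees `n` and `1`: the first factor has no terms below
        -- degree `n`, the second no constant term.
        · rw [coeffMap_apply, coeff_algHom_mul, Finset.sum_eq_single (n, 1)]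
          · rw [← coeffMap_apply, ← coeffMap_apply, h2, coeffMap_one_of_mem _ (hsI h), hs1]
          · rintro ⟨i, j⟩ hij hne
            rw [Finset.HasAntidiagonal.mem_antidiagonal] at hij
            simp only at hij ⊢
            by_cases hi : i < n
            · rw [θ.coeff_algHom_eq_zero n _ h1 i hi, zero_mul]
            · have hj : j = 0 := by
                by_contra hj
                exact hne (Prod.ext (by simp only; omega) (by simp only; omega))
              rw [hj, coeff_algHom_zero, RingHom.mem_ker.1 (hsI h), map_zero, mul_zero]
          · intro h; simp at h
      | add a _ b _ ha hb =>
        rw [map_add, map_add, ha.2, hb.2]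
        exact ⟨add_mem ha.1 hb.1, rfl⟩
    · intro r hr
      rw [Submodule.pow_succ] at hr
      induction hr using Submodule.mul_induction_on' with
      | mem_mul_mem a ha b hb =>
        obtain ⟨t, ht, hat⟩ := ih2 a ha
        refine ⟨t * TensorAlgebra.ι ℚ (θ.degOne b), ?_, ?_⟩
        · rw [pow_succ]
          exact Submodule.mul_mem_mul ht (LinearMap.mem_range_self _ _)
        · rw [map_mul, hσι]
          have e : a * b - σ t * s (θ.degOne b) =
              (a - σ t) * b + σ t * (b - s (θ.degOne b)) := by noncomm_ring
          rw [e]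
          refine add_mem ?_ ?_
          · rw [Submodule.pow_succ]; exact Ideal.mul_mem_mul hat hb
          · rw [show n + 1 + 1 = n + 2 from rfl, Ideal.IsTwoSided.pow_add]
            exact Ideal.mul_mem_mul (ih1 t ht).1 (hs2 b hb)
      | add a _ b _ ha hb =>
        obtain ⟨t, ht, hat⟩ := ha
        obtain ⟨u, hu, hbu⟩ := hb
        refine ⟨t + u, add_mem ht hu, ?_⟩
        rw [map_add, add_sub_add_comm]
        exact add_mem hat hbu

/-- Injectivity of `Iⁿ / Iⁿ⁺¹ → H^{⊗ n}`. Modulo `Iⁿ⁺¹` the element is a lift `σ t`, and `t` is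
recovered as its degree `n` part. -/
theorem mem_pow_succ_of_part_eq_zero {n : ℕ} {r : MonoidAlgebra ℚ G}
    (hr : r ∈ RingHom.ker (groupAug G) ^ n) (h : θ.part n r = 0) :
    r ∈ RingHom.ker (groupAug G) ^ (n + 1) := by
  obtain ⟨σ, hσ⟩ := θ.exists_lift
  obtain ⟨t, ht, hrt⟩ := (hσ n).2 r hr
  have h1 : θ.coeffMap n (r - σ t) = 0 := by
    rw [coeffMap, LinearMap.comp_apply, θ.part_eq_zero n _ hrt, map_zero]
  have h2 : θ.coeffMap n r = 0 := by rw [coeffMap, LinearMap.comp_apply, h, map_zero]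
  rw [map_sub, h2, ((hσ n).1 t ht).2, zero_sub, neg_eq_zero] at h1
  rw [h1, map_zero, sub_zero] at hrt
  exact hrt

theorem exists_part_eq (n : ℕ) (x : ⨂[ℚ]^n (RatHOne G)) :
    ∃ r ∈ RingHom.ker (groupAug G) ^ n, θ.part n r = x := by
  obtain ⟨σ, hσ⟩ := θ.exists_lift
  obtain ⟨h1, h2⟩ := (hσ n).1 _ (toTensorAlgebra_mem n x)
  exact ⟨_, h1, toTensorAlgebra_injective n h2⟩

end MagnusExpansion

theorem span_ratClass_of_closure {G ι : Type*} [Group G] {l : ι → G}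
    (hl : Subgroup.closure (Set.range l) = ⊤) :
    Submodule.span ℚ (Set.range fun i => ratClass (l i)) = ⊤ := by
  rw [eq_top_iff, ← span_ratClass, Submodule.span_le]
  rintro _ ⟨x, rfl⟩
  have hx : x ∈ Subgroup.closure (Set.range l) := by rw [hl]; trivial
  induction hx using Subgroup.closure_induction with
  | mem x hx =>
    obtain ⟨i, rfl⟩ := hx
    exact Submodule.subset_span ⟨i, rfl⟩
  | one => rw [ratClass_one]; exact zero_mem _
  | mul x y _ _ hx hy => rw [ratClass_mul]; exact add_mem hx hy
  | inv x _ hx =>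
    have h := ratClass_mul x x⁻¹
    rw [mul_inv_cancel, ratClass_one] at h
    rw [eq_neg_of_add_eq_zero_right h.symm]
    exact neg_mem hx

/-! ### The completion as a completed tensor algebra, and `H₁^Lie` -/

namespace MagnusExpansion

variable {G : Type*} [Group G] (θ : MagnusExpansion G)

theorem complPart_toCompl (n : ℕ) (r : MonoidAlgebra ℚ G) :
    θ.complPart n (toCompl (groupAug G) r) = θ.part n r := rfl

theorem complPart_congr {n : ℕ} {a b : GroupCompletion G}
    (h : complProj (groupAug G) (n + 1) a = complProj (groupAug G) (n + 1) b) :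
    θ.complPart n a = θ.complPart n b := by
  unfold complPart
  simp only [LinearMap.comp_apply, AlgHom.toLinearMap_apply, h]

theorem complPart_eq_zero {m n : ℕ} (h : n < m) {a : GroupCompletion G}
    (ha : a ∈ complFilt (groupAug G) m) : θ.complPart n a = 0 := by
  rw [← map_zero (θ.complPart n)]
  refine θ.complPart_congr ?_
  rw [map_zero]
  exact complFilt_anti h ha

theorem mem_complFilt_succ {n : ℕ} {a : GroupCompletion G} (ha : a ∈ complFilt (groupAug G) n)
    (h : θ.complPart n a = 0) : a ∈ complFilt (groupAug G) (n + 1) := by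
  obtain ⟨r, hr⟩ := exists_toCompl (groupAug G) (n + 1) a
  rw [θ.complPart_congr (hr _ le_rfl), complPart_toCompl] at h
  rw [mem_complFilt, hr n (Nat.le_succ n), ← mem_complFilt, toCompl_mem_complFilt] at ha
  rw [mem_complFilt, hr _ le_rfl, ← mem_complFilt, toCompl_mem_complFilt]
  exact θ.mem_pow_succ_of_part_eq_zero ha h

theorem exists_complPart_eq (n : ℕ) (x : ⨂[ℚ]^n (RatHOne G)) :
    ∃ a ∈ complFilt (groupAug G) n, θ.complPart n a = x := by
  obtain ⟨r, hr, h⟩ := θ.exists_part_eq n x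
  exact ⟨toCompl _ r, toCompl_mem_complFilt.2 hr, h⟩

theorem complPart_ext {a b : GroupCompletion G} (h : ∀ n, θ.complPart n a = θ.complPart n b) :
    a = b := by
  have h' : ∀ n, a - b ∈ complFilt (groupAug G) n := by
    intro n
    induction n with
    | zero => exact mem_complFilt_zero _
    | succ n ih => exact θ.mem_complFilt_succ ih (by rw [map_sub, h, sub_self])
  exact AugCompletion.ext fun n => sub_mem_complFilt.1 (h' n)

/-- The parts are corrected one degree at a time. The correction in degree `n` lies in step `n` of
the filtration and leaves lower degrees alone. The degree `n` part is determined at level `n + 1`,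
where the limit agrees with `s (n + 1)`, the first term corrected in degree `n`. -/
theorem exists_complPart_eq_all (x : ∀ n : ℕ, ⨂[ℚ]^n (RatHOne G)) :
    ∃ a, ∀ n, θ.complPart n a = x n := by
  choose c hc hc' using fun n y => θ.exists_complPart_eq n y
  let s : ℕ → GroupCompletion G := fun n =>
    Nat.rec 0 (fun k a => a + c k (x k - θ.complPart k a)) n
  have hs : ∀ n, s (n + 1) = s n + c n (x n - θ.complPart n (s n)) := fun n => rfl
  obtain ⟨a, ha⟩ := exists_limit (groupAug G) s (by
    intro n
    rw [hs, ← sub_mem_complFilt, add_sub_cancel_left]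
    exact hc _ _)
  refine ⟨a, fun n => ?_⟩
  rw [θ.complPart_congr (ha (n + 1)), hs, map_add, hc', add_sub_cancel]

/-- The degree `n` part, in the tensor algebra. -/
def complCoeff (n : ℕ) : GroupCompletion G →ₗ[ℚ] TensorAlgebra ℚ (RatHOne G) :=
  TensorPower.toTensorAlgebra ∘ₗ θ.complPart n

theorem complCoeff_apply (n : ℕ) (a : GroupCompletion G) :
    θ.complCoeff n a = TensorPower.toTensorAlgebra (θ.complPart n a) := rfl

theorem complCoeff_mul (n : ℕ) (a b : GroupCompletion G) :
    θ.complCoeff n (a * b) = ∑ p ∈ Finset.HasAntidiagonal.antidiagonal n,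
      θ.complCoeff p.1 a * θ.complCoeff p.2 b := by
  obtain ⟨r, hr⟩ := exists_toCompl (groupAug G) (n + 1) a
  obtain ⟨s, hs⟩ := exists_toCompl (groupAug G) (n + 1) b
  have h : ∀ k ≤ n, θ.complCoeff k a = PowerSeries.coeff k (θ.algHom r).1 ∧
      θ.complCoeff k b = PowerSeries.coeff k (θ.algHom s).1 := by
    intro k hk
    rw [complCoeff_apply, complCoeff_apply, θ.complPart_congr (hr (k + 1) (by omega)),
      θ.complPart_congr (hs (k + 1) (by omega)), complPart_toCompl, complPart_toCompl,
      toTensorAlgebra_part, toTensorAlgebra_part]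
    exact ⟨rfl, rfl⟩
  have hab : complProj (groupAug G) (n + 1) (a * b) =
      complProj (groupAug G) (n + 1) (toCompl _ (r * s)) := by
    rw [map_mul, map_mul, map_mul, hr _ le_rfl, hs _ le_rfl]
  rw [complCoeff_apply, θ.complPart_congr hab, complPart_toCompl, toTensorAlgebra_part,
    coeff_algHom_mul]
  refine Finset.sum_congr rfl fun p hp => ?_
  rw [Finset.HasAntidiagonal.mem_antidiagonal] at hp
  rw [(h p.1 (by omega)).1, (h p.2 (by omega)).2]

/-- The class of the degree `n` part in `H^{⊗ n} / ℤ_n`. -/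
def cycPart (n : ℕ) : GroupCompletion G →ₗ[ℚ] CyclicTensor (RatHOne G) n :=
  Submodule.mkQ _ ∘ₗ θ.complPart n

theorem cycPart_eq (n : ℕ) (a : GroupCompletion G) :
    θ.cycPart n a = cycClass (RatHOne G) n (θ.complCoeff n a) := by
  rw [cycClass, LinearMap.comp_apply, complCoeff_apply, tensorDeg_toTensorAlgebra]
  rfl

theorem cycPart_mul_comm (n : ℕ) (a b : GroupCompletion G) :
    θ.cycPart n (a * b) = θ.cycPart n (b * a) := by
  rw [cycPart_eq, cycPart_eq, complCoeff_mul, complCoeff_mul, map_sum, map_sum,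
    ← Finset.Nat.sum_antidiagonal_swap]
  exact Finset.sum_congr rfl fun p _ => cycClass_mul_comm _ _ _

theorem cycPart_eq_zero {m n : ℕ} (h : n < m) {a : GroupCompletion G}
    (ha : a ∈ complFilt (groupAug G) m) : θ.cycPart n a = 0 := by
  rw [cycPart, LinearMap.comp_apply, θ.complPart_eq_zero h ha, map_zero]

theorem cycPart_congr {n : ℕ} {a b : GroupCompletion G}
    (h : complProj (groupAug G) (n + 1) a = complProj (groupAug G) (n + 1) b) :
    θ.cycPart n a = θ.cycPart n b := by
  rw [cycPart, LinearMap.comp_apply, LinearMap.comp_apply, θ.complPart_congr h]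

theorem complCoeff_mul_of_mem {m n : ℕ} {a b : GroupCompletion G}
    (ha : a ∈ complFilt (groupAug G) m) (hb : b ∈ complFilt (groupAug G) n) :
    θ.complCoeff (m + n) (a * b) = θ.complCoeff m a * θ.complCoeff n b := by
  rw [complCoeff_mul, Finset.sum_eq_single (m, n)]
  · rintro ⟨i, j⟩ hij hne
    rw [Finset.HasAntidiagonal.mem_antidiagonal] at hij
    simp only at hij ⊢
    by_cases hi : i < m
    · rw [complCoeff_apply, θ.complPart_eq_zero hi ha, map_zero, zero_mul]
    · have hj : j < n := by
        by_contra hj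
        exact hne (Prod.ext (by simp only; omega) (by simp only; omega))
      rw [complCoeff_apply _ j, θ.complPart_eq_zero hj hb, map_zero, mul_zero]
  · intro h; simp at h

theorem complCoeff_ext {a b : GroupCompletion G}
    (h : ∀ n, θ.complCoeff n a = θ.complCoeff n b) : a = b :=
  θ.complPart_ext fun n => toTensorAlgebra_injective n (h n)

/-- In all degrees the commutators are taken with the same `e i`, so `W i` can collect the second
entries of all degrees. This is why finitely many commutators suffice and no closure is needed. -/
theorem exists_sum_commutators {ι : Type*} [Fintype ι] {e : ι → RatHOne G}
    (he : Submodule.span ℚ (Set.range e) = ⊤) {y : GroupCompletion G}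
    (hy : y ∈ complFilt (groupAug G) 1) (h : ∀ n, θ.cycPart (n + 1) y = 0) :
    ∃ X W : ι → GroupCompletion G, (∀ i, X i ∈ complFilt (groupAug G) 1) ∧
      (∀ i, W i ∈ complFilt (groupAug G) 1) ∧ y = ∑ i, (X i * W i - W i * X i) := by
  choose w hw using fun n => exists_commutators he (h n)
  have hX : ∀ i, ∃ X, ∀ n, θ.complCoeff n X = if n = 1 then TensorAlgebra.ι ℚ (e i) else 0 := by
    intro i
    obtain ⟨X, hX⟩ := θ.exists_complPart_eq_all fun n =>
      if n = 1 then tensorDeg n (TensorAlgebra.ι ℚ (e i)) else 0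
    refine ⟨X, fun n => ?_⟩
    rw [complCoeff_apply, hX]
    split_ifs with hn
    · subst hn
      refine toTensorAlgebra_tensorDeg ?_
      rw [pow_one]; exact LinearMap.mem_range_self _ _
    · exact map_zero _
  choose X hX using hX
  -- `w 0 i` is a scalar and has zero commutators, so it is replaced by `0`. This keeps `W i` in the
  -- augmentation ideal.
  have hW : ∀ i, ∃ W, ∀ n, θ.complCoeff n W =
      if n = 0 then 0 else TensorPower.toTensorAlgebra (w n i) := by
    intro i
    obtain ⟨W, hW⟩ := θ.exists_complPart_eq_all fun n => if n = 0 then 0 else w n i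
    refine ⟨W, fun n => ?_⟩
    rw [complCoeff_apply, hW]
    split_ifs with hn
    · exact map_zero _
    · rfl
  choose W hW using hW
  have hmem : ∀ a : GroupCompletion G, θ.complCoeff 0 a = 0 → a ∈ complFilt (groupAug G) 1 := by
    intro a ha
    exact θ.mem_complFilt_succ (mem_complFilt_zero a)
      (toTensorAlgebra_injective 0 (ha.trans (map_zero _).symm))
  refine ⟨X, W, fun i => hmem _ (by simp [hX]), fun i => hmem _ (by simp [hW]), ?_⟩
  refine θ.complCoeff_ext fun n => ?_
  rw [map_sum]
  cases n with
  | zero =>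
    rw [complCoeff_apply, θ.complPart_eq_zero zero_lt_one hy, map_zero]
    symm
    refine Finset.sum_eq_zero fun i _ => ?_
    rw [map_sub, complCoeff_mul, complCoeff_mul]
    simp [hX]
  | succ n =>
    have hXn : ∀ i b, θ.complCoeff (n + 1) (X i * b) =
        TensorAlgebra.ι ℚ (e i) * θ.complCoeff n b := by
      intro i b
      rw [complCoeff_mul, Finset.sum_eq_single (1, n)]
      · simp [hX]
      · rintro ⟨j, k⟩ hjk hne
        rw [Finset.HasAntidiagonal.mem_antidiagonal] at hjk
        simp only at hjk ⊢
        rw [hX, if_neg, zero_mul]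
        rintro rfl
        exact hne (Prod.ext rfl (by simp only; omega))
      · intro h; simp [add_comm] at h
    have hnX : ∀ i b, θ.complCoeff (n + 1) (b * X i) =
        θ.complCoeff n b * TensorAlgebra.ι ℚ (e i) := by
      intro i b
      rw [complCoeff_mul, Finset.sum_eq_single (n, 1)]
      · simp [hX]
      · rintro ⟨j, k⟩ hjk hne
        rw [Finset.HasAntidiagonal.mem_antidiagonal] at hjk
        simp only at hjk ⊢
        rw [hX, if_neg, mul_zero]
        rintro rfl
        exact hne (Prod.ext (by simp only; omega) rfl)
      · intro h; simp at h
    rw [complCoeff_apply, hw]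
    refine Finset.sum_congr rfl fun i _ => ?_
    rw [map_sub, hXn, hnX, hW]
    split_ifs with hn
    · subst hn
      have h1 := toTensorAlgebra_mem 0 (w 0 i)
      rw [pow_zero, Submodule.mem_one] at h1
      obtain ⟨q, hq⟩ := h1
      rw [← hq, Algebra.commutes]
      simp
    · rfl

/-- The map `Î → ∏_{n ≥ 1} H^{⊗ n} / ℤ_n`. -/
def cyclicMap : complIdeal (groupAug G) →ₗ[ℚ] ∀ n : ℕ+, CyclicTensor (RatHOne G) n :=
  LinearMap.pi fun n : ℕ+ => θ.cycPart n ∘ₗ (complIdeal (groupAug G)).subtype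

theorem ker_cyclicMap {ι : Type*} [Fintype ι] {e : ι → RatHOne G}
    (he : Submodule.span ℚ (Set.range e) = ⊤) :
    LinearMap.ker θ.cyclicMap = complBracket (groupAug G) := by
  refine le_antisymm ?_ (Submodule.span_le.2 ?_)
  · intro y hy
    have hy' : ∀ n, θ.cycPart (n + 1) (y : GroupCompletion G) = 0 := fun n =>
      congrFun (LinearMap.mem_ker.1 hy) n.succPNat
    obtain ⟨X, W, hX, hW, h⟩ := θ.exists_sum_commutators he (mem_complIdeal_iff.1 y.2) hy'
    have hXW : ∀ i, X i * W i - W i * X i ∈ complIdeal (groupAug G) := fun i =>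
      mem_complIdeal_iff.2
        (sub_mem (mul_mem_complFilt_left _ (hW i)) (mul_mem_complFilt_right _ (hW i)))
    have : y = ∑ i, ⟨X i * W i - W i * X i, hXW i⟩ := by
      ext1
      rw [h, Submodule.coe_sum]
    rw [this]
    exact Submodule.sum_mem _ fun i _ => Submodule.subset_span
      ⟨⟨X i, mem_complIdeal_iff.2 (hX i)⟩, ⟨W i, mem_complIdeal_iff.2 (hW i)⟩, rfl⟩
  · rintro z ⟨x, y, h⟩
    refine LinearMap.mem_ker.2 (funext fun n => ?_)
    show θ.cycPart n (z : GroupCompletion G) = 0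
    rw [h, map_sub, cycPart_mul_comm, sub_self]

theorem cyclicMap_surjective : Function.Surjective θ.cyclicMap := by
  intro c
  choose x hx using fun n : ℕ+ => Submodule.mkQ_surjective _ (c n)
  obtain ⟨a, ha⟩ := θ.exists_complPart_eq_all fun n => if h : 0 < n then x ⟨n, h⟩ else 0
  have ha1 : a ∈ complIdeal (groupAug G) :=
    mem_complIdeal_iff.2 (θ.mem_complFilt_succ (mem_complFilt_zero a) (by rw [ha]; simp))
  refine ⟨⟨a, ha1⟩, funext fun n => ?_⟩
  show θ.cycPart n a = c n
  exact (congrArg (Submodule.mkQ _) ((ha n).trans (dif_pos n.2))).trans (hx n)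

/-- The isomorphism `H₁^Lie(Î) ≃ ∏_{n ≥ 1} H^{⊗ n} / ℤ_n`. -/
theorem exists_thetaStar {ι : Type*} [Fintype ι] {e : ι → RatHOne G}
    (he : Submodule.span ℚ (Set.range e) = ⊤) :
    ∃ f : LieHOne (groupAug G) ≃ₗ[ℚ] ((n : ℕ+) → CyclicTensor (RatHOne G) n),
      ∀ y : complIdeal (groupAug G), f (Submodule.Quotient.mk y) = θ.cyclicPart y :=
  ⟨(Submodule.quotEquivOfEq _ _ (θ.ker_cyclicMap he).symm).trans
    (θ.cyclicMap.quotKerEquivOfSurjective θ.cyclicMap_surjective), fun _ => rfl⟩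

end MagnusExpansion

/-! ### Convergence of the logarithm series -/

section AdicSums

variable {R : Type*} [Ring R] [Algebra ℚ R] {ε : R →ₐ[ℚ] ℚ}

theorem tendsto_complProj {α : Type*} {l : Filter α} {f : α → AugCompletion ε}
    {b : AugCompletion ε} (h : ∀ n, ∀ᶠ a in l, complProj ε n (f a) = complProj ε n b) :
    Filter.Tendsto f l (nhds b) := by
  rw [nhds_iInf, Filter.tendsto_iInf]
  intro n
  rw [@nhds_induced _ _ ⊥, Filter.tendsto_comap_iff, @nhds_discrete _ ⊥ (@DiscreteTopology.mk _ ⊥ rfl), Filter.tendsto_pure]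
  exact h n

theorem AugCompletion.continuous_complProj (n : ℕ) :
    @Continuous _ _ _ ⊥ (complProj ε n) :=
  continuous_iff_le_induced.2 (iInf_le _ n)

/-- Limits must be unique for the `tsum` in `matLog` to equal the sum constructed entry by entry. -/
instance : T2Space (AugCompletion ε) := by
  refine ⟨fun a b hab => ?_⟩
  obtain ⟨n, hn⟩ : ∃ n, complProj ε n a ≠ complProj ε n b := by
    by_contra! h
    exact hab (AugCompletion.ext h)
  let _ : TopologicalSpace (R ⧸ RingHom.ker ε ^ n) := ⊥
  have _ : DiscreteTopology (R ⧸ RingHom.ker ε ^ n) := ⟨rfl⟩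
  exact separated_by_continuous (AugCompletion.continuous_complProj n) hn

theorem hasSum_of_mem_complFilt {f : ℕ → AugCompletion ε} {b : AugCompletion ε}
    (hf : ∀ k, f k ∈ complFilt ε (k + 1))
    (hb : ∀ n, complProj ε n b = complProj ε n (∑ k ∈ Finset.range n, f k)) : HasSum f b := by
  refine tendsto_complProj fun n => ?_
  simp only [SummationFilter.unconditional_filter]
  filter_upwards [Filter.eventually_ge_atTop (Finset.range n)] with s hs
  rw [hb, ← Finset.sum_sdiff hs, map_add, map_sum, Finset.sum_eq_zero, zero_add]
  intro k hk
  rw [Finset.mem_sdiff, Finset.mem_range, not_lt] at hk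
  exact complFilt_anti (by omega) (hf k)

/-- The matrices with all entries in the given step of the filtration. -/
def matFilt (ε : R →ₐ[ℚ] ℚ) (N k : ℕ) : Submodule ℚ (Matrix (Fin N) (Fin N) (AugCompletion ε)) where
  carrier := {X | ∀ i j, X i j ∈ complFilt ε k}
  add_mem' hX hY i j := add_mem (hX i j) (hY i j)
  zero_mem' _ _ := zero_mem _
  smul_mem' q _ hX i j := Submodule.smul_mem _ q (hX i j)

theorem mem_matFilt {N k : ℕ} {X : Matrix (Fin N) (Fin N) (AugCompletion ε)} :
    X ∈ matFilt ε N k ↔ ∀ i j, X i j ∈ complFilt ε k := Iff.rfl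

theorem matFilt_zero (N : ℕ) : matFilt ε N 0 = ⊤ :=
  eq_top_iff.2 fun _ _ _ _ => mem_complFilt_zero _

theorem mul_mem_matFilt {N m n : ℕ} {X Y : Matrix (Fin N) (Fin N) (AugCompletion ε)}
    (hX : X ∈ matFilt ε N m) (hY : Y ∈ matFilt ε N n) : X * Y ∈ matFilt ε N (m + n) := by
  intro i j
  rw [Matrix.mul_apply]
  exact sum_mem fun k _ => mul_mem_complFilt (hX i k) (hY k j)

theorem pow_mem_matFilt {N m : ℕ} {X : Matrix (Fin N) (Fin N) (AugCompletion ε)}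
    (hX : X ∈ matFilt ε N m) (n : ℕ) : X ^ n ∈ matFilt ε N (m * n) := by
  induction n with
  | zero => rw [mul_zero, matFilt_zero]; trivial
  | succ n ih => rw [pow_succ, mul_add, mul_one]; exact mul_mem_matFilt ih hX

theorem matFilt_anti {N m n : ℕ} (h : m ≤ n) : matFilt ε N n ≤ matFilt ε N m :=
  fun _ hX i j => complFilt_anti h (hX i j)

theorem trace_mem_complFilt {N m : ℕ} {X : Matrix (Fin N) (Fin N) (AugCompletion ε)}
    (hX : X ∈ matFilt ε N m) : X.trace ∈ complFilt ε m :=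
  sum_mem fun i _ => hX i i

theorem hasSum_logTerm {N : ℕ} {B : Matrix (Fin N) (Fin N) (AugCompletion ε)}
    (hB : B - 1 ∈ matFilt ε N 1) : ∃ L, HasSum (logTerm ε B) L ∧
      ∀ m, L - truncLog m (B - 1) ∈ matFilt ε N m := by
  have h1 : ∀ k, logTerm ε B k ∈ matFilt ε N (k + 1) := fun k =>
    Submodule.smul_mem _ _ (by simpa using pow_mem_matFilt hB (k + 1))
  have h2 : ∀ i j, ∃ b, ∀ n, complProj ε n b =
      complProj ε n (∑ k ∈ Finset.range n, logTerm ε B k i j) := fun i j =>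
    exists_limit ε (fun n => ∑ k ∈ Finset.range n, logTerm ε B k i j) fun n => by
      rw [Finset.sum_range_succ, map_add, mem_complFilt.1 (complFilt_anti n.le_succ (h1 n i j)),
        add_zero]
  choose L hL using h2
  refine ⟨Matrix.of L, ?_, fun m i j => ?_⟩
  · refine Pi.hasSum.2 fun i => Pi.hasSum.2 fun j => ?_
    exact hasSum_of_mem_complFilt (fun k => h1 k i j) (hL i j)
  · rw [Matrix.sub_apply, sub_mem_complFilt, Matrix.of_apply, hL]
    congr 1
    rw [truncLog, Matrix.sum_apply]
    rfl

theorem summable_logTerm {N : ℕ} {B : Matrix (Fin N) (Fin N) (AugCompletion ε)}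
    (hB : B - 1 ∈ matFilt ε N 1) : Summable (logTerm ε B) :=
  let ⟨_, h, _⟩ := hasSum_logTerm hB
  h.summable

theorem matLog_sub_truncLog_mem {N : ℕ} {B : Matrix (Fin N) (Fin N) (AugCompletion ε)}
    (hB : B - 1 ∈ matFilt ε N 1) (m : ℕ) :
    matLog ε B - truncLog m (B - 1) ∈ matFilt ε N m := by
  obtain ⟨L, h, hL⟩ := hasSum_logTerm hB
  rw [matLog, h.tsum_eq]
  exact hL m

end AdicSums

/-! ### Normalization of matrices and the trace of the logarithm -/

section TraceLog

variable {R : Type*} [Ring R] [Algebra ℚ R] (ε : R →ₐ[ℚ] ℚ) {N : ℕ}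

/-- The matrix of scalars `ε(A)`. -/
def scalarAug : (Matrix (Fin N) (Fin N) (AugCompletion ε))ˣ →*
    (Matrix (Fin N) (Fin N) (AugCompletion ε))ˣ :=
  (Units.map ((Algebra.ofId ℚ (AugCompletion ε)).mapMatrix (m := Fin N) : _ →* _)).comp (augGL ε)

theorem normalizeGL_eq (A : (Matrix (Fin N) (Fin N) (AugCompletion ε))ˣ) :
    normalizeGL ε A = A * (scalarAug ε A)⁻¹ := rfl

theorem augGL_scalarAug (A : (Matrix (Fin N) (Fin N) (AugCompletion ε))ˣ) :
    augGL ε (scalarAug ε A) = augGL ε A := by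
  ext i j
  simp [augGL, scalarAug, Algebra.ofId_apply]

theorem augGL_normalizeGL (A : (Matrix (Fin N) (Fin N) (AugCompletion ε))ˣ) :
    augGL ε (normalizeGL ε A) = 1 := by
  rw [normalizeGL_eq, map_mul, map_inv, augGL_scalarAug, mul_inv_cancel]

theorem sub_one_mem_matFilt {A : (Matrix (Fin N) (Fin N) (AugCompletion ε))ˣ} :
    A.val - 1 ∈ matFilt ε N 1 ↔ augGL ε A = 1 := by
  rw [mem_matFilt, Units.ext_iff, ← Matrix.ext_iff]
  refine forall_congr' fun i => forall_congr' fun j => ?_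
  rw [← complAug_eq_zero_iff, Matrix.sub_apply, map_sub, sub_eq_zero]
  simp only [augGL, Units.coe_map, MonoidHom.coe_coe, AlgHom.mapMatrix_apply, Matrix.map_apply,
    Units.val_one, Matrix.one_apply]
  split_ifs <;> simp

theorem normalizeGL_sub_one_mem (A : (Matrix (Fin N) (Fin N) (AugCompletion ε))ˣ) :
    (normalizeGL ε A).val - 1 ∈ matFilt ε N 1 :=
  (sub_one_mem_matFilt ε).2 (augGL_normalizeGL ε A)

theorem normalizeGL_of_augGL_eq_one {A : (Matrix (Fin N) (Fin N) (AugCompletion ε))ˣ}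
    (h : augGL ε A = 1) : normalizeGL ε A = A := by
  rw [normalizeGL_eq, scalarAug, MonoidHom.comp_apply, h, map_one, inv_one, mul_one]

/-- Normalization is multiplicative up to conjugation by a matrix of scalars, which a trace does not
see. -/
theorem normalizeGL_mul (A B : (Matrix (Fin N) (Fin N) (AugCompletion ε))ˣ) :
    normalizeGL ε (A * B) =
      normalizeGL ε A * (scalarAug ε A * normalizeGL ε B * (scalarAug ε A)⁻¹) := by
  simp only [normalizeGL_eq, map_mul, mul_inv_rev]
  group

theorem trLog_sub_trace_mem (A : (Matrix (Fin N) (Fin N) (AugCompletion ε))ˣ) (m : ℕ) :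
    trLog ε A - (truncLog m ((normalizeGL ε A).val - 1)).trace ∈ complFilt ε m := by
  rw [trLog, ← Matrix.trace_sub]
  exact trace_mem_complFilt (matLog_sub_truncLog_mem (normalizeGL_sub_one_mem ε A) m)

theorem truncLog_mem_matFilt {X : Matrix (Fin N) (Fin N) (AugCompletion ε)} {n : ℕ}
    (hX : X ∈ matFilt ε N n) (m : ℕ) : truncLog m X ∈ matFilt ε N n := by
  refine sum_mem fun k _ => Submodule.smul_mem _ _ (matFilt_anti ?_ (pow_mem_matFilt hX (k + 1)))
  nlinarith

theorem trLog_mem_complIdeal (A : (Matrix (Fin N) (Fin N) (AugCompletion ε))ˣ) :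
    trLog ε A ∈ complIdeal ε := by
  rw [mem_complIdeal_iff, ← sub_add_cancel (trLog ε A)]
  exact add_mem (trLog_sub_trace_mem ε A 1)
    (trace_mem_complFilt (truncLog_mem_matFilt ε (normalizeGL_sub_one_mem ε A) 1))

theorem truncLog_conj {S : Type*} [Ring S] [Algebra ℚ S] (s : Sˣ) (x : S) (m : ℕ) :
    truncLog m (s * x * ↑s⁻¹) = s * truncLog m x * ↑s⁻¹ := by
  simp only [truncLog, Finset.mul_sum, Finset.sum_mul, Units.conj_pow, mul_smul_comm,
    smul_mul_assoc]

end TraceLog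

namespace MagnusExpansion

variable {G : Type*} [Group G] (θ : MagnusExpansion G) {N : ℕ}

/-- The degree `n` part of the trace of a matrix. -/
def cycTrace (n : ℕ) : Matrix (Fin N) (Fin N) (GroupCompletion G) →ₗ[ℚ]
    CyclicTensor (RatHOne G) n :=
  θ.cycPart n ∘ₗ Matrix.traceLinearMap (Fin N) ℚ (GroupCompletion G)

theorem cycTrace_apply (n : ℕ) (X : Matrix (Fin N) (Fin N) (GroupCompletion G)) :
    θ.cycTrace n X = θ.cycPart n X.trace := rfl

theorem cycTrace_mul_comm (n : ℕ) (X Y : Matrix (Fin N) (Fin N) (GroupCompletion G)) :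
    θ.cycTrace n (X * Y) = θ.cycTrace n (Y * X) := by
  simp only [cycTrace_apply, Matrix.trace, Matrix.diag, Matrix.mul_apply, map_sum]
  rw [Finset.sum_comm]
  exact Finset.sum_congr rfl fun i _ => Finset.sum_congr rfl fun j _ => θ.cycPart_mul_comm n _ _

theorem cycTrace_eq_zero {m n : ℕ} (h : n < m) {X : Matrix (Fin N) (Fin N) (GroupCompletion G)}
    (hX : X ∈ matFilt (groupAug G) N m) : θ.cycTrace n X = 0 :=
  θ.cycPart_eq_zero h (trace_mem_complFilt hX)

theorem cycPart_trLog (A : (Matrix (Fin N) (Fin N) (GroupCompletion G))ˣ) (n : ℕ) :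
    θ.cycPart n (trLog (groupAug G) A) =
      θ.cycTrace n (truncLog (n + 1) ((normalizeGL (groupAug G) A).val - 1)) :=
  θ.cycPart_congr (sub_mem_complFilt.1 (trLog_sub_trace_mem (groupAug G) A (n + 1)))

/-- With `Y'` the conjugate of `Y` by `s`, the normalized product is `(1 + X)(1 + Y')`.
`trace_truncLog_mul` splits its logarithm, and cyclicity undoes the conjugation. In degree `n` the
trace vanishes on step `n + 1`, so `n + 1` terms of the series are enough. -/
theorem cycPart_trLog_mul (A B : (Matrix (Fin N) (Fin N) (GroupCompletion G))ˣ) (n : ℕ) :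
    θ.cycPart n (trLog (groupAug G) (A * B)) =
      θ.cycPart n (trLog (groupAug G) A) + θ.cycPart n (trLog (groupAug G) B) := by
  simp only [cycPart_trLog]
  set s := scalarAug (groupAug G) A with hs
  set X := (normalizeGL (groupAug G) A).val - 1 with hX
  set Y := (normalizeGL (groupAug G) B).val - 1 with hY
  have h1 : (normalizeGL (groupAug G) (A * B)).val - 1 =
      X + s * Y * s⁻¹.val + X * (s * Y * s⁻¹.val) := by
    rw [normalizeGL_mul]
    have h2 : (s : Matrix (Fin N) (Fin N) (GroupCompletion G)) * Y * s⁻¹.val =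
        s * (normalizeGL (groupAug G) B).val * s⁻¹.val - 1 := by
      rw [hY, mul_sub, sub_mul, mul_one, Units.mul_inv]
    rw [h2]
    simp only [Units.val_mul, hX, sub_mul, mul_sub, one_mul, mul_one]
    abel
  have hY1 : (s : Matrix (Fin N) (Fin N) (GroupCompletion G)) * Y * s⁻¹.val ∈
      matFilt (groupAug G) N 1 := by
    have h0 : ∀ Z, Z ∈ matFilt (groupAug G) N 0 := fun Z => by rw [matFilt_zero]; trivial
    simpa using mul_mem_matFilt (mul_mem_matFilt (h0 s)
      (normalizeGL_sub_one_mem (groupAug G) B)) (h0 ↑s⁻¹)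
  rw [h1, trace_truncLog_mul (J := matFilt (groupAug G) N) (matFilt_zero N)
    (fun m n x y hx hy => mul_mem_matFilt hx hy) (θ.cycTrace n) (θ.cycTrace_mul_comm n)
    (fun x hx => θ.cycTrace_eq_zero n.lt_succ_self hx) (normalizeGL_sub_one_mem (groupAug G) A) hY1,
    truncLog_conj, θ.cycTrace_mul_comm, ← mul_assoc, Units.inv_mul, one_mul]

/-- The leading term of the logarithm. -/
theorem cycPart_trLog_of_mem {A : (Matrix (Fin N) (Fin N) (GroupCompletion G))ˣ} {m n : ℕ}
    (hA : A.val - 1 ∈ matFilt (groupAug G) N m) (hn : n < m + m) :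
    θ.cycPart n (trLog (groupAug G) A) = θ.cycTrace n (A.val - 1) := by
  have h1 : augGL (groupAug G) A = 1 :=
    (sub_one_mem_matFilt (groupAug G)).1 (matFilt_anti (by omega) hA)
  rw [cycPart_trLog, normalizeGL_of_augGL_eq_one _ h1, truncLog, Finset.sum_range_succ', map_add,
    map_sum, Finset.sum_eq_zero, zero_add]
  · simp
  · intro k _
    rw [map_smul, θ.cycTrace_eq_zero _ (pow_mem_matFilt hA (k + 1 + 1)), smul_zero]
    nlinarith

end MagnusExpansion

/-! ### Maps to and from `K₁` -/

namespace KOne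

variable {R : Type*} [Ring R]

theorem mk_stabGL {m n : ℕ} (h : m ≤ n) (A : (Matrix (Fin m) (Fin m) R)ˣ) :
    mk n (stabGL R m n h A) = mk m A := by
  unfold mk
  congr 1
  exact (DirectLimit.eq_of_le (F := fun n : ℕ => (Matrix (Fin n) (Fin n) R)ˣ)
    (f := stabGL R) ⟨m, A⟩ n h).symm

theorem mk_mul (n : ℕ) (A B : (Matrix (Fin n) (Fin n) R)ˣ) : mk n (A * B) = mk n A * mk n B := by
  rw [mk, mk, mk, ← map_mul, DirectLimit.mul_def]

/-- The map `GL(n, R) → K₁(R)` as a group homomorphism. -/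
def mkHom (n : ℕ) : (Matrix (Fin n) (Fin n) R)ˣ →* KOne R := MonoidHom.mk' (mk n) (mk_mul n)

theorem mkHom_apply (n : ℕ) (A : (Matrix (Fin n) (Fin n) R)ˣ) : mkHom n A = mk n A := rfl

theorem exists_mk (κ : KOne R) : ∃ n A, mk n A = κ := by
  obtain ⟨a, rfl⟩ := QuotientGroup.mk_surjective κ
  induction a using DirectLimit.induction with
  | _ n A => exact ⟨n, A, rfl⟩

theorem exists_lift {M : Type*} [CommGroup M] (f : ∀ n, (Matrix (Fin n) (Fin n) R)ˣ →* M)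
    (hf : ∀ m n (h : m ≤ n) A, f n (stabGL R m n h A) = f m A) :
    ∃ F : KOne R →* M, ∀ n A, F (mk n A) = f n A := by
  let F₀ : StableGL R → M := DirectLimit.lift (stabGL R) (fun n A => f n A)
    fun m n h A => (hf m n h A).symm
  have hF₀ : ∀ n A, F₀ ⟦⟨n, A⟩⟧ = f n A := fun n A => rfl
  refine ⟨Abelianization.lift (MonoidHom.mk' F₀ fun a b => ?_), fun n A => ?_⟩
  · induction a, b using DirectLimit.induction₂ (f := stabGL R) with
    | _ n A B => rw [DirectLimit.mul_def, hF₀, hF₀, hF₀, map_mul]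
  · rfl

/-- The map `Rˣ → K₁(R)` as a group homomorphism. -/
def ofUnitHom : Rˣ →* KOne R :=
  (mkHom 1).comp (Units.map (Matrix.scalar (Fin 1)).toMonoidHom)

theorem ofUnitHom_apply (u : Rˣ) : ofUnitHom u = ofUnit u := rfl

end KOne

/-! ### Elimination along an idempotent, in an abelian quotient -/

section Elimination

/-- The unit `1 + X` for `X² = 0`. -/
def unipotentUnit {S : Type*} [Ring S] (X : S) (h : X * X = 0) : Sˣ where
  val := 1 + X
  inv := 1 - X
  val_inv := by rw [mul_sub, add_mul, add_mul, h]; simp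
  inv_val := by rw [mul_add, sub_mul, sub_mul, h]; simp

/-- The unit `1 + p` for an idempotent `p`. -/
def idempotentUnit {S : Type*} [Ring S] [Algebra ℚ S] (p : S) (h : p * p = p) : Sˣ where
  val := 1 + p
  inv := 1 - (1 / 2 : ℚ) • p
  val_inv := by
    rw [mul_sub, mul_smul_comm, add_mul, add_mul, h]
    simp only [mul_one, one_mul]
    module
  inv_val := by
    rw [sub_mul, mul_add, smul_mul_assoc, mul_add, h]
    simp only [mul_one, one_mul]
    module

variable {S : Type*} [Ring S] [Algebra ℚ S] {M : Type*} [CommGroup M]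

/-- The relation `(1 + X)(1 + p) = (1 + p)(1 + X)²` becomes `f (1 + X) = f (1 + X)²` in the abelian
group `M`. The element `1 + p` is invertible because `2` is. -/
theorem map_unipotentUnit_right (f : Sˣ →* M) {p X : S} (hp : p * p = p) (h1 : X * p = X)
    (h2 : p * X = 0) (h : X * X = 0) : f (unipotentUnit X h) = 1 := by
  have e : unipotentUnit X h * idempotentUnit p hp =
      idempotentUnit p hp * unipotentUnit X h * unipotentUnit X h := by
    ext
    simp only [unipotentUnit, idempotentUnit, Units.val_mul, add_mul, mul_add, h, h1, h2, one_mul,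
      mul_one, add_zero]
    abel
  have e' := congrArg f e
  rw [map_mul, map_mul, map_mul, mul_comm (f (unipotentUnit X h)), mul_assoc] at e'
  simpa using e'

theorem map_unipotentUnit_left (f : Sˣ →* M) {p X : S} (hp : p * p = p) (h1 : p * X = X)
    (h2 : X * p = 0) (h : X * X = 0) : f (unipotentUnit X h) = 1 := by
  have e : idempotentUnit p hp * unipotentUnit X h =
      unipotentUnit X h * unipotentUnit X h * idempotentUnit p hp := by
    ext
    simp only [unipotentUnit, idempotentUnit, Units.val_mul, add_mul, mul_add, h, h1, h2, one_mul,
      mul_one, add_zero]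
    abel
  have e' := congrArg f e
  rw [map_mul, map_mul, map_mul, mul_comm (f (idempotentUnit p hp))] at e'
  simpa using e'

/-- Elimination along an idempotent `p` whose corner `p a p` is invertible in `p S p`. -/
theorem exists_block_diagonal (f : Sˣ →* M) {p b : S} (hp : p * p = p) (a : Sˣ)
    (hb : p * b = b) (hb' : b * p = b) (h1 : p * a * b = p) (h2 : b * a * p = p) :
    ∃ d : Sˣ, f a = f d ∧ p * d * p = p * a * p ∧ p * d * (1 - p) = 0 ∧ (1 - p) * d * p = 0 := by
  have hX : (a * b - p) * p = a * b - p := by rw [sub_mul, mul_assoc, hb', hp]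
  have hX' : p * (a * b - p) = 0 := by rw [mul_sub, ← mul_assoc, h1, hp, sub_self]
  have hXX : (a * b - p) * (a * b - p) = 0 := by
    nth_rw 1 [← hX]
    rw [mul_assoc, hX', mul_zero]
  have hY : p * (b * a - p) = b * a - p := by rw [mul_sub, ← mul_assoc, hb, hp]
  have hY' : (b * a - p) * p = 0 := by rw [sub_mul, h2, hp, sub_self]
  have hYY : (b * a - p) * (b * a - p) = 0 := by
    nth_rw 2 [← hY]
    rw [← mul_assoc, hY', zero_mul]
  have hX1 := map_unipotentUnit_right f hp hX hX' hXX
  have hY1 := map_unipotentUnit_left f hp hY hY' hYY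
  -- Since `b` inverts `p a p` in the corner, multiplying `a` by `x⁻¹` on the left clears `(1 - p) a
  -- p`, and by `y⁻¹` on the right clears `p a (1 - p)`.
  set x := unipotentUnit (a * b - p) hXX with hx
  set y := unipotentUnit (b * a - p) hYY with hy
  have ex : (x⁻¹ : Sˣ).val = 1 - (a * b - p) := rfl
  have ey : (y⁻¹ : Sˣ).val = 1 - (b * a - p) := rfl
  have hpx : p * (x⁻¹ : Sˣ).val = p := by rw [ex, mul_sub, mul_one, hX', sub_zero]
  have hyp : (y⁻¹ : Sˣ).val * p = p := by rw [ey, sub_mul, one_mul, hY', sub_zero]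
  have h3 : p * a * (y⁻¹ : Sˣ).val = p * a * p := by
    rw [ey, mul_sub, mul_one, mul_sub, ← mul_assoc, h1]; abel
  have h4 : (x⁻¹ : Sˣ).val * a * p = p * a * p := by
    rw [ex, sub_mul, one_mul, sub_mul, sub_mul, sub_mul, mul_assoc (a : S) b, mul_assoc (a : S),
      h2]; abel
  refine ⟨x⁻¹ * a * y⁻¹, by simp [hX1, hY1], ?_, ?_, ?_⟩
  · rw [Units.val_mul, Units.val_mul, mul_assoc p, mul_assoc _ _ p, hyp, ← mul_assoc, ← mul_assoc,
      hpx]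
  · rw [Units.val_mul, Units.val_mul, ← mul_assoc, ← mul_assoc, hpx, h3, mul_sub, mul_one,
      mul_assoc _ p p, hp, sub_self]
  · rw [Units.val_mul, Units.val_mul, mul_assoc (1 - p), mul_assoc _ _ p, hyp, h4, ← mul_assoc,
      ← mul_assoc, sub_mul, hp]
    simp

end Elimination

/-! ### Invariance under stabilization, and the homomorphism `Φ_θ` -/

section Stabilization

variable {R : Type*} [Ring R]

/-- Extension of a matrix by zero. -/
def extMatrix (m n : ℕ) (A : Matrix (Fin m) (Fin m) R) : Matrix (Fin n) (Fin n) R :=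
  Matrix.of fun i j => if h : i.val < m ∧ j.val < m then A ⟨i.val, h.1⟩ ⟨j.val, h.2⟩ else 0

theorem extMatrix_mul {m n : ℕ} (h : m ≤ n) (A B : Matrix (Fin m) (Fin m) R) :
    extMatrix m n (A * B) = extMatrix m n A * extMatrix m n B := by
  obtain ⟨d, rfl⟩ := Nat.exists_eq_add_of_le h
  ext i j
  refine Fin.addCases (fun i => ?_) (fun i => ?_) i <;>
  refine Fin.addCases (fun j => ?_) (fun j => ?_) j <;>
  simp [extMatrix, Matrix.mul_apply, Fin.sum_univ_add]

theorem extMatrix_pow {m n : ℕ} (h : m ≤ n) (A : Matrix (Fin m) (Fin m) R) (k : ℕ) :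
    extMatrix m n (A ^ (k + 1)) = extMatrix m n A ^ (k + 1) := by
  induction k with
  | zero => simp
  | succ k ih => rw [pow_succ, extMatrix_mul h, ih, ← pow_succ]

theorem trace_extMatrix {m n : ℕ} (h : m ≤ n) (A : Matrix (Fin m) (Fin m) R) :
    (extMatrix m n A).trace = A.trace := by
  obtain ⟨d, rfl⟩ := Nat.exists_eq_add_of_le h
  simp [Matrix.trace, extMatrix, Fin.sum_univ_add]

theorem stabMatrix_sub_one (m n : ℕ) (A : Matrix (Fin m) (Fin m) R) :
    stabMatrix m n A - 1 = extMatrix m n (A - 1) := by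
  ext i j
  simp only [stabMatrix, extMatrix, Matrix.sub_apply, Matrix.of_apply, Matrix.one_apply, Fin.ext_iff]
  split_ifs <;> simp

theorem trace_truncLog_stabMatrix [Algebra ℚ R] {m n : ℕ} (h : m ≤ n)
    (A : Matrix (Fin m) (Fin m) R) (k : ℕ) :
    (truncLog k (stabMatrix m n A - 1)).trace = (truncLog k (A - 1)).trace := by
  simp only [truncLog, Matrix.trace_sum, Matrix.trace_smul, stabMatrix_sub_one,
    ← extMatrix_pow h, trace_extMatrix h]

theorem stabMatrix_map {R' : Type*} [Ring R'] (f : R →+* R') (m n : ℕ)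
    (A : Matrix (Fin m) (Fin m) R) : (stabMatrix m n A).map f = stabMatrix m n (A.map f) := by
  ext i j
  simp only [stabMatrix, Matrix.map_apply, Matrix.of_apply]
  split_ifs <;> simp

theorem det_stabMatrix {K : Type*} [CommRing K] {m n : ℕ} (h : m ≤ n)
    (A : Matrix (Fin m) (Fin m) K) : (stabMatrix m n A).det = A.det := by
  obtain ⟨d, rfl⟩ := Nat.exists_eq_add_of_le h
  have h1 : ∀ (i : Fin m) (j : Fin d), ¬ (i.val = m + j.val) := fun i j => by omega
  have h2 : ∀ (i : Fin m) (j : Fin d), ¬ (m + j.val = i.val) := fun i j => by omega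
  have e : (stabMatrix m (m + d) A).submatrix finSumFinEquiv finSumFinEquiv =
      Matrix.fromBlocks A 0 0 1 := by
    ext i j
    rcases i with i | i <;> rcases j with j | j <;>
      simp [stabMatrix, h1, h2, Matrix.one_apply]
    simp [← Fin.ext_iff]
  rw [← Matrix.det_submatrix_equiv_self finSumFinEquiv, e, Matrix.det_fromBlocks_zero₂₁,
    Matrix.det_one, mul_one]

variable [Algebra ℚ R] (ε : R →ₐ[ℚ] ℚ)

theorem augGL_stabGL {m n : ℕ} (h : m ≤ n) (A : (Matrix (Fin m) (Fin m) (AugCompletion ε))ˣ) :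
    augGL ε (stabGL _ m n h A) = stabGL _ m n h (augGL ε A) :=
  Units.ext (stabMatrix_map (complAug ε).toRingHom m n A.val)

theorem scalarAug_stabGL {m n : ℕ} (h : m ≤ n) (A : (Matrix (Fin m) (Fin m) (AugCompletion ε))ˣ) :
    scalarAug ε (stabGL _ m n h A) = stabGL _ m n h (scalarAug ε A) := by
  rw [scalarAug, MonoidHom.comp_apply, augGL_stabGL]
  exact Units.ext (stabMatrix_map (Algebra.ofId ℚ (AugCompletion ε)).toRingHom m n _)

theorem normalizeGL_stabGL {m n : ℕ} (h : m ≤ n)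
    (A : (Matrix (Fin m) (Fin m) (AugCompletion ε))ˣ) :
    normalizeGL ε (stabGL _ m n h A) = stabGL _ m n h (normalizeGL ε A) := by
  rw [normalizeGL_eq, normalizeGL_eq, scalarAug_stabGL, map_mul, map_inv]

theorem det_augGL_stabGL {m n : ℕ} (h : m ≤ n) (A : (Matrix (Fin m) (Fin m) (AugCompletion ε))ˣ) :
    Matrix.GeneralLinearGroup.det (augGL ε (stabGL _ m n h A)) =
      Matrix.GeneralLinearGroup.det (augGL ε A) := by
  rw [augGL_stabGL]
  exact Units.ext (det_stabMatrix h _)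

/-- Stabilization extends `A - 1` by zero. The positive powers are extended in the same way, so no
term of the series changes its trace. -/
theorem trLog_stabGL {m n : ℕ} (h : m ≤ n) (A : (Matrix (Fin m) (Fin m) (AugCompletion ε))ˣ) :
    trLog ε (stabGL _ m n h A) = trLog ε A := by
  refine AugCompletion.ext fun k => ?_
  rw [sub_mem_complFilt.1 (trLog_sub_trace_mem ε _ k), sub_mem_complFilt.1 (trLog_sub_trace_mem ε A k),
    normalizeGL_stabGL]
  exact congrArg _ (trace_truncLog_stabMatrix h _ k)

end Stabilization

/-- The homomorphism `Φ_θ`. -/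
theorem MagnusExpansion.exists_phi {G : Type*} [Group G] (θ : MagnusExpansion G) :
    ∃ Φ : KOne (GroupCompletion G) →*
        ℚˣ × Multiplicative ((n : ℕ+) → CyclicTensor (RatHOne G) n),
      ∀ (N : ℕ) (A : (Matrix (Fin N) (Fin N) (GroupCompletion G))ˣ), Φ (KOne.mk N A) =
        (Matrix.GeneralLinearGroup.det (augGL (groupAug G) A),
          Multiplicative.ofAdd (θ.cyclicPart (trLog (groupAug G) A))) := by
  refine KOne.exists_lift (fun N => MonoidHom.mk' (fun A =>
    (Matrix.GeneralLinearGroup.det (augGL (groupAug G) A),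
          Multiplicative.ofAdd (θ.cyclicPart (trLog (groupAug G) A)))) fun A B => ?_) ?_
  · rw [map_mul, map_mul, Prod.mk_mul_mk, ← ofAdd_add]
    congr 2
    funext n
    exact θ.cycPart_trLog_mul A B n
  · intro m n h A
    simp only [MonoidHom.mk'_apply, det_augGL_stabGL, trLog_stabGL]

/-! ### Gaussian elimination over a local ring -/

section LocalElimination

variable {R : Type*} [Ring R]

/-- The diagonal matrix with the entry `a` in position `i`, and `1` elsewhere. -/
def diagUnit {n : ℕ} (i : Fin n) (a : Rˣ) : (Matrix (Fin n) (Fin n) R)ˣ where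
  val := Matrix.diagonal (Function.update 1 i a)
  inv := Matrix.diagonal (Function.update 1 i ↑a⁻¹)
  val_inv := by
    rw [Matrix.diagonal_mul_diagonal, ← Matrix.diagonal_one]
    congr 1
    funext j
    by_cases h : j = i
    · subst h; simp
    · simp [h]
  inv_val := by
    rw [Matrix.diagonal_mul_diagonal, ← Matrix.diagonal_one]
    congr 1
    funext j
    by_cases h : j = i
    · subst h; simp
    · simp [h]

/-- A permutation matrix conjugates the entry to position `0`, which does not matter in `K₁`; there
the matrix is a stabilized `1 × 1` matrix. -/
theorem KOne.mk_diagUnit {n : ℕ} (i : Fin n) (a : Rˣ) : KOne.mk n (diagUnit i a) = KOne.ofUnit a := by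
  have h0 : 0 < n := i.pos
  let w : (Matrix (Fin n) (Fin n) R)ˣ := ⟨Matrix.swap R i ⟨0, h0⟩, Matrix.swap R i ⟨0, h0⟩,
    Matrix.swap_mul_self _ _, Matrix.swap_mul_self _ _⟩
  have h1 : w * diagUnit i a = diagUnit ⟨0, h0⟩ a * w := by
    refine Units.ext ?_
    simp only [w, diagUnit, Units.val_mul, Matrix.swap, Equiv.Perm.permMatrix]
    rw [PEquiv.toMatrix_toPEquiv_mul, PEquiv.mul_toMatrix_toPEquiv]
    ext j k
    simp only [Matrix.submatrix_apply, Matrix.diagonal_apply, id, Equiv.eq_symm_apply]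
    congr 1
    by_cases hj : j = ⟨0, h0⟩
    · subst hj; simp
    · rw [Function.update_of_ne hj, Function.update_of_ne, Pi.one_apply, Pi.one_apply]
      intro h
      rw [← Equiv.eq_symm_apply] at h
      simp at h
      exact hj h
  have h2 : diagUnit ⟨0, h0⟩ a = stabGL R 1 n h0 (Units.map (Matrix.scalar (Fin 1)).toMonoidHom a) := by
    refine Units.ext (Matrix.ext fun j k => ?_)
    simp only [diagUnit, stabGL, stabMatrix, Units.coe_map, MonoidHom.coe_mk, OneHom.coe_mk, Matrix.of_apply,
      Matrix.diagonal_apply]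
    by_cases hj : j = ⟨0, h0⟩
    · subst hj
      by_cases hk : ⟨0, h0⟩ = k
      · subst hk; simp
      · have : k.val ≠ 0 := fun h => hk (Fin.ext h.symm)
        simp [hk, this, this.symm]
    · have : j.val ≠ 0 := fun h => hj (Fin.ext h)
      simp [hj, this, Fin.ext_iff]
  have h3 := congrArg (KOne.mkHom n) h1
  rw [map_mul, map_mul, mul_comm, mul_left_inj, h2] at h3
  exact h3.trans (KOne.mk_stabGL h0 _)

theorem eq_stabMatrix_of_last {N : ℕ} {M : Matrix (Fin (N + 1)) (Fin (N + 1)) R}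
    (h1 : M * Matrix.single (Fin.last N) (Fin.last N) 1 =
      Matrix.single (Fin.last N) (Fin.last N) 1)
    (h2 : Matrix.single (Fin.last N) (Fin.last N) 1 * M =
      Matrix.single (Fin.last N) (Fin.last N) 1) :
    M = stabMatrix N (N + 1) (M.submatrix Fin.castSucc Fin.castSucc) := by
  have h1' : ∀ i, M i (Fin.last N) = Matrix.single (Fin.last N) (Fin.last N) (1 : R) i (Fin.last N) := by
    intro i
    rw [← h1]; simp
  have h2' : ∀ i, M (Fin.last N) i = Matrix.single (Fin.last N) (Fin.last N) (1 : R) (Fin.last N) i := by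
    intro i
    rw [← h2]; simp
  ext i j
  refine Fin.lastCases ?_ (fun i => ?_) i
  · rw [h2']
    refine Fin.lastCases ?_ (fun j => ?_) j
    · simp [stabMatrix]
    · have : N ≠ j.val := by omega
      simp [stabMatrix, this, Fin.ext_iff]
  · refine Fin.lastCases ?_ (fun j => ?_) j
    · have : i.val ≠ N := by omega
      rw [h1']
      simp [stabMatrix, this, this.symm, Fin.ext_iff]
    · simp [stabMatrix]

theorem stabMatrix_succ_injective (N : ℕ) :
    Function.Injective (stabMatrix N (N + 1) : Matrix (Fin N) (Fin N) R → _) := by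
  intro A B h
  ext i j
  have := congrFun (congrFun h i.castSucc) j.castSucc
  simpa [stabMatrix] using this

/-- The inverse of `M` satisfies the same two equations, so its upper left block inverts that of
`M`. -/
theorem exists_stabGL_eq {N : ℕ} {M : (Matrix (Fin (N + 1)) (Fin (N + 1)) R)ˣ}
    (h1 : M.val * Matrix.single (Fin.last N) (Fin.last N) 1 =
      Matrix.single (Fin.last N) (Fin.last N) 1)
    (h2 : Matrix.single (Fin.last N) (Fin.last N) 1 * M.val =
      Matrix.single (Fin.last N) (Fin.last N) 1) :
    ∃ A, M = stabGL R N (N + 1) N.le_succ A := by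
  have e1 := eq_stabMatrix_of_last h1 h2
  have e2 : (M⁻¹ : (Matrix (Fin (N + 1)) (Fin (N + 1)) R)ˣ).val = _ :=
    eq_stabMatrix_of_last ((Units.inv_mul_eq_iff_eq_mul M).2 h1.symm)
      ((Units.mul_inv_eq_iff_eq_mul M).2 h2.symm)
  refine ⟨⟨M.val.submatrix Fin.castSucc Fin.castSucc,
    (M⁻¹ : (Matrix (Fin (N + 1)) (Fin (N + 1)) R)ˣ).val.submatrix Fin.castSucc Fin.castSucc,
    stabMatrix_succ_injective N ?_, stabMatrix_succ_injective N ?_⟩, Units.ext e1⟩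
  · rw [stabMatrix_mul R N.le_succ, ← e1, ← e2, stabMatrix_one, Units.mul_inv]
  · rw [stabMatrix_mul R N.le_succ, ← e1, ← e2, stabMatrix_one, Units.inv_mul]

variable [Algebra ℚ R]

/-- The pivot step of the elimination. -/
theorem KOne.exists_mk_eq_of_isUnit {N : ℕ} (A : (Matrix (Fin (N + 1)) (Fin (N + 1)) R)ˣ)
    (hA : IsUnit (A.val (Fin.last N) (Fin.last N))) :
    ∃ (a : Rˣ) (B : (Matrix (Fin N) (Fin N) R)ˣ), KOne.mk (N + 1) A = KOne.ofUnit a * KOne.mk N B := by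
  obtain ⟨a, ha⟩ := hA
  set p : Matrix (Fin (N + 1)) (Fin (N + 1)) R := Matrix.single (Fin.last N) (Fin.last N) 1 with hp
  have hpp : p * p = p := by simp [hp]
  have hpAp : p * A.val * p = Matrix.single (Fin.last N) (Fin.last N) (a : R) := by
    rw [hp, Matrix.single_mul_mul_single, ← ha, one_mul, mul_one]
  obtain ⟨d, hd, hd1, hd2, hd3⟩ := exists_block_diagonal (KOne.mkHom (R := R) (N + 1)) hpp A
    (b := Matrix.single (Fin.last N) (Fin.last N) ↑a⁻¹) (by simp [hp]) (by simp [hp])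
    (by
      rw [show (Matrix.single (Fin.last N) (Fin.last N) (↑a⁻¹ : R)) =
        p * Matrix.single (Fin.last N) (Fin.last N) ↑a⁻¹ by simp [hp], ← mul_assoc, hpAp]
      simp [hp])
    (by
      rw [show (Matrix.single (Fin.last N) (Fin.last N) (↑a⁻¹ : R)) =
        Matrix.single (Fin.last N) (Fin.last N) ↑a⁻¹ * p by simp [hp], mul_assoc, mul_assoc,
        ← mul_assoc p, hpAp]
      simp [hp])
  have hD1 : (diagUnit (Fin.last N) a).val * p = p * A.val * p := by
    rw [hpAp, hp]
    ext i j
    rw [diagUnit, Matrix.diagonal_mul]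
    by_cases hi : i = Fin.last N
    · subst hi; simp [Matrix.single_apply]
    · simp [Ne.symm hi]
  have hD2 : p * (diagUnit (Fin.last N) a).val = p * A.val * p := by
    rw [hpAp, hp]
    ext i j
    rw [diagUnit, Matrix.mul_diagonal]
    by_cases hi : j = Fin.last N
    · subst hi; simp [Matrix.single_apply]
    · simp [Ne.symm hi]
  have hd4 : d.val * p = p * A.val * p := by
    rw [← hd1, ← sub_eq_zero, ← hd3]; noncomm_ring
  have hd5 : p * d.val = p * A.val * p := by
    rw [← hd1, ← sub_eq_zero, ← hd2]; noncomm_ring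
  -- `d` and `D` have the same last row and last column, so `D⁻¹ * d` is a stabilization.
  set D := diagUnit (Fin.last N) a
  have hDp : (D⁻¹ : (Matrix (Fin (N + 1)) (Fin (N + 1)) R)ˣ).val * p =
      p * (D⁻¹ : (Matrix (Fin (N + 1)) (Fin (N + 1)) R)ˣ).val := by
    rw [Units.inv_mul_eq_iff_eq_mul, ← mul_assoc, hD1, ← hD2, mul_assoc, Units.mul_inv, mul_one]
  obtain ⟨B, hB⟩ := exists_stabGL_eq (M := D⁻¹ * d)
    (by rw [← hp, Units.val_mul, mul_assoc, hd4, ← hD1, ← mul_assoc, Units.inv_mul, one_mul])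
    (by rw [← hp, Units.val_mul, ← mul_assoc, ← hDp, mul_assoc, hd5, ← hD1, ← mul_assoc,
      Units.inv_mul, one_mul])
  refine ⟨a, B, ?_⟩
  rw [← KOne.mk_stabGL N.le_succ B, ← hB, ← KOne.mk_diagUnit (Fin.last N) a, ← KOne.mk_mul,
    mul_inv_cancel_left]
  exact hd

/-- Gaussian elimination over a local ring. -/
theorem KOne.ofUnitHom_surjective {K : Type*} [Field K] (χ : R →+* K)
    (hχ : ∀ a, χ a ≠ 0 → IsUnit a) :
    Function.Surjective (KOne.ofUnitHom (R := R)) := by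
  suffices h : ∀ N (A : (Matrix (Fin N) (Fin N) R)ˣ), ∃ u, KOne.ofUnitHom u = KOne.mk N A by
    intro κ
    obtain ⟨N, A, rfl⟩ := KOne.exists_mk κ
    exact h N A
  intro N
  induction N with
  | zero =>
    intro A
    refine ⟨1, ?_⟩
    rw [map_one, Subsingleton.elim A 1, ← KOne.mkHom_apply, map_one]
  | succ N ih =>
    suffices h : ∀ A : (Matrix (Fin (N + 1)) (Fin (N + 1)) R)ˣ,
        χ (A.val (Fin.last N) (Fin.last N)) ≠ 0 → ∃ u, KOne.ofUnitHom u = KOne.mk (N + 1) A by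
      intro A
      by_cases hA : χ (A.val (Fin.last N) (Fin.last N)) = 0
      -- The last column cannot vanish over the residue field. If its last entry does, adding row
      -- `i` to the last row creates an invertible pivot, and the elementary matrix is trivial in
      -- `K₁`.
      · obtain ⟨i, hi⟩ : ∃ i, χ (A.val i (Fin.last N)) ≠ 0 := by
          by_contra! h
          have h1 := congrArg χ (congrFun (congrFun A.inv_mul (Fin.last N)) (Fin.last N))
          rw [Matrix.mul_apply, map_sum, Finset.sum_eq_zero, Matrix.one_apply_eq, map_one] at h1
          · exact zero_ne_one h1
          · intro i _
            rw [map_mul, h i, mul_zero]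
        have hne : i ≠ Fin.last N := fun h => hi (h ▸ hA)
        have hX : Matrix.single (Fin.last N) i (1 : R) * Matrix.single (Fin.last N) i 1 = 0 :=
          Matrix.single_mul_single_of_ne _ _ _ _ hne _
        obtain ⟨u, hu⟩ := h (unipotentUnit _ hX * A) (by
          rw [Units.val_mul, unipotentUnit, add_mul, one_mul, Matrix.add_apply,
            Matrix.single_mul_apply_same, one_mul, map_add, hA, zero_add]
          exact hi)
        refine ⟨u, hu.trans ?_⟩
        rw [KOne.mk_mul, ← KOne.mkHom_apply, map_unipotentUnit_left (KOne.mkHom (R := R) (N + 1))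
          (p := Matrix.single (Fin.last N) (Fin.last N) 1) (by simp) (by simp)
          (Matrix.single_mul_single_of_ne _ _ _ _ hne _), one_mul]
      · exact h A hA
    intro A hA
    obtain ⟨a, B, hB⟩ := KOne.exists_mk_eq_of_isUnit A (hχ _ hA)
    obtain ⟨u, hu⟩ := ih B
    exact ⟨a * u, by rw [map_mul, hu, hB]; rfl⟩

end LocalElimination

open scoped commutatorElement

/-! ### First-order behaviour of commutators of units -/

section UnitFiltration

variable {R : Type*} [Ring R] [Algebra ℚ R] {ε : R →ₐ[ℚ] ℚ}

theorem complAug_eq_one_iff {a : AugCompletion ε} : complAug ε a = 1 ↔ a - 1 ∈ complFilt ε 1 := by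
  rw [← complAug_eq_zero_iff, map_sub, map_one, sub_eq_zero]

theorem complAug_val_inv {a : (AugCompletion ε)ˣ} (ha : complAug ε a = 1) :
    complAug ε (a⁻¹ : (AugCompletion ε)ˣ).val = 1 := by
  have := congrArg (complAug ε) a.mul_inv
  rwa [map_mul, ha, one_mul, map_one] at this

/-- Elements of `1 + Î` act trivially on the graded pieces of the filtration. -/
theorem mul_mul_sub_mem {m : ℕ} {p q D : AugCompletion ε} (hp : complAug ε p = 1)
    (hq : complAug ε q = 1) (hD : D ∈ complFilt ε m) : p * D * q - D ∈ complFilt ε (m + 1) := by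
  have e : p * D * q - D = (p - 1) * (D * q) + D * (q - 1) := by noncomm_ring
  rw [e]
  refine add_mem ?_ (mul_mem_complFilt hD (complAug_eq_one_iff.1 hq))
  rw [add_comm m]
  exact mul_mem_complFilt (complAug_eq_one_iff.1 hp) (mul_mem_complFilt_right q hD)

theorem sum_bracket_mem {d n : ℕ} {X W : Fin d → AugCompletion ε}
    (hX : ∀ i, X i ∈ complFilt ε 1) (hW : ∀ i, W i ∈ complFilt ε n) :
    ∑ i, (X i * W i - W i * X i) ∈ complFilt ε (n + 1) :=
  sum_mem fun i _ => sub_mem (by rw [add_comm n]; exact mul_mem_complFilt (hX i) (hW i))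
    (mul_mem_complFilt (hW i) (hX i))

/-- There is an exact identity `[a, zy] - [a, z] = (a z a⁻¹)(ay - ya)(a⁻¹ y⁻¹ z⁻¹)`, where `ay - ya`
is the commutator of `a - 1` and `y - 1`. The outer factors are `1` modulo `Î`, so they only matter
one step deeper. -/
theorem commutator_sub_mem {n : ℕ} {a z y : (AugCompletion ε)ˣ} (ha : complAug ε a = 1)
    (hz : complAug ε z = 1) (hy : complAug ε y = 1) (hW : (y : AugCompletion ε) - 1 ∈ complFilt ε n) :
    (⁅a, z * y⁆ : (AugCompletion ε)ˣ).val - (⁅a, z⁆ : (AugCompletion ε)ˣ).val -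
      ((a.val - 1) * (y - 1) - (y - 1) * (a.val - 1)) ∈ complFilt ε (n + 1 + 1) := by
  have hD : (a.val - 1) * (y.val - 1) - (y.val - 1) * (a.val - 1) ∈ complFilt ε (n + 1) :=
    sub_mem (by rw [add_comm n]; exact mul_mem_complFilt (complAug_eq_one_iff.1 ha) hW)
      (mul_mem_complFilt hW (complAug_eq_one_iff.1 ha))
  have e : (⁅a, z * y⁆ : (AugCompletion ε)ˣ).val - (⁅a, z⁆ : (AugCompletion ε)ˣ).val =
      (a * z * a⁻¹ : (AugCompletion ε)ˣ).val *
        ((a.val - 1) * (y.val - 1) - (y.val - 1) * (a.val - 1)) *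
          (a⁻¹ * y⁻¹ * z⁻¹ : (AugCompletion ε)ˣ).val := by
    have e1 : (a.val - 1) * (y.val - 1) - (y.val - 1) * (a.val - 1) =
        (a * y : (AugCompletion ε)ˣ).val - (y * a : (AugCompletion ε)ˣ).val := by
      rw [Units.val_mul, Units.val_mul]; noncomm_ring
    rw [e1, mul_sub, sub_mul]
    simp only [← Units.val_mul, commutatorElement_def]
    congr 2 <;> group
  rw [e]
  refine mul_mul_sub_mem ?_ ?_ hD
  · simp [ha, hz, complAug_val_inv ha]
  · simp [complAug_val_inv ha, complAug_val_inv hz, complAug_val_inv hy]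

theorem complAug_list_prod {d : ℕ} {c : Fin d → AugCompletion ε} (hc : ∀ i, complAug ε (c i) = 1) :
    complAug ε (List.ofFn c).prod = 1 := by
  rw [map_list_prod, List.map_ofFn]
  refine List.prod_eq_one fun x hx => ?_
  obtain ⟨i, rfl⟩ := (List.mem_ofFn).1 hx
  exact hc i

/-- The factors are `1` modulo `Î`, so a perturbation in step `m` passes them at the cost of an
error in step `m + 1`. Hence the perturbations add up. -/
theorem list_prod_sub_mem {m d : ℕ} {c c' δ : Fin d → AugCompletion ε}
    (hc : ∀ i, complAug ε (c i) = 1) (hc' : ∀ i, complAug ε (c' i) = 1)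
    (hδ : ∀ i, δ i ∈ complFilt ε m) (h : ∀ i, c' i - c i - δ i ∈ complFilt ε (m + 1)) :
    (List.ofFn c').prod - (List.ofFn c).prod - ∑ i, δ i ∈ complFilt ε (m + 1) := by
  induction d with
  | zero => simp
  | succ d ih =>
    have ih' := ih (fun i => hc i.succ) (fun i => hc' i.succ) (fun i => hδ i.succ)
      (fun i => h i.succ)
    rw [List.ofFn_succ, List.ofFn_succ, List.prod_cons, List.prod_cons, Fin.sum_univ_succ]
    set P := (List.ofFn fun i : Fin d => c i.succ).prod
    set P' := (List.ofFn fun i : Fin d => c' i.succ).prod with hP'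
    set T := ∑ i : Fin d, δ i.succ with hT
    have e : c' 0 * P' - c 0 * P - (δ 0 + T) = (c' 0 - c 0 - δ 0) * P' + c 0 * (P' - P - T) +
        δ 0 * (P' - 1) + (c 0 - 1) * T := by noncomm_ring
    rw [e]
    refine add_mem (add_mem (add_mem (mul_mem_complFilt_right _ (h 0))
      (mul_mem_complFilt_left _ ih')) (mul_mem_complFilt (hδ 0)
        (complAug_eq_one_iff.1 (complAug_list_prod fun i => hc' i.succ)))) ?_
    rw [add_comm m]
    exact mul_mem_complFilt (complAug_eq_one_iff.1 (hc 0)) (sum_mem fun i _ => hδ i.succ)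

/-- The product of the commutators of `a i` and `z i`. -/
def commProd {U : Type*} [Group U] {d : ℕ} (a z : Fin d → U) : U :=
  (List.ofFn fun i => ⁅a i, z i⁆).prod

theorem map_commProd {U V : Type*} [Group U] [Group V] (f : U →* V) {d : ℕ} (a z : Fin d → U) :
    f (commProd a z) = commProd (f ∘ a) (f ∘ z) := by
  rw [commProd, map_list_prod, List.map_ofFn, commProd]
  congr 2
  funext i
  exact map_commutatorElement f _ _

theorem commProd_mem_commutator {U : Type*} [Group U] {d : ℕ} (a z : Fin d → U) :
    commProd a z ∈ commutator U := by
  refine list_prod_mem fun x hx => ?_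
  obtain ⟨i, rfl⟩ := (List.mem_ofFn).1 hx
  exact Subgroup.commutator_mem_commutator trivial trivial

theorem val_commProd {d : ℕ} (a z : Fin d → (AugCompletion ε)ˣ) :
    (commProd a z).val = (List.ofFn fun i => (⁅a i, z i⁆ : (AugCompletion ε)ˣ).val).prod := by
  rw [commProd, ← Units.coeHom_apply, map_list_prod, List.map_ofFn]
  rfl

theorem complAug_commutator (a z : (AugCompletion ε)ˣ) :
    complAug ε (⁅a, z⁆ : (AugCompletion ε)ˣ).val = 1 := by
  have : Units.map (complAug ε : AugCompletion ε →* ℚ) ⁅a, z⁆ = 1 := by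
    rw [map_commutatorElement, commutatorElement_eq_one_iff_mul_comm, mul_comm]
  exact congrArg Units.val this

theorem commProd_sub_mem {n d : ℕ} {a z y : Fin d → (AugCompletion ε)ˣ}
    (ha : ∀ i, complAug ε (a i) = 1)
    (hz : ∀ i, complAug ε (z i) = 1) (hy : ∀ i, complAug ε (y i) = 1)
    (hW : ∀ i, (y i : AugCompletion ε) - 1 ∈ complFilt ε n) :
    (commProd a (fun i => z i * y i)).val - (commProd a z).val -
      ∑ i, (((a i).val - 1) * (y i - 1) - (y i - 1) * ((a i).val - 1)) ∈ complFilt ε (n + 1 + 1) := by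
  rw [val_commProd, val_commProd]
  exact list_prod_sub_mem (fun _ => complAug_commutator _ _) (fun _ => complAug_commutator _ _)
    (fun i => sub_mem (by rw [add_comm n]; exact mul_mem_complFilt (complAug_eq_one_iff.1 (ha i)) (hW i))
      (mul_mem_complFilt (hW i) (complAug_eq_one_iff.1 (ha i))))
    fun i => commutator_sub_mem (ha i) (hz i) (hy i) (hW i)

end UnitFiltration

/-! ### Units with given logarithm, and units that are products of commutators -/

namespace MagnusExpansion

variable {G : Type*} [Group G] (θ : MagnusExpansion G)

/-- The degree `n` part of the logarithm of a unit. -/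
def cycLog (n : ℕ) : (GroupCompletion G)ˣ →* Multiplicative (CyclicTensor (RatHOne G) n) :=
  MonoidHom.mk' (fun u => Multiplicative.ofAdd (θ.cycPart n (trLog (groupAug G)
    (Units.map (Matrix.scalar (Fin 1)).toMonoidHom u)))) fun u v => by
      rw [map_mul, cycPart_trLog_mul, ofAdd_add]

theorem cycLog_apply (n : ℕ) (u : (GroupCompletion G)ˣ) :
    θ.cycLog n u = Multiplicative.ofAdd (θ.cycPart n (trLog (groupAug G)
      (Units.map (Matrix.scalar (Fin 1)).toMonoidHom u))) := rfl

theorem cycLog_of_mem {u : (GroupCompletion G)ˣ} {m n : ℕ}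
    (hu : u.val - 1 ∈ complFilt (groupAug G) m) (hn : n < m + m) :
    θ.cycLog n u = Multiplicative.ofAdd (θ.cycPart n (u.val - 1)) := by
  rw [cycLog_apply, θ.cycPart_trLog_of_mem (m := m) _ hn, cycTrace_apply]
  · simp [Matrix.trace_sub]
  · intro i j
    rw [Subsingleton.elim i j]
    simpa using hu

theorem cycLog_eq_one {u : (GroupCompletion G)ˣ} {n : ℕ}
    (hu : u.val - 1 ∈ complFilt (groupAug G) (n + 1)) : θ.cycLog n u = 1 := by
  rw [θ.cycLog_of_mem hu (by omega), θ.cycPart_eq_zero n.lt_succ_self hu, ofAdd_zero]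

theorem cycLog_congr {u v : (GroupCompletion G)ˣ} {n : ℕ}
    (h : u.val - v.val ∈ complFilt (groupAug G) (n + 1)) : θ.cycLog n u = θ.cycLog n v := by
  have h1 : θ.cycLog n (v⁻¹ * u) = 1 := θ.cycLog_eq_one (by
    rw [Units.val_mul, ← v.inv_mul, ← mul_sub]
    exact mul_mem_complFilt_left _ h)
  rw [map_mul, map_inv, inv_mul_eq_one] at h1
  exact h1.symm

theorem exists_mem_cycPart_eq (n : ℕ) (c : CyclicTensor (RatHOne G) n) :
    ∃ f ∈ complFilt (groupAug G) n, θ.cycPart n f = c := by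
  obtain ⟨x, rfl⟩ := Submodule.mkQ_surjective _ c
  obtain ⟨f, hf, rfl⟩ := θ.exists_complPart_eq n x
  exact ⟨f, hf, rfl⟩

/-- For `f` in step `n + 1`, the factor `1 + f` adds the class of `f` to the logarithm in degree `n
+ 1`. -/
theorem exists_unit_step (c : ∀ n : ℕ, Multiplicative (CyclicTensor (RatHOne G) n)) (n : ℕ)
    (u : (GroupCompletion G)ˣ) : ∃ v : (GroupCompletion G)ˣ,
      v.val - u.val ∈ complFilt (groupAug G) (n + 1) ∧ θ.cycLog (n + 1) v = c (n + 1) := by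
  obtain ⟨f, hf, hfc⟩ := θ.exists_mem_cycPart_eq (n + 1)
    ((c (n + 1)).toAdd - (θ.cycLog (n + 1) u).toAdd)
  have hf1 : (1 + f) - 1 ∈ complFilt (groupAug G) 1 := by
    rw [add_sub_cancel_left]; exact complFilt_anti (by omega) hf
  obtain ⟨w, hw⟩ := isUnit_of_sub_one_mem hf1
  refine ⟨u * w, ?_, ?_⟩
  · rw [Units.val_mul, hw, mul_add, mul_one, add_sub_cancel_left]
    exact mul_mem_complFilt_left _ hf
  · have hw' : w.val - 1 = f := by rw [hw, add_sub_cancel_left]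
    rw [map_mul, θ.cycLog_of_mem (u := w) (m := n + 1) (by rwa [hw']) (by omega), hw', hfc, ofAdd_sub,
      ofAdd_toAdd, ofAdd_toAdd, mul_div_cancel]

theorem exists_unit_cycLog_eq (q : ℚˣ) (c : ∀ n : ℕ, Multiplicative (CyclicTensor (RatHOne G) n)) :
    ∃ u : (GroupCompletion G)ˣ, complAug (groupAug G) u = q ∧
      ∀ n, θ.cycLog (n + 1) u = c (n + 1) := by
  choose F hF hF' using θ.exists_unit_step c
  let s : ℕ → (GroupCompletion G)ˣ := fun n =>
    Nat.rec (Units.map (algebraMap ℚ (GroupCompletion G)).toMonoidHom q) F n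
  have hs : ∀ n, (s (n + 1)).val - (s n).val ∈ complFilt (groupAug G) (n + 1) := fun n => hF n (s n)
  have hs' : ∀ n, θ.cycLog (n + 1) (s (n + 1)) = c (n + 1) := fun n => hF' n (s n)
  obtain ⟨b, hb⟩ := exists_limit (groupAug G) (fun n => (s n).val) fun n =>
    sub_mem_complFilt.1 (complFilt_anti n.le_succ (hs n))
  -- `cycLog (n + 1)` needs agreement with `s (n + 1)` at level `n + 2`, one more than the limit
  -- gives directly. The extra level comes from comparing with the next term.
  have hb' : ∀ n, b - (s n).val ∈ complFilt (groupAug G) (n + 1) := by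
    intro n
    have h := add_mem (sub_mem_complFilt.2 (hb (n + 1))) (hs n)
    rwa [sub_add_sub_cancel] at h
  have h0 : complAug (groupAug G) b = q := by
    have h := complAug_eq_zero_iff.2 (hb' 0)
    rw [map_sub, sub_eq_zero] at h
    rw [h]
    exact (complAug (groupAug G)).commutes (q : ℚ)
  obtain ⟨u, rfl⟩ := isUnit_of_complAug_ne_zero (h0.trans_ne q.ne_zero)
  exact ⟨u, h0, fun n => (θ.cycLog_congr (hb' (n + 1))).trans (hs' n)⟩

variable {d : ℕ} {a : Fin d → (GroupCompletion G)ˣ} {e : Fin d → RatHOne G}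

/-- The error `u P⁻¹` has trivial logarithm, so its leading term dies in the coinvariants and is a
sum of commutators of `e i` with tensors `w i`. As `e i` is the leading term of `a i - 1`,
multiplying `z i` by `1 + W i`, with `W i` a lift of `w i`, cancels it. -/
theorem exists_commProd_step (he : Submodule.span ℚ (Set.range e) = ⊤)
    (ha : ∀ i, complAug (groupAug G) (a i) = 1)
    (hae : ∀ i, θ.complCoeff 1 ((a i).val - 1) = TensorAlgebra.ι ℚ (e i))
    {u : (GroupCompletion G)ˣ} (hu : ∀ n, θ.cycLog (n + 1) u = 1) (n : ℕ)
    {z : Fin d → (GroupCompletion G)ˣ} (hz : ∀ i, complAug (groupAug G) (z i) = 1)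
    (h : u.val - (commProd a z).val ∈ complFilt (groupAug G) (n + 2)) :
    ∃ z' : Fin d → (GroupCompletion G)ˣ, (∀ i, complAug (groupAug G) (z' i) = 1) ∧
      u.val - (commProd a z').val ∈ complFilt (groupAug G) (n + 3) ∧
      ∀ i, (z' i).val - (z i).val ∈ complFilt (groupAug G) (n + 1) := by
  set P := commProd a z with hP
  have hP1 : complAug (groupAug G) P = 1 := by
    rw [hP, val_commProd]
    exact complAug_list_prod fun i => complAug_commutator _ _
  have hPlog : θ.cycLog (n + 2) P = 1 := by
    have := commProd_mem_commutator a z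
    exact (Abelianization.commutator_subset_ker (θ.cycLog (n + 2))) this
  have hvu : (u * P⁻¹).val - 1 - (u.val - P.val) ∈ complFilt (groupAug G) (n + 3) := by
    have e1 : (u * P⁻¹).val - 1 = 1 * (u.val - P.val) * (P⁻¹ : (GroupCompletion G)ˣ).val := by
      rw [one_mul, sub_mul, Units.mul_inv, Units.val_mul]
    rw [e1]
    exact mul_mul_sub_mem (map_one _) (complAug_val_inv hP1) h
  have hv : (u * P⁻¹).val - 1 ∈ complFilt (groupAug G) (n + 2) := by
    have := add_mem (complFilt_anti (by omega : n + 2 ≤ n + 3) hvu) h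
    rwa [sub_add_cancel] at this
  have hcyc : θ.cycPart (n + 2) (u.val - P.val) = 0 := by
    rw [← θ.cycPart_congr (sub_mem_complFilt.1 hvu), ← ofAdd_eq_one,
      ← θ.cycLog_of_mem hv (by omega), map_mul, map_inv, hu, hPlog, inv_one, one_mul]
  obtain ⟨w, hw⟩ := exists_commutators he hcyc
  choose W hW hWw using fun i => θ.exists_complPart_eq (n + 1) (w i)
  have hy : ∀ i, IsUnit (1 + W i) := fun i => isUnit_of_sub_one_mem (by
    rw [add_sub_cancel_left]; exact complFilt_anti (by omega) (hW i))
  choose y hy using hy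
  have hyW : ∀ i, (y i).val - 1 = W i := fun i => by rw [hy, add_sub_cancel_left]
  have hy1 : ∀ i, complAug (groupAug G) (y i) = 1 := fun i => by
    rw [complAug_eq_one_iff, hyW]; exact complFilt_anti (by omega) (hW i)
  have hX : ∀ i, (a i).val - 1 ∈ complFilt (groupAug G) 1 := fun i => complAug_eq_one_iff.1 (ha i)
  refine ⟨fun i => z i * y i, fun i => by rw [Units.val_mul, map_mul, hz, hy1, one_mul], ?_,
    fun i => ?_⟩
  · have h1 := commProd_sub_mem ha hz hy1 fun i => (hyW i).symm ▸ hW i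
    simp only [hyW] at h1
    rw [← hP] at h1
    have h2 : u.val - P.val - ∑ i, (((a i).val - 1) * W i - W i * ((a i).val - 1)) ∈
        complFilt (groupAug G) (n + 3) := by
      refine θ.mem_complFilt_succ (sub_mem h (sum_bracket_mem hX hW)) ?_
      refine toTensorAlgebra_injective (n + 2) ?_
      rw [map_zero, ← complCoeff_apply, map_sub, complCoeff_apply, hw, map_sum, sub_eq_zero]
      refine Finset.sum_congr rfl fun i _ => ?_
      have hWw' : θ.complCoeff (n + 1) (W i) = TensorPower.toTensorAlgebra (w i) := by
        rw [complCoeff_apply, hWw]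
      rw [map_sub, θ.complCoeff_mul_of_mem (hW i) (hX i), hae, hWw',
        show n + 2 = 1 + (n + 1) by omega, θ.complCoeff_mul_of_mem (hX i) (hW i), hae, hWw']
    have h3 := sub_mem h2 h1
    have e3 : ∀ p q r s : GroupCompletion G, p - q - s - (r - q - s) = p - r := fun p q r s => by
      abel
    rwa [e3] at h3
  · rw [Units.val_mul, hy, mul_add, mul_one, add_sub_cancel_left]
    exact mul_mem_complFilt_left _ (hW i)

/-- A unit with trivial logarithmic invariants is a product of boundedly many commutators. -/
theorem mem_commutator_of_cycLog_eq_one (he : Submodule.span ℚ (Set.range e) = ⊤)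
    (ha : ∀ i, complAug (groupAug G) (a i) = 1)
    (hae : ∀ i, θ.complCoeff 1 ((a i).val - 1) = TensorAlgebra.ι ℚ (e i))
    {u : (GroupCompletion G)ˣ} (hu1 : complAug (groupAug G) u = 1)
    (hu : ∀ n, θ.cycLog (n + 1) u = 1) : u ∈ commutator (GroupCompletion G)ˣ := by
  -- In degree one nothing is divided out in the coinvariants: the commutators there are with
  -- scalars. Hence the approximation can start at step two with all `z i = 1`.
  have hu2 : u.val - 1 ∈ complFilt (groupAug G) 2 := by
    have h1 := complAug_eq_one_iff.1 hu1
    refine θ.mem_complFilt_succ h1 (toTensorAlgebra_injective 1 ?_)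
    have h2 : θ.cycPart 1 (u.val - 1) = 0 := by
      rw [← ofAdd_eq_one, ← θ.cycLog_of_mem h1 (by omega), hu]
    obtain ⟨w, hw⟩ := exists_commutators he h2
    rw [hw, map_zero]
    refine Finset.sum_eq_zero fun i _ => ?_
    have h1 := toTensorAlgebra_mem 0 (w i)
    rw [pow_zero, Submodule.mem_one] at h1
    obtain ⟨q, hq⟩ := h1
    rw [← hq, Algebra.commutes, sub_self]
  let C : ℕ → Type _ := fun n => {z : Fin d → (GroupCompletion G)ˣ //
    (∀ i, complAug (groupAug G) (z i) = 1) ∧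
      u.val - (commProd a z).val ∈ complFilt (groupAug G) (n + 2)}
  have hstep : ∀ n (z : C n), ∃ z' : C (n + 1),
      ∀ i, (z'.1 i).val - (z.1 i).val ∈ complFilt (groupAug G) (n + 1) := by
    rintro n ⟨z, hz, h⟩
    obtain ⟨z', hz', h', h''⟩ := θ.exists_commProd_step he ha hae hu n hz h
    exact ⟨⟨z', hz', h'⟩, h''⟩
  choose F hF using hstep
  have h0 : commProd a (fun _ => 1) = 1 := by
    rw [commProd]
    exact List.prod_eq_one fun x hx => by
      obtain ⟨i, rfl⟩ := (List.mem_ofFn).1 hx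
      exact commutatorElement_one_right _
  let s : ∀ n, C n := fun n => Nat.rec
    ⟨fun _ => 1, fun _ => by simp, by rw [h0]; exact hu2⟩ F n
  have hs : ∀ n i, ((s (n + 1)).1 i).val - ((s n).1 i).val ∈ complFilt (groupAug G) (n + 1) :=
    fun n => hF n (s n)
  choose b hb using fun i => exists_limit (groupAug G) (fun n => ((s n).1 i).val) fun n =>
    sub_mem_complFilt.1 (complFilt_anti n.le_succ (hs n i))
  have hb1 : ∀ i, complAug (groupAug G) (b i) = 1 := by
    intro i
    have h := complAug_eq_zero_iff.2 (sub_mem_complFilt.2 (hb i 1))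
    rwa [map_sub, (s 1).2.1 i, sub_eq_zero] at h
  choose z hz using fun i => isUnit_of_complAug_ne_zero ((hb1 i).trans_ne one_ne_zero)
  -- The number of commutators is the same at every stage, so at level `n` the product for the
  -- limits `z` is the product for the `n`-th approximation.
  have hzu : commProd a z = u := by
    refine Units.ext (AugCompletion.ext fun n => ?_)
    have h1 := sub_mem_complFilt.1 (complFilt_anti (by omega : n ≤ n + 2) (s n).2.2)
    rw [h1]
    have h2 : Units.map (complProj (groupAug G) n).toRingHom.toMonoidHom (commProd a z) =
        Units.map (complProj (groupAug G) n).toRingHom.toMonoidHom (commProd a (s n).1) := by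
      rw [map_commProd, map_commProd]
      congr 1
      funext i
      refine Units.ext ?_
      show complProj (groupAug G) n (z i).val = complProj (groupAug G) n ((s n).1 i).val
      rw [hz, hb]
    exact congrArg Units.val h2
  rw [← hzu]
  exact commProd_mem_commutator a z

end MagnusExpansion

theorem IsFreeBasis.comp_equiv {ι κ G : Type*} [Group G] {l : ι → G} (h : IsFreeBasis l)
    (e : κ ≃ ι) : IsFreeBasis (l ∘ e) := by
  refine ⟨by rw [e.surjective.range_comp]; exact h.1, fun K _ c => ?_⟩
  obtain ⟨f, hf⟩ := h.2 K (c ∘ e.symm)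
  exact ⟨f, fun i => by simp [hf]⟩

/-! ### Geometric series in the completed tensor algebra -/

section GeometricSeries

variable {H : Type*} [AddCommGroup H] [Module ℚ H]

theorem geomSeries_mul (x : TensorAlgebra ℚ H) :
    (1 - PowerSeries.C x * PowerSeries.X) * PowerSeries.mk (fun n => x ^ n) = 1 := by
  ext n
  rw [sub_mul, one_mul, mul_assoc, map_sub, PowerSeries.coeff_C_mul, PowerSeries.coeff_one]
  cases n with
  | zero => simp
  | succ n => simp [PowerSeries.coeff_succ_X_mul, pow_succ']

theorem mul_geomSeries (x : TensorAlgebra ℚ H) :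
    PowerSeries.mk (fun n => x ^ n) * (1 - PowerSeries.C x * PowerSeries.X) = 1 := by
  ext n
  rw [mul_sub, mul_one, ← mul_assoc, map_sub, PowerSeries.coeff_one]
  cases n with
  | zero => simp
  | succ n => simp [PowerSeries.coeff_succ_mul_X, PowerSeries.coeff_mul_C, pow_succ]

/-- The geometric series of an element of degree `1`. -/
def geomUnit (m : H) : (complTensor H)ˣ where
  val := ⟨PowerSeries.mk fun n => TensorAlgebra.ι ℚ m ^ n, fun n => by
    rw [PowerSeries.coeff_mk]
    exact Submodule.pow_mem_pow _ (LinearMap.mem_range_self _ m) n⟩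
  inv := ⟨1 - PowerSeries.C (TensorAlgebra.ι ℚ m) * PowerSeries.X, by
    refine sub_mem (one_mem (complTensor H)) fun n => ?_
    rw [PowerSeries.coeff_C_mul, PowerSeries.coeff_X]
    split_ifs with h
    · rw [mul_one, h, pow_one]; exact LinearMap.mem_range_self _ m
    · rw [mul_zero]; exact Submodule.zero_mem _⟩
  val_inv := Subtype.ext (mul_geomSeries _)
  inv_val := Subtype.ext (geomSeries_mul _)

theorem coeff_geomUnit (m : H) (n : ℕ) :
    PowerSeries.coeff n (geomUnit m).val.1 = TensorAlgebra.ι ℚ m ^ n :=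
  PowerSeries.coeff_mk n fun n => TensorAlgebra.ι ℚ m ^ n

theorem coeff_geomUnit_inv (m : H) (n : ℕ) :
    PowerSeries.coeff n ((geomUnit m)⁻¹ : (complTensor H)ˣ).val.1 =
      if n = 0 then 1 else if n = 1 then -TensorAlgebra.ι ℚ m else 0 := by
  show PowerSeries.coeff n (1 - PowerSeries.C (TensorAlgebra.ι ℚ m) * PowerSeries.X) = _
  rw [map_sub, PowerSeries.coeff_C_mul, PowerSeries.coeff_X, PowerSeries.coeff_one]
  split_ifs <;> simp_all

/-- A square `m ⊗ m` does not vanish in the cyclic coinvariants. -/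
theorem cycClass_sq_ne_zero {ι : Type*} [Fintype ι] {e : ι → H}
    (he : Submodule.span ℚ (Set.range e) = ⊤) (ψ : H →ₗ[ℚ] ℚ) {m : H} (hm : ψ m = 1) :
    cycClass H 2 (TensorAlgebra.ι ℚ m ^ 2) ≠ 0 := by
  intro h
  obtain ⟨w, hw⟩ := exists_commutators he h
  rw [toTensorAlgebra_tensorDeg
    (Submodule.pow_mem_pow _ (LinearMap.mem_range_self (TensorAlgebra.ι ℚ) m) 2)] at hw
  -- The algebra map to the commutative ring `ℚ` that extends `ψ` kills all commutators, but sends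
  -- `m ⊗ m` to `1`.
  have h2 := congrArg (TensorAlgebra.lift ℚ ψ) hw
  rw [map_pow, TensorAlgebra.lift_ι_apply, hm, map_sum, Finset.sum_eq_zero, one_pow] at h2
  · exact one_ne_zero h2
  · intro i _
    rw [map_sub, map_mul, map_mul, mul_comm, sub_self]

end GeometricSeries

/-! ### Magnus expansions of free groups and the isomorphisms on `K₁` -/

section FreeBasis

variable {G : Type} [Group G]

/-- Under products and inverses of series with constant term `1`, the linear coefficient behaves
additively, as `ratClass` does. So the leading terms need only be checked on generators. -/
theorem coeff_hom_of_closure {ι : Type*} {l : ι → G} (hl : Subgroup.closure (Set.range l) = ⊤)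
    (f : G →* complTensor (RatHOne G)) (h0 : ∀ i, PowerSeries.coeff 0 (f (l i)).1 = 1)
    (h1 : ∀ i, PowerSeries.coeff 1 (f (l i)).1 = TensorAlgebra.ι ℚ (ratClass (l i))) (x : G) :
    PowerSeries.coeff 0 (f x).1 = 1 ∧
      PowerSeries.coeff 1 (f x).1 = TensorAlgebra.ι ℚ (ratClass x) := by
  have m0 : ∀ u v : complTensor (RatHOne G), PowerSeries.coeff 0 (u * v).1 =
      PowerSeries.coeff 0 u.1 * PowerSeries.coeff 0 v.1 := fun u v => by
    rw [MulMemClass.coe_mul, PowerSeries.coeff_mul]; simp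
  have m1 : ∀ u v : complTensor (RatHOne G), PowerSeries.coeff 1 (u * v).1 =
      PowerSeries.coeff 0 u.1 * PowerSeries.coeff 1 v.1 +
        PowerSeries.coeff 1 u.1 * PowerSeries.coeff 0 v.1 := fun u v => by
    rw [MulMemClass.coe_mul, PowerSeries.coeff_mul, Finset.Nat.antidiagonal_succ]; simp
  have o0 : PowerSeries.coeff 0 (1 : complTensor (RatHOne G)).1 = 1 := by
    rw [OneMemClass.coe_one, PowerSeries.coeff_one, if_pos rfl]
  have o1 : PowerSeries.coeff 1 (1 : complTensor (RatHOne G)).1 = 0 := by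
    rw [OneMemClass.coe_one, PowerSeries.coeff_one, if_neg one_ne_zero]
  have hx : x ∈ Subgroup.closure (Set.range l) := hl ▸ Subgroup.mem_top x
  induction hx using Subgroup.closure_induction with
  | mem x hx => obtain ⟨i, rfl⟩ := hx; exact ⟨h0 i, h1 i⟩
  | one => rw [map_one, o0, o1, ratClass_one, map_zero]; exact ⟨rfl, rfl⟩
  | mul x y _ _ hx hy =>
    rw [map_mul, m0, m1, hx.1, hy.1, hx.2, hy.2, ratClass_mul, map_add, one_mul, one_mul, mul_one,
      add_comm]
    exact ⟨rfl, rfl⟩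
  | inv x _ hx =>
    have e : f x⁻¹ * f x = 1 := by rw [← map_mul, inv_mul_cancel, map_one]
    have e0 := m0 (f x⁻¹) (f x)
    have e1 := m1 (f x⁻¹) (f x)
    rw [e, o0, hx.1, mul_one] at e0
    rw [e, o1, ← e0, hx.1, hx.2, one_mul, mul_one] at e1
    refine ⟨e0.symm, ?_⟩
    have e2 := ratClass_mul x⁻¹ x
    rw [inv_mul_cancel, ratClass_one] at e2
    rw [eq_neg_of_add_eq_zero_left e2.symm, map_neg]
    exact eq_neg_of_add_eq_zero_right e1.symm

/-- A Magnus expansion with prescribed values on a basis. -/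
theorem IsFreeBasis.exists_magnusExpansion {ι : Type*} {l : ι → G} (hl : IsFreeBasis l)
    (T : ι → (complTensor (RatHOne G))ˣ) (h0 : ∀ i, PowerSeries.coeff 0 (T i).val.1 = 1)
    (h1 : ∀ i, PowerSeries.coeff 1 (T i).val.1 = TensorAlgebra.ι ℚ (ratClass (l i))) :
    ∃ θ : MagnusExpansion G, ∀ i, θ.toHom (l i) = T i := by
  obtain ⟨f, hf⟩ := hl.2 _ T
  have hf' : ∀ i, ((Units.coeHom _).comp f) (l i) = T i := fun i => congrArg Units.val (hf i)
  have key := coeff_hom_of_closure hl.1 ((Units.coeHom _).comp f)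
    (fun i => by rw [hf', h0]) (fun i => by rw [hf', h1])
  exact ⟨⟨(Units.coeHom _).comp f, fun x => (key x).1, fun x => (key x).2⟩, hf'⟩

theorem IsFreeBasis.exists_functional {ι : Type*} {l : ι → G} (hl : IsFreeBasis l) (i : ι) :
    ∃ ψ : RatHOne G →ₗ[ℚ] ℚ, ψ (ratClass (l i)) = 1 := by
  obtain ⟨f, hf⟩ := hl.2 (Multiplicative ℚ) fun _ => Multiplicative.ofAdd 1
  let F : Additive (Abelianization G) →+ ℚ := MonoidHom.toAdditiveLeft (Abelianization.lift f)
  refine ⟨LinearMap.liftBaseChange ℚ F.toIntLinearMap, ?_⟩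
  rw [ratClass, LinearMap.liftBaseChange_tmul, one_smul]
  exact congrArg Multiplicative.toAdd (hf i)

variable (G) in
/-- The group elements as units of the completion. -/
def groupUnit : G →* (GroupCompletion G)ˣ :=
  ((toCompl (groupAug G) : MonoidAlgebra ℚ G →* GroupCompletion G).comp
    (MonoidAlgebra.of ℚ G)).toHomUnits

theorem groupUnit_val (x : G) :
    (groupUnit G x).val = toCompl (groupAug G) (MonoidAlgebra.single x 1) := rfl

theorem complAug_groupUnit (x : G) : complAug (groupAug G) (groupUnit G x) = 1 := by
  rw [groupUnit_val, complAug_toCompl]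
  simp [groupAug]

theorem MagnusExpansion.complCoeff_groupUnit_sub_one (θ : MagnusExpansion G) {n : ℕ} (hn : n ≠ 0)
    (x : G) : θ.complCoeff n ((groupUnit G x).val - 1) = PowerSeries.coeff n (θ.toHom x).1 := by
  rw [groupUnit_val, ← map_one (toCompl (groupAug G)), ← map_sub, complCoeff_apply,
    complPart_toCompl]
  exact θ.coeffMap_sub_one hn x

variable {d : ℕ} {l : Fin d → G}

theorem MagnusExpansion.mem_commutator_of_mk_eq_one (θ : MagnusExpansion G)
    (hl : Subgroup.closure (Set.range l) = ⊤) {u : (GroupCompletion G)ˣ}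
    (hdet : Matrix.GeneralLinearGroup.det (augGL (groupAug G)
      (Units.map (Matrix.scalar (Fin 1)).toMonoidHom u)) = 1)
    (hlog : θ.cyclicPart (trLog (groupAug G)
      (Units.map (Matrix.scalar (Fin 1)).toMonoidHom u)) = 0) :
    u ∈ commutator (GroupCompletion G)ˣ := by
  refine θ.mem_commutator_of_cycLog_eq_one (a := fun i => groupUnit G (l i))
    (span_ratClass_of_closure hl) (fun i => complAug_groupUnit _)
    (fun i => by rw [θ.complCoeff_groupUnit_sub_one one_ne_zero, θ.coeff_one]) ?_ fun n => ?_
  · have h := congrArg Units.val hdet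
    simpa [Matrix.GeneralLinearGroup.val_det_apply, augGL] using h
  · exact congrArg Multiplicative.ofAdd (congrFun hlog n.succPNat)

theorem KOne.ofUnitHom_groupCompletion_surjective :
    Function.Surjective (KOne.ofUnitHom (R := GroupCompletion G)) :=
  KOne.ofUnitHom_surjective (complAug (groupAug G)).toRingHom fun _ => isUnit_of_complAug_ne_zero

/-- `Φ_θ` factors through `K₁`, and its kernel on units already consists of products of commutators
of units. -/
theorem KOne.ofUnitHom_eq_one_iff (θ : MagnusExpansion G)
    (hl : Subgroup.closure (Set.range l) = ⊤) {u : (GroupCompletion G)ˣ} :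
    KOne.ofUnitHom u = 1 ↔ u ∈ commutator (GroupCompletion G)ˣ := by
  refine ⟨fun h => ?_, fun h => Abelianization.commutator_subset_ker KOne.ofUnitHom h⟩
  obtain ⟨Φ, hΦ⟩ := θ.exists_phi
  have h1 := congrArg Φ h
  rw [ofUnitHom_apply, ofUnit, hΦ, map_one] at h1
  exact θ.mem_commutator_of_mk_eq_one hl (congrArg Prod.fst h1) (congrArg Prod.snd h1)

/-- The Dieudonné determinant. -/
theorem exists_dieudonne (θ : MagnusExpansion G) (hl : Subgroup.closure (Set.range l) = ⊤) :
    ∃ D : KOne (GroupCompletion G) ≃* Abelianization (GroupCompletion G)ˣ,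
      ∀ u, D (KOne.ofUnit u) = Abelianization.of u := by
  let φ : Abelianization (GroupCompletion G)ˣ →* KOne (GroupCompletion G) :=
    Abelianization.lift KOne.ofUnitHom
  have hφ : Function.Bijective φ := by
    refine ⟨(injective_iff_map_eq_one φ).2 fun x hx => ?_, fun κ => ?_⟩
    · obtain ⟨u, rfl⟩ := QuotientGroup.mk_surjective x
      exact (QuotientGroup.eq_one_iff u).2 ((KOne.ofUnitHom_eq_one_iff θ hl).1 hx)
    · obtain ⟨u, rfl⟩ := KOne.ofUnitHom_groupCompletion_surjective κ
      exact ⟨Abelianization.of u, rfl⟩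
  refine ⟨(MulEquiv.ofBijective φ hφ).symm, fun u => ?_⟩
  rw [MulEquiv.symm_apply_eq]
  rfl

theorem MagnusExpansion.exists_phiEquiv (θ : MagnusExpansion G)
    (hl : Subgroup.closure (Set.range l) = ⊤) :
    ∃ Φ : KOne (GroupCompletion G) ≃*
        ℚˣ × Multiplicative ((n : ℕ+) → CyclicTensor (RatHOne G) n),
      ∀ (N : ℕ) (A : (Matrix (Fin N) (Fin N) (GroupCompletion G))ˣ), Φ (KOne.mk N A) =
        (Matrix.GeneralLinearGroup.det (augGL (groupAug G) A),
          Multiplicative.ofAdd (θ.cyclicPart (trLog (groupAug G) A))) := by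
  obtain ⟨Φ, hΦ⟩ := θ.exists_phi
  have hbij : Function.Bijective Φ := by
    refine ⟨(injective_iff_map_eq_one Φ).2 fun κ hκ => ?_, fun ⟨q, c⟩ => ?_⟩
    · obtain ⟨u, rfl⟩ := KOne.ofUnitHom_groupCompletion_surjective κ
      rw [KOne.ofUnitHom_apply, KOne.ofUnit, hΦ] at hκ
      exact (KOne.ofUnitHom_eq_one_iff θ hl).2
        (θ.mem_commutator_of_mk_eq_one hl (congrArg Prod.fst hκ) (congrArg Prod.snd hκ))
    · obtain ⟨u, hu, hc⟩ := θ.exists_unit_cycLog_eq q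
        fun n => if h : 0 < n then Multiplicative.ofAdd (c.toAdd ⟨n, h⟩) else 1
      refine ⟨KOne.ofUnit u, ?_⟩
      rw [KOne.ofUnit, hΦ]
      refine Prod.ext (Units.ext ?_) (funext fun n => ?_)
      · simpa [Matrix.GeneralLinearGroup.val_det_apply, augGL] using hu
      · obtain ⟨n, rfl⟩ : ∃ k : ℕ, n = k.succPNat := ⟨n.natPred, by simp⟩
        exact (hc n).trans (dif_pos n.succ_pos)
  exact ⟨MulEquiv.ofBijective Φ hbij, hΦ⟩

theorem exists_trans_ofAdd {K Q V W : Type*} [Group K] [Group Q] [AddCommGroup V] [AddCommGroup W]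
    (F : K ≃* Q × Multiplicative V) (t : V ≃+ W) : ∃ Φ : K ≃* Q × Multiplicative W,
      ∀ κ, Φ κ = ((F κ).1, Multiplicative.ofAdd (t (F κ).2.toAdd)) :=
  ⟨F.trans ((MulEquiv.refl Q).prodCongr t.toMultiplicative), fun _ => rfl⟩

/-- The logarithmic determinant. -/
theorem MagnusExpansion.exists_ldet (θ : MagnusExpansion G)
    (hl : Subgroup.closure (Set.range l) = ⊤) :
    ∃ D : KOne (GroupCompletion G) ≃* ℚˣ × Multiplicative (LieHOne (groupAug G)),
      ∀ (N : ℕ) (A : (Matrix (Fin N) (Fin N) (GroupCompletion G))ˣ), D (KOne.mk N A) =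
        (Matrix.GeneralLinearGroup.det (augGL (groupAug G) A), Multiplicative.ofAdd
          (Submodule.Quotient.mk ⟨trLog (groupAug G) A, trLog_mem_complIdeal (groupAug G) A⟩)) := by
  obtain ⟨Φ, hΦ⟩ := θ.exists_phiEquiv hl
  obtain ⟨t, ht⟩ := θ.exists_thetaStar (span_ratClass_of_closure hl)
  -- Pulled back along `θ_*`, the formula for `Φ_θ` no longer involves `θ`.
  obtain ⟨D, hD⟩ := exists_trans_ofAdd Φ t.symm.toAddEquiv
  refine ⟨D, fun N A => ?_⟩
  rw [hD, hΦ]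
  refine Prod.ext rfl (congrArg Multiplicative.ofAdd ?_)
  exact (LinearEquiv.symm_apply_eq t).2
    (ht ⟨trLog (groupAug G) A, trLog_mem_complIdeal (groupAug G) A⟩).symm

/-- In degree two only `(x - 1) - (x - 1)² / 2` contributes, and `(x - 1)²` has leading term `[x]²`.
-/
theorem MagnusExpansion.cycPart_two_trLog (θ : MagnusExpansion G) (x : G) :
    θ.cycPart 2 (trLog (groupAug G) (Units.map (Matrix.scalar (Fin 1)).toMonoidHom
      (groupUnit G x))) = cycClass (RatHOne G) 2 (PowerSeries.coeff 2 (θ.toHom x).1) -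
        (1 / 2 : ℚ) • cycClass (RatHOne G) 2 (TensorAlgebra.ι ℚ (ratClass x) ^ 2) := by
  set U := Units.map (Matrix.scalar (Fin 1)).toMonoidHom (groupUnit G x) with hU
  have hx : (groupUnit G x).val - 1 ∈ complFilt (groupAug G) 1 :=
    complAug_eq_one_iff.1 (complAug_groupUnit x)
  have hX : U.val - 1 = Matrix.scalar (Fin 1) ((groupUnit G x).val - 1) := by
    rw [map_sub, map_one]; rfl
  have hmem : U.val - 1 ∈ matFilt (groupAug G) 1 1 := by
    intro i j
    rw [hX, Subsingleton.elim i j]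
    simpa using hx
  have h1 : θ.complCoeff 2 (((groupUnit G x).val - 1) ^ 2) = TensorAlgebra.ι ℚ (ratClass x) ^ 2 := by
    rw [pow_two, pow_two, θ.complCoeff_mul_of_mem (m := 1) (n := 1) hx hx,
      θ.complCoeff_groupUnit_sub_one one_ne_zero, θ.coeff_one]
  rw [cycPart_trLog, normalizeGL_of_augGL_eq_one _ ((sub_one_mem_matFilt _).1 hmem), truncLog,
    Finset.sum_range_succ, Finset.sum_range_succ, Finset.sum_range_one, map_add, map_add,
    map_smul, map_smul, map_smul,
    θ.cycTrace_eq_zero (by omega : 2 < 1 * (2 + 1)) (pow_mem_matFilt hmem (2 + 1)), hX,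
    ← map_pow, ← map_pow, cycTrace_apply, cycTrace_apply,
    ← θ.complCoeff_groupUnit_sub_one two_ne_zero, ← h1, ← cycPart_eq, ← cycPart_eq]
  simp [Matrix.trace]
  module

/-- One expansion sends the generators to `1 + [l i] + [l i]² + ⋯`, the other to `1 + [l i]`. The
logarithms of one generator differ in degree two by the class of `[l i]²`, which is not zero. -/
theorem IsFreeBasis.exists_trLog_ne (hl : IsFreeBasis l) (i : Fin d) :
    ∃ (θ θ' : MagnusExpansion G) (N : ℕ) (A : (Matrix (Fin N) (Fin N) (GroupCompletion G))ˣ),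
      θ.cyclicPart (trLog (groupAug G) A) ≠ θ'.cyclicPart (trLog (groupAug G) A) := by
  obtain ⟨θ, hθ⟩ := hl.exists_magnusExpansion (fun i => geomUnit (ratClass (l i)))
    (fun i => by rw [coeff_geomUnit, pow_zero]) (fun i => by rw [coeff_geomUnit, pow_one])
  obtain ⟨θ', hθ'⟩ := hl.exists_magnusExpansion (fun i => (geomUnit (-ratClass (l i)))⁻¹)
    (fun i => by rw [coeff_geomUnit_inv]; simp) (fun i => by rw [coeff_geomUnit_inv]; simp)
  obtain ⟨ψ, hψ⟩ := hl.exists_functional i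
  refine ⟨θ, θ', 1, Units.map (Matrix.scalar (Fin 1)).toMonoidHom (groupUnit G (l i)), fun h => ?_⟩
  have h2 : θ.cycPart 2 _ = θ'.cycPart 2 _ := congrFun h 2
  rw [θ.cycPart_two_trLog, θ'.cycPart_two_trLog, sub_left_inj, hθ, hθ', coeff_geomUnit,
    coeff_geomUnit_inv, if_neg two_ne_zero, if_neg (by decide), map_zero] at h2
  exact cycClass_sq_ne_zero (span_ratClass_of_closure hl.1) ψ hψ h2

end FreeBasis

end

/-! ### Assembly -/

theorem theorem1p1 (g : ℕ) (x₀ : Surface g) :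
    ∃ (dieudonne : KOne (GroupCompletion (SurfaceGroup g x₀)) ≃*
          Abelianization (GroupCompletion (SurfaceGroup g x₀))ˣ)
      (ldet : KOne (GroupCompletion (SurfaceGroup g x₀)) ≃*
          ℚˣ × Multiplicative (LieHOne (groupAug (SurfaceGroup g x₀)))),
      -- the Dieudonné determinant inverts the map induced by `R̂ˣ = GL(1, R̂) → K₁(R̂)`
      (∀ u : (GroupCompletion (SurfaceGroup g x₀))ˣ,
        dieudonne (KOne.ofUnit u) = Abelianization.of u) ∧
      -- `ldet` is `A ↦ (det ε(A), tr log (A ε(A)⁻¹))`, with values in `ℚˣ × H₁^Lie(Î)`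
      (∀ (N : ℕ) (A : (Matrix (Fin N) (Fin N) (GroupCompletion (SurfaceGroup g x₀)))ˣ),
        Summable (logTerm (groupAug (SurfaceGroup g x₀))
          (normalizeGL (groupAug (SurfaceGroup g x₀)) A).val) ∧
        ∃ y : complIdeal (groupAug (SurfaceGroup g x₀)),
          (y : GroupCompletion (SurfaceGroup g x₀)) = trLog (groupAug (SurfaceGroup g x₀)) A ∧
          ldet (KOne.mk N A) =
            (Matrix.GeneralLinearGroup.det (augGL (groupAug (SurfaceGroup g x₀)) A),
              Multiplicative.ofAdd (Submodule.Quotient.mk y))) ∧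
      Nonempty (MagnusExpansion (SurfaceGroup g x₀)) ∧
      -- every Magnus expansion gives an isomorphism
      (∀ θ : MagnusExpansion (SurfaceGroup g x₀),
        ∃ (thetaStar : LieHOne (groupAug (SurfaceGroup g x₀)) ≃ₗ[ℚ]
              ((n : ℕ+) → CyclicTensor (RatHOne (SurfaceGroup g x₀)) n))
          (Φ : KOne (GroupCompletion (SurfaceGroup g x₀)) ≃*
              ℚˣ × Multiplicative ((n : ℕ+) → CyclicTensor (RatHOne (SurfaceGroup g x₀)) n)),
          (∀ y : complIdeal (groupAug (SurfaceGroup g x₀)),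
            thetaStar (Submodule.Quotient.mk y) = θ.cyclicPart y) ∧
          (∀ κ : KOne (GroupCompletion (SurfaceGroup g x₀)),
            Φ κ = ((ldet κ).1, Multiplicative.ofAdd (thetaStar (ldet κ).2.toAdd))) ∧
          ∀ (N : ℕ) (A : (Matrix (Fin N) (Fin N) (GroupCompletion (SurfaceGroup g x₀)))ˣ),
            Φ (KOne.mk N A) =
              (Matrix.GeneralLinearGroup.det (augGL (groupAug (SurfaceGroup g x₀)) A),
                Multiplicative.ofAdd (θ.cyclicPart (trLog (groupAug (SurfaceGroup g x₀)) A)))) ∧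
      -- the isomorphism depends on the Magnus expansion
      (0 < g → ∃ (θ θ' : MagnusExpansion (SurfaceGroup g x₀)) (N : ℕ)
        (A : (Matrix (Fin N) (Fin N) (GroupCompletion (SurfaceGroup g x₀)))ˣ),
        θ.cyclicPart (trLog (groupAug (SurfaceGroup g x₀)) A) ≠
          θ'.cyclicPart (trLog (groupAug (SurfaceGroup g x₀)) A)) := by
  obtain ⟨l₀, hl₀⟩ := exists_isFreeBasis_surfaceGroup x₀
  have hcard : Fintype.card (Fin g × Bool) = g * 2 := by simp
  have hl := hl₀.comp_equiv (Fintype.equivFinOfCardEq hcard).symm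
  set l := l₀ ∘ (Fintype.equivFinOfCardEq hcard).symm
  -- `θ₀` is auxiliary: the maps built from it are determined by formulas that do not mention it.
  obtain ⟨θ₀, -⟩ := hl.exists_magnusExpansion (fun i => geomUnit (ratClass (l i)))
    (fun i => by rw [coeff_geomUnit, pow_zero]) (fun i => by rw [coeff_geomUnit, pow_one])
  have hspan := span_ratClass_of_closure hl.1
  obtain ⟨D, hD⟩ := exists_dieudonne θ₀ hl.1
  obtain ⟨ldet, hldet⟩ := θ₀.exists_ldet hl.1
  refine ⟨D, ldet, hD, fun N A => ⟨summable_logTerm (normalizeGL_sub_one_mem _ A),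
    ⟨_, trLog_mem_complIdeal _ A⟩, rfl, hldet N A⟩, ⟨θ₀⟩, fun θ => ?_,
    fun hg => hl.exists_trLog_ne ⟨0, by omega⟩⟩
  obtain ⟨t, ht⟩ := θ.exists_thetaStar hspan
  obtain ⟨Φ, hΦ⟩ := exists_trans_ofAdd ldet t.toAddEquiv
  refine ⟨t, Φ, ht, hΦ, fun N A => ?_⟩
  rw [hΦ, hldet]
  exact Prod.ext rfl (congrArg Multiplicative.ofAdd (ht ⟨trLog _ A, trLog_mem_complIdeal _ A⟩))
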